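/- Let $n\ge 2$ and $\ell\ge 2$ be integers. For $k\in\mathbb Z$ write uniquely $k=c+n(d-1)-n\ell m$ with $1\le c\le n$, $1\le d\le\ell$, $m\in\mathbb Z$. For $s\in\mathbb Z$ let $P(s)$ be the set of integer sequences $\mathbf k=(k_1,k_2,\dots)$ with $k_r=s-r+1$ for all large $r$, and let $\Lambda^s$ be the $\mathbb Q(q)$-vector space spanned by the symbols $u_{\mathbf k}=u_{k_1}\wedge u_{k_2}\wedge\cdots$ ($\mathbf k\in P(s)$) modulo the straightening rules, applied to adjacent factors: for $k_2\le k_1$ with labels $(c_i,d_i,m_i)$ of $k_i$, $$u_{k_2}\wedge u_{k_1}=(-q^{-1})^{[d_1=d_2]}\Bigl\{q^{[c_1=c_2]}\,u_{k_1}\wedge u_{k_2}+(q-q^{-1})\sum_{i=[c_1\le c_2]}^{m_2-m_1-[d_1\le d_2]}u_{k_1-c_1+c_2-n\ell i}\wedge u_{k_2+c_1-c_2+n\ell i}\Bigr\},$$ where $[\cdot]$ is $1$ or $0$ according to whether the condition holds. The bar involution of $\Lambda^s$ is the involution, semilinear with respect to $q\mapsto q^{-1}$, with $$\overline{u_{\mathbf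 k}}=(-q)^{\kappa(d_1,\dots,d_r)}q^{-\kappa(c_1,\dots,c_r)}\,u_{k_r}\wedge\cdots\wedge u_{k_1}\wedge u_{k_{r+1}}\wedge u_{k_{r+2}}\wedge\cdots$$ for all sufficiently large $r$, where $(c_i,d_i,m_i)$ are now the labels of the $i$-th entry $k_i$ of $\mathbf k$ and $\kappa(a_1,\dots,a_r)=\#\{(i,i')\mid i<i',\ a_i=a_{i'}\}$. For an $\ell$-tuple $\boldsymbol\lambda=(\lambda^{(1)},\dots,\lambda^{(\ell)})$ of Young diagrams and $\mathbf s=(s_1,\dots,s_\ell)\in\mathbb Z^\ell$ with $\sum_d s_d=s$, let $|\boldsymbol\lambda;\mathbf s\rangle=u_{\mathbf k}\in\Lambda^s$, where $\mathbf k$ is the strictly decreasing sequence whose entries are the integers $c+n(d-1)-n\ell m$ with $1\le c\le n$, $1\le d\le \ell$, $m\in\mathbb Z$ and $c-nm\in\{\lambda^{(d)}_r+s_d-r+1\mid r\ge1\}$. Let $F_q[\mathbf s]=\bigoplus_{\boldsymbol\lambda}\mathbb Q(q)\,|\boldsymbol\lambda;\mathbf s\rangle\subseteq\Lambda^s$,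 and for $\varepsilon\in\{+,-\}$ let $\mathcal L^\varepsilon=\bigoplus_{\boldsymbol\lambda}\mathbb Q[q^{\varepsilon1}]\,|\boldsymbol\lambda;\mathbf s\rangle$. The canonical basis $\{G^\varepsilon(\boldsymbol\lambda;\mathbf s)\}_{\boldsymbol\lambda}$ is the basis of $F_q[\mathbf s]$ such that $\overline{G^\varepsilon(\boldsymbol\lambda;\mathbf s)}=G^\varepsilon(\boldsymbol\lambda;\mathbf s)$ and $G^\varepsilon(\boldsymbol\lambda;\mathbf s)\equiv|\boldsymbol\lambda;\mathbf s\rangle \bmod q^{\varepsilon1}\mathcal L^\varepsilon$, and the $q$-decomposition numbers of level $\ell$ are defined by $G^\varepsilon(\boldsymbol\lambda;\mathbf s)=\sum_{\boldsymbol\mu}\Delta^\varepsilon_{\boldsymbol\lambda,\boldsymbol\mu;\mathbf s}(q)\,|\boldsymbol\mu;\mathbf s\rangle$. The same definitions are used for level $\ell-1$, with the same $n$. Theorem B. Let $\varepsilon\in\{+,-\}$, $\mathbf s\in\mathbb Z^\ell$, $1\le j\le\ell$, and let $\boldsymbol\lambda,\boldsymbol\mu$ be $\ell$-tuples of Young diagrams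 such that $|\boldsymbol\lambda|=|\boldsymbol\mu|$ or $\lambda^{(j)}=\emptyset$, where $|\cdot|$ is the total number of boxes. Let $\check{\boldsymbol\lambda},\check{\boldsymbol\mu},\check{\mathbf s}$ be obtained from $\boldsymbol\lambda,\boldsymbol\mu,\mathbf s$ by omitting the $j$-th component. If $s_i-s_j\ge|\boldsymbol\mu|$ for all $i\ne j$, and $\mu^{(j)}=\emptyset$, then the canonical bases of $F_q[\mathbf s]$ (level $\ell$) and of $F_q[\check{\mathbf s}]$ (level $\ell-1$) exist and are unique, and $$\Delta^\varepsilon_{\boldsymbol\lambda,\boldsymbol\mu;\mathbf s}(q)=\Delta^\varepsilon_{\check{\boldsymbol\lambda},\check{\boldsymbol\mu};\check{\mathbf s}}(q).$$ -/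

import Mathlib

open Filter

namespace QFock

noncomputable section

/-! ### The field `ℚ(q)` and the automorphism `q ↦ q⁻¹` -/

/-- The field `ℚ(q)`. -/
abbrev Kq : Type := RatFunc ℚ

/-- The indeterminate `q`. -/
def q : Kq := RatFunc.X

theorem aeval_q_inv_injective :
    Function.Injective (Polynomial.aeval (R := ℚ) (q⁻¹ : Kq)) := by
  refine transcendental_iff_injective.mp fun h => ?_
  have h2 : IsAlgebraic ℚ (q⁻¹⁻¹ : Kq) := h.inv
  rw [inv_inv] at h2
  refine RatFunc.transcendental_X (K := ℚ) ?_
  convert! h2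
  exact Subsingleton.elim _ _

/-- The `ℚ`-algebra endomorphism of `ℚ(q)` with `q ↦ q⁻¹`. -/
def conj : Kq →+* Kq :=
  RatFunc.liftRingHom (Polynomial.aeval (R := ℚ) (q⁻¹ : Kq)).toRingHom
    (nonZeroDivisors_le_comap_nonZeroDivisors_of_injective _ aeval_q_inv_injective)

theorem conj_q : conj q = q⁻¹ := by
  have h := RatFunc.liftRingHom_algebraMap (Polynomial.aeval (R := ℚ) (q⁻¹ : Kq)).toRingHom
    (nonZeroDivisors_le_comap_nonZeroDivisors_of_injective _ aeval_q_inv_injective)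
    (Polynomial.X : Polynomial ℚ)
  rw [RatFunc.algebraMap_X] at h
  simp [conj, q]

/-! ### The labels `c`, `d`, `m` of an integer -/

/-- The integer `c ∈ {1, …, n}` in `k = c + n (d - 1) - n ℓ m`. -/
def cPart (n : ℕ) (k : ℤ) : ℤ := (k - 1) % n + 1

/-- The integer `d ∈ {1, …, ℓ}` in `k = c + n (d - 1) - n ℓ m`. -/
def dPart (n ℓ : ℕ) (k : ℤ) : ℤ := (k - 1) / n % ℓ + 1

/-- The integer `m` in `k = c + n (d - 1) - n ℓ m`. -/
def mPart (n ℓ : ℕ) (k : ℤ) : ℤ := -((k - 1) / n / ℓ)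

theorem cdm_eq (n ℓ : ℕ) (k : ℤ) :
    k = cPart n k + n * (dPart n ℓ k - 1) - n * ℓ * mPart n ℓ k := by
  have h1 := Int.emod_add_mul_ediv (k - 1) n
  have h2 := Int.emod_add_mul_ediv ((k - 1) / n) ℓ
  unfold cPart dPart mPart
  linear_combination -h1 - (n : ℤ) * h2

/-- The position `k = c + n d - n ℓ m` of the bead `x = c - n m` (`1 ≤ c ≤ n`) on the abacus
with index `d ∈ {0, …, ℓ - 1}`; thus `u_k` is the vector written `u_x^{(d + 1)}`. -/
def pos (n ℓ : ℕ) (d : Fin ℓ) (x : ℤ) : ℤ := (x - 1) % n + 1 + n * (d : ℕ) + n * ℓ * ((x - 1) / n)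

theorem pos_sub_one (n ℓ : ℕ) (d : Fin ℓ) (x : ℤ) :
    pos n ℓ d x - 1 = (x - 1) % n + n * ((d : ℕ) + ℓ * ((x - 1) / n)) := by
  unfold pos; ring

theorem pos_sub_one_ediv {n ℓ : ℕ} (hn : 0 < n) (d : Fin ℓ) (x : ℤ) :
    (pos n ℓ d x - 1) / n = (d : ℕ) + ℓ * ((x - 1) / n) := by
  have hn' : (0 : ℤ) < n := by exact_mod_cast hn
  rw [pos_sub_one, Int.add_mul_ediv_left _ _ hn'.ne',
    Int.ediv_eq_zero_of_lt (Int.emod_nonneg _ hn'.ne') (Int.emod_lt_of_pos _ hn'), zero_add]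

theorem cPart_pos {n ℓ : ℕ} (d : Fin ℓ) (x : ℤ) : cPart n (pos n ℓ d x) = cPart n x := by
  unfold cPart
  rw [pos_sub_one, Int.add_mul_emod_self_left, Int.emod_emod]

theorem dPart_pos {n ℓ : ℕ} (hn : 0 < n) (d : Fin ℓ) (x : ℤ) :
    dPart n ℓ (pos n ℓ d x) = (d : ℕ) + 1 := by
  unfold dPart
  rw [pos_sub_one_ediv hn, Int.add_mul_emod_self_left,
    Int.emod_eq_of_lt (by positivity) (by exact_mod_cast d.2)]

theorem mPart_pos {n ℓ : ℕ} (hn : 0 < n) (d : Fin ℓ) (x : ℤ) :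
    mPart n ℓ (pos n ℓ d x) = -((x - 1) / n) := by
  have hl : (0 : ℤ) < ℓ := by exact_mod_cast (Nat.zero_le _).trans_lt d.2
  unfold mPart
  rw [pos_sub_one_ediv hn, Int.add_mul_ediv_left _ _ hl.ne',
    Int.ediv_eq_zero_of_lt (by positivity) (by exact_mod_cast d.2), zero_add]

theorem pos_inj {n ℓ : ℕ} (hn : 0 < n) {d d' : Fin ℓ} {x x' : ℤ}
    (h : pos n ℓ d x = pos n ℓ d' x') : d = d' ∧ x = x' := by
  have h1 := congrArg (dPart n ℓ) h
  have h2 := congrArg (mPart n ℓ) h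
  have h3 := congrArg (cPart n) h
  rw [dPart_pos hn, dPart_pos hn] at h1
  rw [mPart_pos hn, mPart_pos hn] at h2
  rw [cPart_pos, cPart_pos] at h3
  refine ⟨Fin.ext (by omega), ?_⟩
  have e1 := Int.emod_add_mul_ediv (x - 1) n
  have e2 := Int.emod_add_mul_ediv (x' - 1) n
  unfold cPart at h3
  linear_combination -e1 + e2 + h3 - (n : ℤ) * h2

theorem exists_pos_eq {n ℓ : ℕ} (hn : 0 < n) (hl : 0 < ℓ) (k : ℤ) :
    ∃ (d : Fin ℓ) (x : ℤ), pos n ℓ d x = k := by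
  have hn' : (0 : ℤ) < n := by exact_mod_cast hn
  have hl' : (0 : ℤ) < ℓ := by exact_mod_cast hl
  have h0 := Int.emod_nonneg ((k - 1) / n) hl'.ne'
  have h1 := Int.emod_lt_of_pos ((k - 1) / n) hl'
  refine ⟨⟨((k - 1) / n % ℓ).toNat, by omega⟩, (k - 1) % n + n * ((k - 1) / n / ℓ) + 1, ?_⟩
  have e1 := Int.emod_add_mul_ediv (k - 1) n
  have e2 := Int.emod_add_mul_ediv ((k - 1) / n) ℓ
  unfold pos
  rw [add_sub_cancel_right, Int.add_mul_emod_self_left, Int.emod_emod,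
    Int.add_mul_ediv_left _ _ hn'.ne',
    Int.ediv_eq_zero_of_lt (Int.emod_nonneg _ hn'.ne') (Int.emod_lt_of_pos _ hn'), zero_add]
  simp only [Int.toNat_of_nonneg h0]
  linear_combination e1 + (n : ℤ) * e2

theorem lt_pos_iff {n ℓ : ℕ} (hn : 0 < n) (d : Fin ℓ) (x M : ℤ) :
    -(n * ℓ * M) < pos n ℓ d x ↔ -(n * M) < x := by
  have hn' : (0 : ℤ) < n := by exact_mod_cast hn
  have hd : ((d : ℕ) : ℤ) < ℓ := by exact_mod_cast d.2
  have hd0 : (0 : ℤ) ≤ ((d : ℕ) : ℤ) := by positivity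
  have a1 : -(n * ℓ * M) < pos n ℓ d x ↔ -(ℓ * M) ≤ (pos n ℓ d x - 1) / n := by
    rw [Int.le_ediv_iff_mul_le hn', ← Int.le_sub_one_iff]
    ring_nf
  have a2 : -(n * M) < x ↔ -M ≤ (x - 1) / n := by
    rw [Int.le_ediv_iff_mul_le hn', ← Int.le_sub_one_iff]
    ring_nf
  rw [a1, a2, pos_sub_one_ediv hn]
  constructor
  · intro h
    by_contra hc
    nlinarith
  · intro h
    nlinarith

/-! ### Semi-infinite `q`-wedges -/

/-- The set `P(s)` of integer sequences `(k₁, k₂, …)` with `k_r = s - r + 1` for large `r`.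
Indices start at `0` here. -/
def P (s : ℤ) : Type := {k : ℕ → ℤ // ∀ᶠ r : ℕ in atTop, k r = s - r}

/-- The sequence obtained from `k` by putting `a`, `b` at the places `i`, `i + 1`. -/
def P.replace {s : ℤ} (k : P s) (i : ℕ) (a b : ℤ) : P s :=
  ⟨Function.update (Function.update k.1 i a) (i + 1) b, by
    filter_upwards [k.2, eventually_gt_atTop (i + 1)] with r hr hi
    rw [Function.update_of_ne (by omega), Function.update_of_ne (by omega), hr]⟩

/-- The sequence obtained from `k` by reversing its first `r` entries. -/
def P.rev {s : ℤ} (k : P s) (r : ℕ) : P s :=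
  ⟨fun i => if i < r then k.1 (r - 1 - i) else k.1 i, by
    filter_upwards [k.2, eventually_ge_atTop r] with i hi hr
    rw [if_neg (by omega), hi]⟩

/-- The right-hand side of the straightening rule for `… ∧ u_{k₂} ∧ u_{k₁} ∧ …` with `k₂ ≤ k₁`,
where `k₂`, `k₁` are the entries of `k` at the places `i`, `i + 1`:
`(-q⁻¹)^{[d₁ = d₂]} (q^{[c₁ = c₂]} u_{k₁} ∧ u_{k₂}
  + (q - q⁻¹) ∑_j u_{k₁ - c₁ + c₂ - n ℓ j} ∧ u_{k₂ + c₁ - c₂ + n ℓ j})`,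
with `j` from `[c₁ ≤ c₂]` to `m₂ - m₁ - [d₁ ≤ d₂]`. -/
def straighten (n ℓ : ℕ) {s : ℤ} (k : P s) (i : ℕ) : P s →₀ Kq :=
  let k₂ := k.1 i
  let k₁ := k.1 (i + 1)
  let c₁ := cPart n k₁
  let c₂ := cPart n k₂
  let d₁ := dPart n ℓ k₁
  let d₂ := dPart n ℓ k₂
  let m₁ := mPart n ℓ k₁
  let m₂ := mPart n ℓ k₂
  let β : ℤ := if c₁ ≤ c₂ then 1 else 0
  let γ : ℤ := if d₁ ≤ d₂ then 1 else 0
  (if d₁ = d₂ then -q⁻¹ else 1 : Kq) •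
    ((if c₁ = c₂ then q else 1 : Kq) • Finsupp.single (k.replace i k₁ k₂) (1 : Kq)
      + (q - q⁻¹) • ∑ j ∈ Finset.Icc β (m₂ - m₁ - γ),
          Finsupp.single
            (k.replace i (k₁ - c₁ + c₂ - n * ℓ * j) (k₂ + c₁ - c₂ + n * ℓ * j)) (1 : Kq))

/-- The span of the straightening relations. -/
def relations (n ℓ : ℕ) (s : ℤ) : Submodule Kq (P s →₀ Kq) :=
  Submodule.span Kq
    {f | ∃ (k : P s) (i : ℕ), k.1 i ≤ k.1 (i + 1) ∧
      f = Finsupp.single k (1 : Kq) - straighten n ℓ k i}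

/-- The space `Λ^s` of semi-infinite `q`-wedges of charge `s`. -/
abbrev Wedge (n ℓ : ℕ) (s : ℤ) : Type := (P s →₀ Kq) ⧸ relations n ℓ s

/-- The `q`-wedge product `u_k = u_{k₁} ∧ u_{k₂} ∧ ⋯`. -/
def wedge (n ℓ : ℕ) {s : ℤ} (k : P s) : Wedge n ℓ s :=
  (relations n ℓ s).mkQ (Finsupp.single k 1)

/-! ### The bar involution -/

/-- `κ(a₁, …, a_r)`: the number of pairs `i < j` of indices with `a_i = a_j`. -/
def kappa (a : ℕ → ℤ) (r : ℕ) : ℕ :=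
  ((Finset.range r ×ˢ Finset.range r).filter fun p => p.1 < p.2 ∧ a p.1 = a p.2).card

/-- `σ` is the bar involution of `Λ^s`: it is semilinear with respect to `q ↦ q⁻¹`, an involution,
and on `u_k` it is given by reversing the first `r` factors, with the factor
`(-q)^{κ(d₁, …, d_r)} q^{-κ(c₁, …, c_r)}`, for all sufficiently large `r`. -/
structure IsBarInvolution (n ℓ : ℕ) (s : ℤ) (σ : Wedge n ℓ s →ₛₗ[conj] Wedge n ℓ s) : Prop where
  involutive : Function.Involutive σ
  apply_wedge : ∀ k : P s, ∀ᶠ r : ℕ in atTop,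
    σ (wedge n ℓ k) =
      ((-q) ^ kappa (fun i => dPart n ℓ (k.1 i)) r * (q⁻¹) ^ kappa (fun i => cPart n (k.1 i)) r) •
        wedge n ℓ (k.rev r)

/-- The bar involution is determined by its defining properties. -/
theorem IsBarInvolution.unique {n ℓ : ℕ} {s : ℤ} {σ τ : Wedge n ℓ s →ₛₗ[conj] Wedge n ℓ s}
    (hσ : IsBarInvolution n ℓ s σ) (hτ : IsBarInvolution n ℓ s τ) : σ = τ := by
  refine LinearMap.ext fun x => ?_
  obtain ⟨f, rfl⟩ := (relations n ℓ s).mkQ_surjective x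
  induction f using Finsupp.induction_linear with
  | zero => simp
  | add f g hf hg => rw [map_add, map_add, map_add, hf, hg]
  | single k a =>
    have h1 : Finsupp.single k a = a • Finsupp.single k (1 : Kq) := by simp
    obtain ⟨r, hr1, hr2⟩ := ((hσ.apply_wedge k).and (hτ.apply_wedge k)).exists
    have h2 : σ (wedge n ℓ k) = τ (wedge n ℓ k) := hr1.trans hr2.symm
    rw [h1, map_smul, LinearMap.map_smulₛₗ, LinearMap.map_smulₛₗ]
    exact congrArg _ h2

/-! ### Multipartitions and the standard basis -/

/-- `ℓ`-tuples of Young diagrams. -/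
abbrev MultiPartition (ℓ : ℕ) : Type := Fin ℓ → YoungDiagram

/-- The total number of boxes. -/
def size {ℓ : ℕ} (lam : MultiPartition ℓ) : ℕ := ∑ d, (lam d).card

/-- The bead configuration of `|λ; s⟩`: the beads on the `d`-th abacus are at
`λ^{(d)}_r + s_d - r + 1`, `r ≥ 1` (rows are counted from `0` here). -/
def beads (n : ℕ) {ℓ : ℕ} (lam : MultiPartition ℓ) (s : Fin ℓ → ℤ) : Set ℤ :=
  {k | ∃ (d : Fin ℓ) (r : ℕ), k = pos n ℓ d ((lam d).rowLen r + s d - r)}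

theorem exists_enumeration (n : ℕ) {ℓ : ℕ} (hn : 0 < n) (hl : 0 < ℓ) (lam : MultiPartition ℓ)
    (s : Fin ℓ → ℤ) :
    ∃ k : P (∑ d, s d), StrictAnti k.1 ∧ Set.range k.1 = beads n lam s := by
  obtain ⟨M, hM⟩ : ∃ M : ℕ, ∀ d, ((lam d).colLen 0 : ℤ) ≤ s d + n * M := by
    refine ⟨∑ d, ((s d).natAbs + (lam d).colLen 0), fun d => ?_⟩
    have h1 : (s d).natAbs + (lam d).colLen 0 ≤ ∑ d, ((s d).natAbs + (lam d).colLen 0) :=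
      Finset.single_le_sum (f := fun d => (s d).natAbs + (lam d).colLen 0)
        (fun _ _ => Nat.zero_le _) (Finset.mem_univ d)
    have h2 := Nat.le_mul_of_pos_left (∑ d, ((s d).natAbs + (lam d).colLen 0)) hn
    have h3 : ((lam d).colLen 0 : ℤ) + (s d).natAbs ≤
        ((n * ∑ d, ((s d).natAbs + (lam d).colLen 0) : ℕ) : ℤ) := by
      exact_mod_cast (by omega)
    have h4 : -((s d).natAbs : ℤ) ≤ s d := by omega
    rw [Nat.cast_mul] at h3
    linarith
  have hrow : ∀ d (r : ℕ), s d + n * M ≤ r → (lam d).rowLen r = 0 := by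
    intro d r hr
    by_contra hc
    have h1 : (r, 0) ∈ lam d := YoungDiagram.mem_iff_lt_rowLen.mpr (Nat.pos_of_ne_zero hc)
    have h2 := YoungDiagram.mem_iff_lt_colLen.mp h1
    have := hM d
    omega
  have h0 : ∀ d, 0 ≤ s d + n * M := fun d => (Int.natCast_nonneg _).trans (hM d)
  let f : (Σ _ : Fin ℓ, ℕ) → ℤ := fun p => pos n ℓ p.1 ((lam p.1).rowLen p.2 + s p.1 - p.2)
  let I : Finset (Σ _ : Fin ℓ, ℕ) :=
    Finset.univ.sigma fun d => Finset.range (s d + n * M).toNat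
  let F : Finset ℤ := I.image f
  have hinj : Function.Injective f := by
    rintro ⟨d, r⟩ ⟨d', r'⟩ h
    obtain ⟨h1, h2⟩ := pos_inj hn h
    dsimp only at h1 h2
    subst h1
    have : r = r' := by
      rcases lt_trichotomy r r' with h | h | h
      · have := (lam d).rowLen_anti r r' h.le
        omega
      · exact h
      · have := (lam d).rowLen_anti r' r h.le
        omega
    rw [this]
  have hcard : (F.card : ℤ) = ∑ d, s d + n * ℓ * M := by
    rw [Finset.card_image_of_injective _ hinj, Finset.card_sigma, Nat.cast_sum]
    simp only [Finset.card_range, Int.toNat_of_nonneg (h0 _)]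
    rw [Finset.sum_add_distrib]
    simp
    ring
  have hF : ∀ x ∈ F, -(n * ℓ * M : ℤ) < x := by
    intro x hx
    obtain ⟨⟨d, r⟩, hp, rfl⟩ := Finset.mem_image.mp hx
    have hr : r < (s d + n * M).toNat := Finset.mem_range.mp (Finset.mem_sigma.mp hp).2
    refine (lt_pos_iff hn _ _ _).mpr ?_
    dsimp only
    omega
  have hB : ∀ x : ℤ, x ∈ beads n lam s ↔ x ∈ F ∨ x ≤ -(n * ℓ * M : ℤ) := by
    intro x
    constructor
    · rintro ⟨d, r, rfl⟩
      by_cases hr : r < (s d + n * M).toNat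
      · exact Or.inl (Finset.mem_image.mpr
          ⟨⟨d, r⟩, Finset.mem_sigma.mpr ⟨Finset.mem_univ _, Finset.mem_range.mpr hr⟩, rfl⟩)
      · right
        have := h0 d
        have hr' : s d + n * M ≤ r := by omega
        rw [hrow d r hr', ← not_lt, lt_pos_iff hn]
        push_cast
        omega
    · rintro (hx | hx)
      · obtain ⟨⟨d, r⟩, -, rfl⟩ := Finset.mem_image.mp hx
        exact ⟨d, r, rfl⟩
      · obtain ⟨d, y, rfl⟩ := exists_pos_eq hn hl x
        rw [← not_lt, lt_pos_iff hn, not_lt] at hx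
        have := h0 d
        refine ⟨d, (s d - y).toNat, ?_⟩
        rw [hrow d _ (by omega), Int.toNat_of_nonneg (by omega)]
        congr 1
        push_cast
        ring
  obtain ⟨N, hN⟩ : ∃ N, F.card = N := ⟨_, rfl⟩
  rw [hN] at hcard
  have hcard' : ∑ d, s d - N = -(n * ℓ * M : ℤ) := by linarith
  let g : ℕ → ℤ := fun r =>
    if h : r < N then F.orderEmbOfFin hN ⟨N - 1 - r, by omega⟩ else ∑ d, s d - r
  refine ⟨⟨g, ?_⟩, ?_, ?_⟩
  · filter_upwards [eventually_ge_atTop N] with r hr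
    simp only [g]
    rw [dif_neg (by omega)]
  · refine strictAnti_nat_of_succ_lt fun r => ?_
    simp only [g]
    by_cases h1 : r + 1 < N
    · rw [dif_pos h1, dif_pos (by omega)]
      refine (F.orderEmbOfFin hN).strictMono ?_
      rw [Fin.mk_lt_mk]
      omega
    · rw [dif_neg h1]
      by_cases h2 : r < N
      · rw [dif_pos h2]
        refine lt_of_le_of_lt ?_ (hF _ (F.orderEmbOfFin_mem hN _))
        push_cast
        omega
      · rw [dif_neg h2]
        push_cast
        omega
  · ext x
    rw [hB]
    constructor
    · rintro ⟨r, rfl⟩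
      simp only [g]
      by_cases h : r < N
      · rw [dif_pos h]
        exact Or.inl (F.orderEmbOfFin_mem hN _)
      · rw [dif_neg h]
        right
        omega
    · rintro (hx | hx)
      · have : x ∈ Set.range (F.orderEmbOfFin hN) := by
          rw [Finset.range_orderEmbOfFin]; exact hx
        obtain ⟨i, rfl⟩ := this
        refine ⟨N - 1 - i, ?_⟩
        have := i.2
        simp only [g]
        rw [dif_pos (by omega)]
        congr 1
        ext
        simp only
        omega
      · refine ⟨(∑ d, s d - x).toNat, ?_⟩
        simp only [g]
        rw [dif_neg (by omega)]
        omega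

/-- The strictly decreasing sequence `k` with `u_k = |λ; s⟩`: it enumerates the beads. -/
def enum (n : ℕ) {ℓ : ℕ} [NeZero n] [NeZero ℓ] (lam : MultiPartition ℓ) (s : Fin ℓ → ℤ) :
    P (∑ d, s d) :=
  (exists_enumeration n (NeZero.pos n) (NeZero.pos ℓ) lam s).choose

theorem enum_strictAnti (n : ℕ) {ℓ : ℕ} [NeZero n] [NeZero ℓ] (lam : MultiPartition ℓ)
    (s : Fin ℓ → ℤ) : StrictAnti (enum n lam s).1 :=
  (exists_enumeration n (NeZero.pos n) (NeZero.pos ℓ) lam s).choose_spec.1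

theorem range_enum (n : ℕ) {ℓ : ℕ} [NeZero n] [NeZero ℓ] (lam : MultiPartition ℓ)
    (s : Fin ℓ → ℤ) : Set.range (enum n lam s).1 = beads n lam s :=
  (exists_enumeration n (NeZero.pos n) (NeZero.pos ℓ) lam s).choose_spec.2

/-! ### The Fock space and its canonical bases -/

/-- The `q`-deformed Fock space `F_q[s]`, in coordinates with respect to its standard basis
`|λ; s⟩`: the `ℚ(q)`-vector space with basis the `ℓ`-tuples of Young diagrams. -/
abbrev Fock (ℓ : ℕ) : Type := MultiPartition ℓ →₀ Kq

/-- The inclusion `F_q[s] ⊆ Λ^s`, which sends the basis vector of `λ` to `|λ; s⟩ = u_k`. -/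
def toWedge (n : ℕ) {ℓ : ℕ} [NeZero n] [NeZero ℓ] (s : Fin ℓ → ℤ) :
    Fock ℓ →ₗ[Kq] Wedge n ℓ (∑ d, s d) :=
  Finsupp.linearCombination Kq fun lam => wedge n ℓ (enum n lam s)

/-- `q` for `ε = 1` and `q⁻¹` for `ε = -1`. -/
def qPow (ε : ℤˣ) : Kq := q ^ (ε : ℤ)

/-- The lattice `L^ε = ⊕_λ ℚ[q^ε] |λ; s⟩`. -/
def lattice (ε : ℤˣ) (ℓ : ℕ) : Set (Fock ℓ) :=
  {x | ∀ mu, x mu ∈ Algebra.adjoin ℚ {qPow ε}}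

/-- `G` is the canonical basis `{G^ε(λ; s)}` of `F_q[s]`: its elements are fixed by the bar
involution of `Λ^s`, and `G^ε(λ; s) ≡ |λ; s⟩` modulo `q^ε L^ε`. -/
structure IsCanonicalBasis (n : ℕ) {ℓ : ℕ} [NeZero n] [NeZero ℓ] (ε : ℤˣ) (s : Fin ℓ → ℤ)
    (G : Module.Basis (MultiPartition ℓ) Kq (Fock ℓ)) : Prop where
  bar : ∃ σ, IsBarInvolution n ℓ (∑ d, s d) σ ∧
    ∀ lam, σ (toWedge n s (G lam)) = toWedge n s (G lam)
  congr : ∀ lam, ∃ y ∈ lattice ε ℓ, G lam = Finsupp.single lam 1 + qPow ε • y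

end

end QFock

/-!
The canonical basis is determined by the matrix of the bar involution in the standard basis, so
the theorem follows from a comparison of these matrices at the levels `ℓ` and `ℓ + 1`.

*The bar involution.* Write `x = c - n m` for the position of a bead on its abacus. In terms of
the labels `c`, `d`, `m` a straightening relation has the form `(b_i - a_i) w`, for an action `a` of
the affine Hecke algebra on the labels `c`, `m` and an action `b` of the finite Hecke algebra on the
labels `d` (`labelMap_relator`). The element `∑_w a_w b_w` does not distinguish `a_i` from `b_i`
(`symSum_mul_eq`), hence kills all relations, while at `q = 1` it is a signed sum over permutations.
Therefore the ordered wedges are linearly independent (`linearIndependent_wedge`) and the relations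
are exactly the vectors whose labels lie in the sum of the ranges of the `b_i - a_i`
(`mem_relations_iff`). The semilinear reversal of factors turns `a_i`, `b_i` into inverses of
operators of the same kind and thus preserves the relations; a vanishing argument for wedges of
small excess shows that the reversal of the first `r` factors does not depend on `r` for large `r`.
So the bar involution exists (`isBarInvolution_bar`).

*Canonical bases.* Straightening `u_{k₂} ∧ u_{k₁}` keeps sums of entries, sums of positions `x` and
the labels `d`, and strictly decreases sums of squares of entries except for the plain exchange.
Hence the bar involution preserves the Fock space and the size of multipartitions, and is
unitriangular with entries in `ℚ[q, q⁻¹]` (`exists_isUnitriangular_fockBar`). The lemma of Kazhdan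
and Lusztig gives the canonical basis and its uniqueness (`existsUnique_isCanonicalBasis`).

*Comparison.* Put `T = s j`. If `μ^{(j)} = ∅` and all other charges exceed `s j` by at least `|μ|`,
then all positions `x ≤ T` are filled in the bead configuration of `μ`. A correction term never
increases the weight `∑ 3^{-k}` over the beads `k` with `x ≤ T`, and decreases it as soon as one of
the two factors has `x ≤ T`; among configurations of the same length the weight is maximal exactly
for those that are filled up to `T`. So a configuration that is not filled up to `T` does not
contribute to a coefficient at `μ` (`IsCoord.bar_of_not_isFull`), and for one that is, the coefficient
is computed by straightening the beads with `x > T` alone (`IsCoord.bar_of_isFull`). No such bead lies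
on the abacus `j`, and the straightening rules of the two levels agree for beads that avoid it
(`IsExpansion.mapDomain_relabel`). Consequently restriction to the multipartitions of size `|μ|` with
empty `j`-th component commutes with the bar involutions (`fockBar_restrict`). The restrictions of
the two canonical basis vectors are therefore both invariant, and congruent to each other modulo
`q^ε L^ε`, so they coincide (`IsUnitriangular.eq_zero`).
-/

namespace QFock

noncomputable section

/-! ### An intertwiner between two commuting actions of the Hecke algebra -/

section Casimir

variable {E : Type*} [Ring E]

/-- The product `g_{i + k - 1} ⋯ g_{i + 1} g_i`. -/
def descProd (g : ℕ → E) (i : ℕ) : ℕ → E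
  | 0 => 1
  | k + 1 => g (i + k) * descProd g i k

/-- The sum over the symmetric group on `r` letters of the products of the `g_i` along reduced
words, written through minimal coset representatives. For `g_i = a_i b_i` this is
`∑_w a_w b_w`. -/
def symSum (g : ℕ → E) : ℕ → E
  | 0 => 1
  | r + 1 => symSum g r * ∑ j ∈ Finset.range (r + 1), descProd g j (r - j)

theorem descProd_succ' (g : ℕ → E) (i k : ℕ) :
    descProd g i (k + 1) = descProd g (i + 1) k * g i := by
  induction k with
  | zero => simp [descProd]
  | succ k ih =>
    rw [descProd, ih, descProd, mul_assoc]
    congr 2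
    ring

theorem descProd_commute {g : ℕ → E} {x : E} {i k : ℕ}
    (hx : ∀ j, i ≤ j → j < i + k → Commute x (g j)) : Commute x (descProd g i k) := by
  induction k with
  | zero => exact Commute.one_right x
  | succ k ih =>
    exact (hx _ (by omega) (by omega)).mul_right (ih fun j h1 h2 => hx j h1 (by omega))

theorem descProd_add (g : ℕ → E) (i k l : ℕ) :
    descProd g i (k + l) = descProd g (i + k) l * descProd g i k := by
  induction l with
  | zero => simp [descProd]
  | succ l ih => rw [← add_assoc, descProd, ih, descProd, mul_assoc, add_assoc]

/-- Moving `x` through a descending product that contains `g_{i+1} g_i` replaces it by `x'`,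
where `g_{i+1} g_i x = x' g_{i+1} g_i`. -/
theorem descProd_mul_eq {g : ℕ → E} {x x' : E} {i j m : ℕ} (hij : j ≤ i) (him : i + 2 ≤ m)
    (hx : ∀ l, l + 1 < i + 1 → Commute x (g l)) (hx' : ∀ l, i + 2 ≤ l → Commute x' (g l))
    (h : g (i + 1) * g i * x = x' * (g (i + 1) * g i)) :
    descProd g j (m - j) * x = x' * descProd g j (m - j) := by
  have e1 : m - j = (i - j) + (2 + (m - (i + 2))) := by omega
  have c1 : Commute x (descProd g j (i - j)) :=
    descProd_commute fun l h1 h2 => hx l (by omega)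
  have c2 : Commute x' (descProd g (i + 2) (m - (i + 2))) :=
    descProd_commute fun l h1 h2 => hx' l h1
  have e2 : descProd g i 2 = g (i + 1) * g i := by simp [descProd]
  rw [e1, descProd_add, descProd_add, show j + (i - j) = i by omega, e2, mul_assoc, mul_assoc,
    ← c1.eq, ← mul_assoc (g (i + 1) * g i), h]
  simp only [← mul_assoc]
  rw [c2.eq]

/-- `∑_w a_w b_w` does not distinguish `a_i` from `b_i` on its right, for two commuting actions
`a`, `b` of the Hecke algebra with quadratic relation `t² = 1 - h t`. -/
theorem symSum_mul_eq {a b : ℕ → E} {h : E} (ha : ∀ i, a i * a i = 1 - h * a i)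
    (hb : ∀ i, b i * b i = 1 - h * b i) (hha : ∀ i, Commute h (a i))
    (hab : ∀ i j, Commute (a i) (b j))
    (ha2 : ∀ i j, i + 2 ≤ j → Commute (a i) (a j)) (hb2 : ∀ i j, i + 2 ≤ j → Commute (b i) (b j))
    (ha3 : ∀ i, a i * a (i + 1) * a i = a (i + 1) * a i * a (i + 1))
    (hb3 : ∀ i, b i * b (i + 1) * b i = b (i + 1) * b i * b (i + 1)) (r i : ℕ) (hi : i + 1 < r) :
    symSum (fun i => a i * b i) r * a i = symSum (fun i => a i * b i) r * b i := by
  induction r generalizing i with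
  | zero => omega
  | succ r ih =>
    set g : ℕ → E := fun i => a i * b i with hg
    have cg : ∀ i j, i + 2 ≤ j → Commute (a i) (g j) ∧ Commute (b i) (g j) ∧
        Commute (a j) (g i) ∧ Commute (b j) (g i) := fun i j hij =>
      ⟨(ha2 i j hij).mul_right (hab i j), (hab j i).symm.mul_right (hb2 i j hij),
        (ha2 i j hij).symm.mul_right (hab j i), (hab i j).symm.mul_right (hb2 i j hij).symm⟩
    have key : ∀ j ∈ (Finset.range (r + 1)).filter (fun j => ¬ (j = i ∨ j = i + 1)),
        symSum g r * (descProd g j (r - j) * a i) = symSum g r * (descProd g j (r - j) * b i) := by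
      intro j hj
      simp only [Finset.mem_filter, Finset.mem_range, not_or] at hj
      obtain ⟨hj1, hj2, hj3⟩ := hj
      rcases lt_or_ge i j with hij | hij
      · have c1 : Commute (a i) (descProd g j (r - j)) :=
          descProd_commute fun l h1 h2 => (cg i l (by omega)).1
        have c2 : Commute (b i) (descProd g j (r - j)) :=
          descProd_commute fun l h1 h2 => (cg i l (by omega)).2.1
        rw [← c1.eq, ← c2.eq, ← mul_assoc, ← mul_assoc, ih i (by omega)]
      · obtain ⟨i, rfl⟩ : ∃ i', i = i' + 1 := ⟨i - 1, by omega⟩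
        have e1 : g (i + 1) * g i * a (i + 1) = a i * (g (i + 1) * g i) := by
          have x1 : g (i + 1) * g i = a (i + 1) * a i * (b (i + 1) * b i) := by
            simp only [hg, mul_assoc]
            rw [← mul_assoc (b (i + 1)), ← (hab i (i + 1)).eq, mul_assoc]
          rw [x1, mul_assoc, ← ((hab (i + 1) (i + 1)).mul_right (hab (i + 1) i)).eq,
            ← mul_assoc, ← mul_assoc, ← ha3]
          simp only [mul_assoc]
        have e2 : g (i + 1) * g i * b (i + 1) = b i * (g (i + 1) * g i) := by
          have x1 : g (i + 1) * g i = a (i + 1) * a i * (b (i + 1) * b i) := by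
            simp only [hg, mul_assoc]
            rw [← mul_assoc (b (i + 1)), ← (hab i (i + 1)).eq, mul_assoc]
          rw [x1, mul_assoc, ← hb3, ← mul_assoc (b i) (a (i + 1) * a i),
            ← ((hab (i + 1) i).mul_left (hab i i)).eq]
          simp only [mul_assoc]
        have d1 := descProd_mul_eq (g := g) (x := a (i + 1)) (x' := a i) (i := i) (j := j) (m := r)
          (by omega) (by omega) (fun l hl => (cg l (i + 1) (by omega)).2.2.1)
          (fun l hl => (cg i l hl).1) e1
        have d2 := descProd_mul_eq (g := g) (x := b (i + 1)) (x' := b i) (i := i) (j := j) (m := r)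
          (by omega) (by omega) (fun l hl => (cg l (i + 1) (by omega)).2.2.2)
          (fun l hl => (cg i l hl).2.1) e2
        rw [d1, d2, ← mul_assoc, ← mul_assoc, ih i (by omega)]
    have key2 : (descProd g i (r - i) + descProd g (i + 1) (r - (i + 1))) * a i =
        (descProd g i (r - i) + descProd g (i + 1) (r - (i + 1))) * b i := by
      have e1 : descProd g i (r - i) = descProd g (i + 1) (r - (i + 1)) * g i := by
        rw [← descProd_succ']
        congr 1
        omega
      have e3 : g i * a i = b i - h * (a i * b i) := by
        rw [hg]
        simp only
        rw [mul_assoc, ← (hab i i).eq, ← mul_assoc, ha, sub_mul, one_mul, mul_assoc]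
      have e4 : g i * b i = a i - h * (a i * b i) := by
        rw [hg]
        simp only
        rw [mul_assoc, hb, mul_sub, mul_one, ← mul_assoc, ← (hha i).eq, mul_assoc]
      rw [e1, add_mul, add_mul, mul_assoc (descProd g (i + 1) (r - (i + 1))) (g i),
        mul_assoc (descProd g (i + 1) (r - (i + 1))) (g i), e3, e4, mul_sub, mul_sub]
      abel
    have split : ∀ x : E, symSum g (r + 1) * x =
        symSum g r * ((descProd g i (r - i) + descProd g (i + 1) (r - (i + 1))) * x) +
        ∑ j ∈ (Finset.range (r + 1)).filter (fun j => ¬ (j = i ∨ j = i + 1)),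
          symSum g r * (descProd g j (r - j) * x) := by
      intro x
      have : (Finset.range (r + 1)).filter (fun j => (j = i ∨ j = i + 1)) = {i, i + 1} := by
        ext j
        simp only [Finset.mem_filter, Finset.mem_range, Finset.mem_insert, Finset.mem_singleton]
        omega
      rw [symSum, ← Finset.sum_filter_add_sum_filter_not (Finset.range (r + 1))
        (fun j => j = i ∨ j = i + 1), this, Finset.sum_pair (by omega), mul_assoc, add_mul,
        mul_add, Finset.sum_mul, Finset.mul_sum]
    rw [split, split, key2, Finset.sum_congr rfl key]

end Casimir

/-! ### Operators on two neighbouring entries of a sequence -/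

section Operators

variable {R : Type*} [CommRing R]

/-- The sequence obtained from `k` by putting `a`, `b` at the places `i`, `i + 1`. -/
def upd (k : ℕ → ℤ) (i : ℕ) (a b : ℤ) : ℕ → ℤ :=
  Function.update (Function.update k i a) (i + 1) b

theorem upd_apply (k : ℕ → ℤ) (i : ℕ) (a b : ℤ) (j : ℕ) :
    upd k i a b j = if j = i then a else if j = i + 1 then b else k j := by
  unfold upd
  by_cases h1 : j = i + 1
  · subst h1; simp
  · by_cases h2 : j = i
    · subst h2; simp
    · simp [h1, h2]

@[simp] theorem upd_left (k : ℕ → ℤ) (i : ℕ) (a b : ℤ) : upd k i a b i = a := by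
  simp [upd_apply]

@[simp] theorem upd_right (k : ℕ → ℤ) (i : ℕ) (a b : ℤ) : upd k i a b (i + 1) = b := by
  simp [upd_apply]

theorem upd_of_ne (k : ℕ → ℤ) {i j : ℕ} (a b : ℤ) (h1 : j ≠ i) (h2 : j ≠ i + 1) :
    upd k i a b j = k j := by
  simp [upd_apply, h1, h2]

@[simp] theorem upd_upd (k : ℕ → ℤ) (i : ℕ) (a b a' b' : ℤ) :
    upd (upd k i a b) i a' b' = upd k i a' b' := by
  ext j; simp only [upd_apply]; split_ifs <;> rfl

@[simp] theorem upd_self (k : ℕ → ℤ) (i : ℕ) : upd k i (k i) (k (i + 1)) = k := by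
  ext j; simp only [upd_apply]; split_ifs with h1 h2 <;> simp [*]

theorem upd_comm (k : ℕ → ℤ) {i j : ℕ} (h : i + 2 ≤ j) (a b a' b' : ℤ) :
    upd (upd k i a b) j a' b' = upd (upd k j a' b') i a b := by
  ext l; simp only [upd_apply]; split_ifs <;> first | rfl | omega

/-- The operator `f` on pairs of integers, acting on the entries at the places `i`, `i + 1`. -/
def atPlace (i : ℕ) (f : Module.End R (ℤ × ℤ →₀ R)) : Module.End R ((ℕ → ℤ) →₀ R) :=
  Finsupp.linearCombination R fun k =>
    Finsupp.mapDomain (fun p => upd k i p.1 p.2) (f (Finsupp.single (k i, k (i + 1)) 1))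

theorem atPlace_single (i : ℕ) (f : Module.End R (ℤ × ℤ →₀ R)) (k : ℕ → ℤ) :
    atPlace i f (Finsupp.single k 1) =
      Finsupp.mapDomain (fun p => upd k i p.1 p.2) (f (Finsupp.single (k i, k (i + 1)) 1)) := by
  simp [atPlace]

/-- Two linear maps out of a free module agree if they agree on the standard basis. -/
theorem linearMap_ext_single {α M : Type*} [AddCommGroup M] [Module R M] {f g : (α →₀ R) →ₗ[R] M}
    (h : ∀ x, f (Finsupp.single x 1) = g (Finsupp.single x 1)) : f = g :=
  Finsupp.lhom_ext' fun x => LinearMap.ext_ring (h x)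

theorem atPlace_mapDomain (i : ℕ) (f : Module.End R (ℤ × ℤ →₀ R)) (k : ℕ → ℤ)
    (y : ℤ × ℤ →₀ R) : atPlace i f (Finsupp.mapDomain (fun p => upd k i p.1 p.2) y) =
      Finsupp.mapDomain (fun p => upd k i p.1 p.2) (f y) := by
  have : atPlace i f ∘ₗ Finsupp.lmapDomain R R (fun p : ℤ × ℤ => upd k i p.1 p.2) =
      Finsupp.lmapDomain R R (fun p : ℤ × ℤ => upd k i p.1 p.2) ∘ₗ f := by
    refine linearMap_ext_single fun p => ?_
    simp [Finsupp.mapDomain_single, atPlace_single]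
  exact LinearMap.congr_fun this y

theorem atPlace_mul (i : ℕ) (f g : Module.End R (ℤ × ℤ →₀ R)) :
    atPlace i (f * g) = atPlace i f * atPlace i g := by
  refine linearMap_ext_single fun k => ?_
  rw [Module.End.mul_apply, atPlace_single, atPlace_single, atPlace_mapDomain, Module.End.mul_apply]

theorem atPlace_add (i : ℕ) (f g : Module.End R (ℤ × ℤ →₀ R)) :
    atPlace i (f + g) = atPlace i f + atPlace i g := by
  refine linearMap_ext_single fun k => ?_
  simp [atPlace_single, Finsupp.mapDomain_add]

theorem atPlace_smul (i : ℕ) (r : R) (f : Module.End R (ℤ × ℤ →₀ R)) :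
    atPlace i (r • f) = r • atPlace i f := by
  refine linearMap_ext_single fun k => ?_
  simp [atPlace_single, Finsupp.mapDomain_smul]

theorem atPlace_one (i : ℕ) : atPlace i (1 : Module.End R (ℤ × ℤ →₀ R)) = 1 := by
  refine linearMap_ext_single fun k => ?_
  simp [atPlace_single, Finsupp.mapDomain_single]

/-- `atPlace` as a homomorphism of algebras. -/
def atPlaceHom (i : ℕ) : Module.End R (ℤ × ℤ →₀ R) →ₐ[R] Module.End R ((ℕ → ℤ) →₀ R) :=
  AlgHom.ofLinearMap
    { toFun := atPlace i, map_add' := atPlace_add i, map_smul' := atPlace_smul i }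
    (atPlace_one i) (atPlace_mul i)

theorem atPlace_commute {i j : ℕ} (h : i + 2 ≤ j) (f g : Module.End R (ℤ × ℤ →₀ R)) :
    Commute (atPlace i f) (atPlace j g) := by
  refine linearMap_ext_single fun k => ?_
  have h1 : ∀ y : ℤ × ℤ →₀ R,
      atPlace i f (Finsupp.mapDomain (fun p => upd k j p.1 p.2) y) =
      y.sum fun p c => c • Finsupp.mapDomain (fun p' => upd (upd k j p.1 p.2) i p'.1 p'.2)
        (f (Finsupp.single (k i, k (i + 1)) 1)) := by
    intro y
    induction y using Finsupp.induction_linear with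
    | zero => simp
    | add y z hy hz =>
      rw [Finsupp.mapDomain_add, map_add, hy, hz, Finsupp.sum_add_index'] <;>
        simp [add_smul]
    | single p c =>
      rw [Finsupp.mapDomain_single, ← mul_one c, ← smul_eq_mul, ← Finsupp.smul_single, map_smul,
        atPlace_single, upd_of_ne _ _ _ (by omega) (by omega),
        upd_of_ne _ _ _ (by omega) (by omega)]
      simp
  have h2 : ∀ y : ℤ × ℤ →₀ R,
      atPlace j g (Finsupp.mapDomain (fun p => upd k i p.1 p.2) y) =
      y.sum fun p c => c • Finsupp.mapDomain (fun p' => upd (upd k i p.1 p.2) j p'.1 p'.2)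
        (g (Finsupp.single (k j, k (j + 1)) 1)) := by
    intro y
    induction y using Finsupp.induction_linear with
    | zero => simp
    | add y z hy hz =>
      rw [Finsupp.mapDomain_add, map_add, hy, hz, Finsupp.sum_add_index'] <;>
        simp [add_smul]
    | single p c =>
      rw [Finsupp.mapDomain_single, ← mul_one c, ← smul_eq_mul, ← Finsupp.smul_single, map_smul,
        atPlace_single, upd_of_ne _ _ _ (by omega) (by omega),
        upd_of_ne _ _ _ (by omega) (by omega)]
      simp
  rw [Module.End.mul_apply, Module.End.mul_apply, atPlace_single, atPlace_single, h1, h2]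
  simp only [Finsupp.mapDomain, Finsupp.smul_sum, upd_comm k h]
  rw [Finsupp.sum_comm]
  simp [mul_comm]

/-- The operator that shifts the entry at the place `j` by `1`. -/
def shift (j : ℕ) : Module.End R ((ℕ → ℤ) →₀ R) :=
  Finsupp.lmapDomain R R fun k => Function.update k j (k j + 1)

theorem shift_single (j : ℕ) (k : ℕ → ℤ) :
    shift j (Finsupp.single k (1 : R)) = Finsupp.single (Function.update k j (k j + 1)) 1 := by
  simp [shift, Finsupp.mapDomain_single]

theorem shift_commute {i j : ℕ} (h1 : j ≠ i) (h2 : j ≠ i + 1) (f : Module.End R (ℤ × ℤ →₀ R)) :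
    Commute (shift j) (atPlace i f) := by
  refine linearMap_ext_single fun k => ?_
  rw [Module.End.mul_apply, Module.End.mul_apply, atPlace_single, shift_single, atPlace_single,
    Function.update_of_ne h1.symm, Function.update_of_ne h2.symm, shift, Finsupp.lmapDomain_apply,
    ← Finsupp.mapDomain_comp]
  congr 1
  funext p
  ext l
  simp only [Function.comp, upd_apply, Function.update_apply]
  split_ifs <;> first | rfl | omega

theorem shift_eq_left (i : ℕ) : shift (R := R) i =
    atPlace i (Finsupp.lmapDomain R R fun p => (p.1 + 1, p.2)) := by
  refine linearMap_ext_single fun k => ?_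
  rw [shift_single, atPlace_single, Finsupp.lmapDomain_apply, Finsupp.mapDomain_single,
    Finsupp.mapDomain_single]
  congr 1
  ext l
  simp only [upd_apply, Function.update_apply]
  split_ifs <;> simp [*]

theorem shift_eq_right (i : ℕ) : shift (R := R) (i + 1) =
    atPlace i (Finsupp.lmapDomain R R fun p => (p.1, p.2 + 1)) := by
  refine linearMap_ext_single fun k => ?_
  rw [shift_single, atPlace_single, Finsupp.lmapDomain_apply, Finsupp.mapDomain_single,
    Finsupp.mapDomain_single]
  congr 1
  ext l
  simp only [upd_apply, Function.update_apply]
  split_ifs <;> first | omega | simp [*]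

/-! ### Operators on one factor of a tensor product of free modules -/

section Factors

variable {α β : Type*}

/-- The operator `f ⊗ 1` on the free module over a product. -/
def onLeft (β : Type*) (f : Module.End R (α →₀ R)) : Module.End R (α × β →₀ R) :=
  Finsupp.linearCombination R fun p =>
    Finsupp.mapDomain (fun a => (a, p.2)) (f (Finsupp.single p.1 1))

/-- The operator `1 ⊗ f` on the free module over a product. -/
def onRight (α : Type*) (f : Module.End R (β →₀ R)) : Module.End R (α × β →₀ R) :=
  Finsupp.linearCombination R fun p =>
    Finsupp.mapDomain (fun b => (p.1, b)) (f (Finsupp.single p.2 1))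

theorem onLeft_single (f : Module.End R (α →₀ R)) (a : α) (b : β) :
    onLeft β f (Finsupp.single (a, b) 1) =
      Finsupp.mapDomain (fun a => (a, b)) (f (Finsupp.single a 1)) := by
  simp [onLeft]

theorem onRight_single (f : Module.End R (β →₀ R)) (a : α) (b : β) :
    onRight α f (Finsupp.single (a, b) 1) =
      Finsupp.mapDomain (fun b => (a, b)) (f (Finsupp.single b 1)) := by
  simp [onRight]

theorem onLeft_mapDomain (f : Module.End R (α →₀ R)) (b : β) (y : α →₀ R) :
    onLeft β f (Finsupp.mapDomain (fun a => (a, b)) y) =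
      Finsupp.mapDomain (fun a => (a, b)) (f y) := by
  have : onLeft β f ∘ₗ Finsupp.lmapDomain R R (fun a : α => (a, b)) =
      Finsupp.lmapDomain R R (fun a : α => (a, b)) ∘ₗ f :=
    linearMap_ext_single fun p => by simp [Finsupp.mapDomain_single, onLeft_single]
  exact LinearMap.congr_fun this y

theorem onRight_mapDomain (f : Module.End R (β →₀ R)) (a : α) (y : β →₀ R) :
    onRight α f (Finsupp.mapDomain (fun b => (a, b)) y) =
      Finsupp.mapDomain (fun b => (a, b)) (f y) := by
  have : onRight α f ∘ₗ Finsupp.lmapDomain R R (fun b : β => (a, b)) =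
      Finsupp.lmapDomain R R (fun b : β => (a, b)) ∘ₗ f :=
    linearMap_ext_single fun p => by simp [Finsupp.mapDomain_single, onRight_single]
  exact LinearMap.congr_fun this y

/-- `f ↦ f ⊗ 1` as a homomorphism of algebras. -/
def onLeftHom (β : Type*) : Module.End R (α →₀ R) →ₐ[R] Module.End R (α × β →₀ R) :=
  AlgHom.ofLinearMap
    { toFun := onLeft β
      map_add' := fun f g => linearMap_ext_single fun ⟨a, b⟩ => by
        simp [onLeft_single, Finsupp.mapDomain_add]
      map_smul' := fun r f => linearMap_ext_single fun ⟨a, b⟩ => by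
        simp [onLeft_single, Finsupp.mapDomain_smul] }
    (linearMap_ext_single fun ⟨a, b⟩ => by simp [onLeft_single, Finsupp.mapDomain_single])
    (fun f g => linearMap_ext_single fun ⟨a, b⟩ => by
      simp [onLeft_single, onLeft_mapDomain])

/-- `f ↦ 1 ⊗ f` as a homomorphism of algebras. -/
def onRightHom (α : Type*) : Module.End R (β →₀ R) →ₐ[R] Module.End R (α × β →₀ R) :=
  AlgHom.ofLinearMap
    { toFun := onRight α
      map_add' := fun f g => linearMap_ext_single fun ⟨a, b⟩ => by
        simp [onRight_single, Finsupp.mapDomain_add]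
      map_smul' := fun r f => linearMap_ext_single fun ⟨a, b⟩ => by
        simp [onRight_single, Finsupp.mapDomain_smul] }
    (linearMap_ext_single fun ⟨a, b⟩ => by simp [onRight_single, Finsupp.mapDomain_single])
    (fun f g => linearMap_ext_single fun ⟨a, b⟩ => by
      simp [onRight_single, onRight_mapDomain])

theorem onLeft_commute_onRight (f : Module.End R (α →₀ R)) (g : Module.End R (β →₀ R)) :
    Commute (onLeft β f) (onRight α g) := by
  refine linearMap_ext_single fun ⟨a, b⟩ => ?_
  have h1 : ∀ y : β →₀ R, onLeft β f (Finsupp.mapDomain (fun b => (a, b)) y) =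
      y.sum fun b c => c • Finsupp.mapDomain (fun a => (a, b)) (f (Finsupp.single a 1)) := by
    intro y
    induction y using Finsupp.induction_linear with
    | zero => simp
    | add y z hy hz =>
      rw [Finsupp.mapDomain_add, map_add, hy, hz, Finsupp.sum_add_index'] <;>
        simp [add_smul]
    | single p c =>
      rw [Finsupp.mapDomain_single, ← mul_one c, ← smul_eq_mul, ← Finsupp.smul_single, map_smul,
        onLeft_single]
      simp
  have h2 : ∀ y : α →₀ R, onRight α g (Finsupp.mapDomain (fun a => (a, b)) y) =
      y.sum fun a c => c • Finsupp.mapDomain (fun b => (a, b)) (g (Finsupp.single b 1)) := by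
    intro y
    induction y using Finsupp.induction_linear with
    | zero => simp
    | add y z hy hz =>
      rw [Finsupp.mapDomain_add, map_add, hy, hz, Finsupp.sum_add_index'] <;>
        simp [add_smul]
    | single p c =>
      rw [Finsupp.mapDomain_single, ← mul_one c, ← smul_eq_mul, ← Finsupp.smul_single, map_smul,
        onRight_single]
      simp
  rw [Module.End.mul_apply, Module.End.mul_apply, onRight_single, onLeft_single, h1, h2]
  simp only [Finsupp.mapDomain, Finsupp.smul_sum]
  rw [Finsupp.sum_comm]
  simp [mul_comm]

end Factors

end Operators

/-! ### The affine Hecke algebra acting on labelled sequences -/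

section Hecke

variable {R : Type*} [CommRing R]

/-- The finite Hecke operator on pairs: `(a, b) ↦ (b, a)` for `a < b`, with the quadratic relation
`t² = 1 - h t`, and with the eigenvalue `κ` on the diagonal. -/
def heckePair (h κ : R) : Module.End R (ℤ × ℤ →₀ R) :=
  Finsupp.linearCombination R fun p =>
    if p.1 = p.2 then Finsupp.single p κ
    else if p.1 < p.2 then Finsupp.single (p.2, p.1) 1
    else Finsupp.single (p.2, p.1) 1 - Finsupp.single p h

/-- The exchange of the two entries of a pair. -/
def swapPair : Module.End R (ℤ × ℤ →₀ R) := Finsupp.lmapDomain R R Prod.swap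

/-- The Demazure operator `f ↦ y₂ (f - s f) / (y₁ - y₂)` on Laurent polynomials in `y₁`, `y₂`;
the pair `(a, b)` stands for the monomial `y₁ ^ a * y₂ ^ b`. -/
def demazurePair : Module.End R (ℤ × ℤ →₀ R) :=
  Finsupp.linearCombination R fun p =>
    ∑ t ∈ Finset.Ico p.2 p.1, Finsupp.single (t, p.1 + p.2 - t) 1 -
    ∑ t ∈ Finset.Ico p.1 p.2, Finsupp.single (t, p.1 + p.2 - t) 1

theorem heckePair_single (h κ : R) (a b : ℤ) : heckePair h κ (Finsupp.single (a, b) 1) =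
    if a = b then Finsupp.single (a, b) κ
    else if a < b then Finsupp.single (b, a) 1
    else Finsupp.single (b, a) 1 - Finsupp.single (a, b) h := by
  simp [heckePair]

theorem swapPair_single (a b : ℤ) :
    swapPair (Finsupp.single (a, b) (1 : R)) = Finsupp.single (b, a) 1 := by
  simp [swapPair, Finsupp.mapDomain_single]

theorem demazurePair_single (a b : ℤ) : demazurePair (Finsupp.single (a, b) (1 : R)) =
    ∑ t ∈ Finset.Ico b a, Finsupp.single (t, a + b - t) 1 -
    ∑ t ∈ Finset.Ico a b, Finsupp.single (t, a + b - t) 1 := by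
  simp [demazurePair]

theorem single_eq_smul {α : Type*} (x : α) (r : R) :
    Finsupp.single x r = r • Finsupp.single x (1 : R) := by simp

theorem heckePair_mul_self {h κ : R} (hκ : κ * κ = 1 - h * κ) :
    heckePair h κ * heckePair h κ = 1 - h • heckePair h κ := by
  refine linearMap_ext_single fun ⟨a, b⟩ => ?_
  simp only [Module.End.mul_apply, LinearMap.sub_apply, Module.End.one_apply,
    LinearMap.smul_apply]
  rcases lt_trichotomy a b with hab | hab | hab
  · simp only [heckePair_single, hab.ne, hab, if_true, if_false, hab.ne', hab.not_gt]
    rw [single_eq_smul (b, a) h]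
  · subst hab
    simp only [heckePair_single, if_true]
    rw [single_eq_smul (a, a) κ, map_smul, heckePair_single, if_pos rfl, single_eq_smul (a, a) κ,
      smul_smul, smul_smul, hκ, sub_smul, one_smul]
  · simp only [heckePair_single, hab.ne, hab, if_true, if_false, hab.ne', hab.not_gt, map_sub]
    rw [single_eq_smul (a, b) h, map_smul, heckePair_single]
    simp only [if_false, hab.ne', hab.not_gt, smul_sub]
    rw [single_eq_smul (a, b) h]

theorem swapPair_mul_self : swapPair * swapPair = (1 : Module.End R (ℤ × ℤ →₀ R)) := by
  refine linearMap_ext_single fun ⟨a, b⟩ => ?_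
  simp [swapPair_single]

theorem demazurePair_mul_swapPair :
    demazurePair * swapPair = -(demazurePair : Module.End R (ℤ × ℤ →₀ R)) := by
  refine linearMap_ext_single fun ⟨a, b⟩ => ?_
  simp [swapPair_single, demazurePair_single, add_comm b a]

theorem sum_Ico_reflect {M : Type*} [AddCommMonoid M] (f : ℤ → ℤ → M) (a b : ℤ) :
    ∑ t ∈ Finset.Ico a b, f (a + b - t) t = ∑ t ∈ Finset.Ioc a b, f t (a + b - t) := by
  refine Finset.sum_nbij' (fun t => a + b - t) (fun t => a + b - t) ?_ ?_ ?_ ?_ ?_ <;>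
    simp only [Finset.mem_Ico, Finset.mem_Ioc] <;> intro t ht <;>
    first
    | omega
    | (congr 1; omega)

theorem swapPair_mul_demazurePair :
    swapPair * demazurePair = demazurePair + 1 - (swapPair : Module.End R (ℤ × ℤ →₀ R)) := by
  refine linearMap_ext_single fun ⟨a, b⟩ => ?_
  have h1 : ∀ a b : ℤ, swapPair (∑ t ∈ Finset.Ico a b, Finsupp.single (t, a + b - t) (1 : R)) =
      ∑ t ∈ Finset.Ioc a b, Finsupp.single (t, a + b - t) 1 := by
    intro a b
    rw [map_sum]
    simp only [swapPair_single]
    exact sum_Ico_reflect (fun x y => Finsupp.single (x, y) (1 : R)) a b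
  have h2 : ∀ a b : ℤ, a < b → ∀ f : ℤ → ℤ × ℤ →₀ R,
      ∑ t ∈ Finset.Ioc a b, f t = ∑ t ∈ Finset.Ico a b, f t + f b - f a := by
    intro a b hab f
    have e1 := Finset.sum_Ioc_add_eq_sum_Icc (f := f) hab.le
    have e2 := Finset.sum_Ico_add_eq_sum_Icc (f := f) hab.le
    rw [e2, ← e1]; abel
  simp only [Module.End.mul_apply, LinearMap.sub_apply, Module.End.one_apply, LinearMap.add_apply,
    swapPair_single, demazurePair_single, map_sub]
  rw [h1 a b, add_comm a b, h1 b a]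
  rcases lt_trichotomy a b with hab | hab | hab
  · rw [h2 a b hab]
    simp [Finset.Ico_eq_empty_of_le hab.le, Finset.Ioc_eq_empty_of_le hab.le]
    abel
  · subst hab; simp
  · rw [h2 b a hab]
    simp [Finset.Ico_eq_empty_of_le hab.le, Finset.Ioc_eq_empty_of_le hab.le]

/-- Multiplication by the first variable. -/
def mulFst : Module.End R (ℤ × ℤ →₀ R) := Finsupp.lmapDomain R R fun p => (p.1 + 1, p.2)

/-- Multiplication by the second variable. -/
def mulSnd : Module.End R (ℤ × ℤ →₀ R) := Finsupp.lmapDomain R R fun p => (p.1, p.2 + 1)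

theorem mulFst_single (a b : ℤ) :
    mulFst (Finsupp.single (a, b) (1 : R)) = Finsupp.single (a + 1, b) 1 := by
  simp [mulFst, Finsupp.mapDomain_single]

theorem mulSnd_single (a b : ℤ) :
    mulSnd (Finsupp.single (a, b) (1 : R)) = Finsupp.single (a, b + 1) 1 := by
  simp [mulSnd, Finsupp.mapDomain_single]

theorem swapPair_mul_mulFst : swapPair * mulFst = mulSnd * (swapPair : Module.End R _) :=
  linearMap_ext_single fun ⟨a, b⟩ => by simp [swapPair_single, mulFst_single, mulSnd_single]

theorem swapPair_mul_mulSnd : swapPair * mulSnd = mulFst * (swapPair : Module.End R _) :=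
  linearMap_ext_single fun ⟨a, b⟩ => by simp [swapPair_single, mulFst_single, mulSnd_single]

theorem demazurePair_mul_mulFst :
    demazurePair * mulFst = mulSnd * demazurePair + (mulSnd : Module.End R (ℤ × ℤ →₀ R)) := by
  refine linearMap_ext_single fun ⟨a, b⟩ => ?_
  simp only [Module.End.mul_apply, LinearMap.add_apply, mulFst_single, mulSnd_single,
    demazurePair_single, map_sub, map_sum]
  have e : ∀ t, a + 1 + b - t = a + b - t + 1 := fun t => by ring
  simp only [e]
  rcases lt_or_ge a b with hab | hab
  · rw [Finset.Ico_eq_empty_of_le (show a + 1 ≤ b from hab), Finset.Ico_eq_empty_of_le hab.le,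
      ← Finset.insert_Ico_add_one_left_eq_Ico hab, Finset.sum_insert (by simp)]
    simp
  · rw [← Finset.insert_Ico_right_eq_Ico_add_one hab, Finset.sum_insert (by simp),
      Finset.Ico_eq_empty_of_le hab, Finset.Ico_eq_empty_of_le (show b ≤ a + 1 by omega)]
    simp
    abel

theorem demazure_mul_snd {E : Type*} [Ring E] {s D x y : E} (hDs : D * s = -D)
    (hsD : s * D = D + 1 - s) (hx : s * x = y * s) (hy : s * y = x * s)
    (hDx : D * x = y * D + y) : D * y = x * D - y := by
  have h1 : s * D * x = x * (s * D) + x * s := by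
    rw [mul_assoc, hDx, mul_add, ← mul_assoc, hy, mul_assoc]
  rw [hsD] at h1
  simp only [add_mul, sub_mul, one_mul, mul_add, mul_sub, mul_one, hDx, hx] at h1
  have h2 : D * y = y * D - y * s := by
    calc D * y = -(D * s * y) := by rw [hDs]; noncomm_ring
      _ = -((y * D + y) * s) := by rw [mul_assoc, hy, ← mul_assoc, hDx]
      _ = -(y * (D * s) + y * s) := by rw [add_mul, mul_assoc]
      _ = _ := by rw [hDs, mul_neg]; abel
  have h3 : x * D = y * D + y - y * s := by
    calc x * D = (x * D + x - x * s + x * s) - x := by abel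
      _ = _ := by rw [← h1]; abel
  rw [h2, h3]
  abel

theorem demazurePair_mul_mulSnd :
    demazurePair * mulSnd = mulFst * demazurePair - (mulSnd : Module.End R (ℤ × ℤ →₀ R)) :=
  demazure_mul_snd (E := Module.End R (ℤ × ℤ →₀ R)) demazurePair_mul_swapPair swapPair_mul_demazurePair swapPair_mul_mulFst
    swapPair_mul_mulSnd demazurePair_mul_mulFst

theorem demazurePair_diag (a : ℤ) : demazurePair (Finsupp.single (a, a) (1 : R)) = 0 := by
  simp [demazurePair_single]

end Hecke

section HeckeSequences

variable {R : Type*} [CommRing R]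

theorem atPlace_heckePair_single (h κ : R) (i : ℕ) (k : ℕ → ℤ) :
    atPlace i (heckePair h κ) (Finsupp.single k 1) =
      if k i = k (i + 1) then κ • Finsupp.single k 1
      else if k i < k (i + 1) then Finsupp.single (upd k i (k (i + 1)) (k i)) 1
      else Finsupp.single (upd k i (k (i + 1)) (k i)) 1 - h • Finsupp.single k 1 := by
  rw [atPlace_single, heckePair_single]
  split_ifs with h1 h2
  · rw [Finsupp.mapDomain_single, upd_self, single_eq_smul]
  · rw [Finsupp.mapDomain_single]
  · rw [sub_eq_add_neg, Finsupp.mapDomain_add, ← Finsupp.single_neg, Finsupp.mapDomain_single,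
      Finsupp.mapDomain_single, upd_self, single_eq_smul k (-h), neg_smul, sub_eq_add_neg]

set_option linter.unusedSimpArgs false in
set_option linter.unusedTactic false in
set_option linter.unreachableTactic false in
/-- The finite Hecke operators satisfy the braid relation. -/
theorem heckePair_braid {h κ : R} (hκ : κ * κ = 1 - h * κ) (i : ℕ) :
    atPlace i (heckePair h κ) * atPlace (i + 1) (heckePair h κ) * atPlace i (heckePair h κ) =
    atPlace (i + 1) (heckePair h κ) * atPlace i (heckePair h κ) *
      atPlace (i + 1) (heckePair h κ) := by
  refine linearMap_ext_single fun k => ?_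
  let U : ℤ → ℤ → ℤ → ℕ → ℤ := fun x y z => upd (upd k i x y) (i + 1) y z
  have hU : k = U (k i) (k (i + 1)) (k (i + 1 + 1)) := by simp [U]
  have e0 : ∀ x y z, U x y z i = x := fun x y z => by
    simp [U, upd_of_ne _ _ _ (show i ≠ i + 1 by omega) (show i ≠ i + 1 + 1 by omega)]
  have e1 : ∀ x y z, U x y z (i + 1) = y := fun x y z => by simp [U]
  have e2 : ∀ x y z, U x y z (i + 1 + 1) = z := fun x y z => by simp [U]
  have u0 : ∀ x y z, upd (U x y z) i y x = U y x z := fun x y z => by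
    ext l; simp only [U, upd_apply]; split_ifs <;> first | rfl | omega
  have u1 : ∀ x y z, upd (U x y z) (i + 1) z y = U x z y := fun x y z => by
    ext l; simp only [U, upd_apply]; split_ifs <;> first | rfl | omega
  have hh0 : ∀ x y z, atPlace i (heckePair h κ) (Finsupp.single (U x y z) 1) =
      if x = y then κ • Finsupp.single (U x y z) 1
      else if x < y then Finsupp.single (U y x z) 1
      else Finsupp.single (U y x z) 1 - h • Finsupp.single (U x y z) 1 := fun x y z => by
    rw [atPlace_heckePair_single]; simp only [e0, e1, u0]
  have hh1 : ∀ x y z, atPlace (i + 1) (heckePair h κ) (Finsupp.single (U x y z) 1) =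
      if y = z then κ • Finsupp.single (U x y z) 1
      else if y < z then Finsupp.single (U x z y) 1
      else Finsupp.single (U x z y) 1 - h • Finsupp.single (U x y z) 1 := fun x y z => by
    rw [atPlace_heckePair_single]; simp only [e1, e2, u1]
  have hk : ∀ v : (ℕ → ℤ) →₀ R, κ • κ • v = v - h • κ • v := fun v => by
    rw [smul_smul, smul_smul, hκ, sub_smul, one_smul]
  have hk' : ∀ v : (ℕ → ℤ) →₀ R, κ • h • κ • v = h • v - h • h • κ • v := fun v => by
    rw [smul_comm κ h, hk, smul_sub]
  rw [hU]
  generalize k i = x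
  generalize k (i + 1) = y
  generalize k (i + 1 + 1) = z
  simp only [Module.End.mul_apply]
  rcases lt_trichotomy x y with hxy | hxy | hxy <;> rcases lt_trichotomy y z with hyz | hyz | hyz <;>
    rcases lt_trichotomy x z with hxz | hxz | hxz <;> first
    | (exfalso; omega)
    | (try subst hxy
       try subst hyz
       try subst hxz
       simp only [hh0, hh1, map_sub, map_smul, if_true, if_false, smul_sub, lt_irrefl, hk, hk',
         hxy, hxy.ne, hxy.ne', hxy.not_gt, hyz, hyz.ne, hyz.ne', hyz.not_gt, hxz,
         hxz.ne, hxz.ne', hxz.not_gt] <;> module)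
    | (try subst hxy
       try subst hyz
       try subst hxz
       simp only [hh0, hh1, map_sub, map_smul, if_true, if_false, smul_sub, lt_irrefl, hk, hk',
         hxy, hxy.ne, hxy.ne', hxy.not_gt] <;> module)
    | (try subst hxy
       try subst hyz
       try subst hxz
       simp only [hh0, hh1, map_sub, map_smul, if_true, if_false, smul_sub, lt_irrefl, hk, hk',
         hyz, hyz.ne, hyz.ne', hyz.not_gt] <;> module)
    | (subst hxy hyz
       simp only [hh0, hh1, map_smul, if_true])

/-- The algebraic identity behind the braid relation of the affine Hecke operators: the defect of
the braid relation intertwines multiplication by the variables. -/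
theorem braid_defect_mul {E : Type*} [Ring E] {h a b x y z : E} (hh : ∀ e : E, h * e = e * h)
    (ha : a * a = 1 - h * a) (hb : b * b = 1 - h * b)
    (hax : a * x = y * (a + h)) (hay : a * y = x * a - h * y) (haz : a * z = z * a)
    (hbx : b * x = x * b) (hby : b * y = z * (b + h)) (hbz : b * z = y * b - h * z) :
    (a * b * a - b * a * b) * x = z * (a * b * a - b * a * b) ∧
    (a * b * a - b * a * b) * y = y * (a * b * a - b * a * b) ∧
    (a * b * a - b * a * b) * z = x * (a * b * a - b * a * b) := by
  have ha' : (a + h) * a = 1 := by rw [add_mul, ha]; abel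
  have hb' : (b + h) * b = 1 := by rw [add_mul, hb]; abel
  have ha'' : a * (a + h) = 1 := by rw [mul_add, ha, hh]; abel
  have hb'' : b * (b + h) = 1 := by rw [mul_add, hb, hh]; abel
  have hay' : (a + h) * y = x * a := by rw [add_mul, hay]; abel
  have hbz' : (b + h) * z = y * b := by rw [add_mul, hbz]; abel
  -- in terms of the inverses `a + h`, `b + h` of `a`, `b`
  have key : a * (b + h) * (a + h) - (b + h) * (a + h) * b = a * b * a - b * a * b := by
    have e1 : a * (b + h) * (a + h) = a * b * a + h * (a * b) + h * (a * (a + h)) := by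
      simp only [add_mul, mul_add, mul_assoc, hh]
      abel
    have e2 : (b + h) * (a + h) * b = b * a * b + h * (a * b) + h * (b * (b + h)) := by
      simp only [add_mul, mul_add, mul_assoc, hh]
    rw [e1, e2, ha'', hb'']
    abel
  have key2 : (a + h) * b * a - b * a * (b + h) = a * b * a - b * a * b := by
    have e1 : (a + h) * b * a = a * b * a + h * (b * a) := by
      simp only [add_mul, mul_assoc]
    have e2 : b * a * (b + h) = b * a * b + h * (b * a) := by
      simp only [mul_add, mul_assoc, hh]
    rw [e1, e2]
    abel
  have hx1 : a * b * a * x = z * (a * (b + h) * (a + h)) := by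
    rw [mul_assoc, hax, ← mul_assoc, mul_assoc a b y, hby, ← mul_assoc a z, haz]
    simp only [mul_assoc]
  have hx2 : b * a * b * x = z * ((b + h) * (a + h) * b) := by
    rw [mul_assoc, hbx, ← mul_assoc, mul_assoc b a x, hax, ← mul_assoc b y, hby]
    simp only [mul_assoc]
  have hy1 : a * b * a * y = y * ((a + h) * b * a) - h * (z * (a * (b + h))) := by
    calc a * b * a * y = a * (b * (a * y)) := by simp only [mul_assoc]
      _ = a * x * (b * a) - h * (a * (b * y)) := by
        rw [hay, mul_sub, mul_sub, ← mul_assoc b x, hbx, ← mul_assoc b h, ← hh b, mul_assoc h b,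
          ← mul_assoc a h, ← hh a]
        simp only [mul_assoc]
      _ = _ := by rw [hax, hby, ← mul_assoc a z, haz]; simp only [mul_assoc]
  have hy2 : b * a * b * y = y * (b * a * (b + h)) - h * (z * (a * (b + h))) := by
    calc b * a * b * y = b * (a * (b * y)) := by simp only [mul_assoc]
      _ = b * z * (a * (b + h)) := by rw [hby, ← mul_assoc a z, haz]; simp only [mul_assoc]
      _ = _ := by rw [hbz, sub_mul]; simp only [mul_assoc]
  have hz1 : a * b * a * z = x * (a * b * a) - h * (y * (b * a)) - h * (z * (a * a)) := by
    calc a * b * a * z = a * (b * z) * a := by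
          rw [mul_assoc, haz]; simp only [mul_assoc]
      _ = a * y * (b * a) - h * (a * z * a) := by
        rw [hbz, mul_sub, ← mul_assoc a h, ← hh a, sub_mul]; simp only [mul_assoc]
      _ = _ := by rw [hay, haz, sub_mul]; simp only [mul_assoc]
  have hz2 : b * a * b * z = x * (b * a * b) - h * (z * ((b + h) * b)) - h * (y * (b * a))
      + h * (h * (z * a)) := by
    calc b * a * b * z = b * (a * (b * z)) := by simp only [mul_assoc]
      _ = b * (a * y) * b - h * (b * (a * z)) := by
        rw [hbz, mul_sub, mul_sub, ← mul_assoc a h, ← hh a, mul_assoc h a, ← mul_assoc b h, ← hh b]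
        simp only [mul_assoc]
      _ = b * x * (a * b) - h * (b * y * b) - h * (b * z * a) := by
        rw [hay, haz, mul_sub, sub_mul, ← mul_assoc b h, ← hh b]
        simp only [mul_assoc]
      _ = _ := by rw [hbx, hby, hbz]; simp only [mul_assoc, sub_mul, mul_sub]; abel
  refine ⟨?_, ?_, ?_⟩
  · rw [sub_mul, hx1, hx2, ← mul_sub, key]
  · rw [sub_mul, hy1, hy2, ← key2]
    simp only [mul_sub]
    abel
  · have e : z * (a * a) = z - h * (z * a) := by
      rw [ha, mul_sub, mul_one, ← mul_assoc z h, ← hh z, mul_assoc]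
    rw [sub_mul, hz1, hz2, hb', e]
    simp only [mul_sub, mul_one]
    abel

/-- The affine Hecke operator at the places `i`, `i + 1` of a pair of sequences: the first sequence
holds the colours, the second one the exponents of the variables. -/
def affHecke (h κ : R) (i : ℕ) : Module.End R ((ℕ → ℤ) × (ℕ → ℤ) →₀ R) :=
  onLeft _ (atPlace i (heckePair h κ)) * onRight _ (atPlace i swapPair) +
    algebraMap R _ h * onRight _ (atPlace i demazurePair)

theorem affHecke_mul_self_aux {E : Type*} [Ring E] {h t s d : E} (hh : ∀ e : E, h * e = e * h)
    (ht : t * t = 1 - h * t) (hs : s * s = 1) (hds : d * s = -d) (hsd : s * d = d + 1 - s)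
    (hts : Commute t s) (htd : Commute t d) (hdd : d * d = -d) :
    (t * s + h * d) * (t * s + h * d) = 1 - h * (t * s + h * d) := by
  have e1 : t * s * (t * s) = 1 - h * t := by
    rw [mul_assoc, ← mul_assoc s t, ← hts.eq, mul_assoc t s s, hs, mul_one, ht]
  have e2 : t * s * (h * d) = h * (t * (d + 1 - s)) := by
    rw [← hsd, ← mul_assoc, ← hh, mul_assoc, mul_assoc]
  have e3 : h * d * (t * s) = -(h * (t * d)) := by
    rw [mul_assoc, ← mul_assoc d t, ← htd.eq, mul_assoc t d s, hds]
    simp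
  have e4 : h * d * (h * d) = -(h * (h * d)) := by
    rw [mul_assoc, ← mul_assoc d h, ← hh d, mul_assoc h d, hdd]
    simp
  rw [add_mul, mul_add, mul_add, e1, e2, e3, e4]
  simp only [mul_add, mul_sub, mul_one]
  abel

theorem affHecke_mul_aux {E : Type*} [Ring E] {h t s d x y : E} (hh : ∀ e : E, h * e = e * h)
    (ht : t * y = y * t) (hs : s * x = y * s) :
    (d * x = y * d → (t * s + h * d) * x = y * (t * s + h * d)) ∧
    (d * x = y * d + y → (t * s + h * d) * x = y * (t * s + h * d + h)) ∧
    (d * x + x = y * d → (t * s + h * d) * x = y * (t * s + h * d) - h * x) := by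
  have e1 : (t * s + h * d) * x = y * (t * s) + h * (d * x) := by
    rw [add_mul, mul_assoc, hs, ← mul_assoc, ht, mul_assoc, mul_assoc]
  have e2 : ∀ e, y * (h * e) = h * (y * e) := fun e => by rw [← mul_assoc, ← hh y, mul_assoc]
  refine ⟨fun hd => ?_, fun hd => ?_, fun hd => ?_⟩
  · rw [e1, hd, mul_add, e2]
  · rw [e1, hd, mul_add, mul_add, mul_add, e2, hh y, add_assoc]
  · rw [e1, mul_add, e2, ← hd, mul_add]
    abel

theorem demazurePair_sum_Ioo (a b : ℤ) :
    demazurePair (∑ t ∈ Finset.Ioo a b, Finsupp.single (t, a + b - t) (1 : R)) = 0 := by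
  rw [map_sum]
  refine Finset.sum_involution (fun t _ => a + b - t) ?_ ?_ ?_ ?_
  · intro t _
    have h1 := LinearMap.congr_fun (demazurePair_mul_swapPair (R := R))
      (Finsupp.single (t, a + b - t) 1)
    rw [Module.End.mul_apply, swapPair_single, LinearMap.neg_apply] at h1
    rw [show a + b - (a + b - t) = t by ring, h1, add_neg_cancel]
  · intro t _ h1 h2
    rw [h2, demazurePair_diag] at h1
    exact h1 rfl
  · intro t ht
    rw [Finset.mem_Ioo] at ht ⊢
    omega
  · intro t _
    ring

theorem demazurePair_mul_self :
    demazurePair * demazurePair = -(demazurePair : Module.End R (ℤ × ℤ →₀ R)) := by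
  have key : ∀ a b : ℤ, a < b →
      demazurePair (∑ t ∈ Finset.Ico a b, Finsupp.single (t, a + b - t) (1 : R)) =
        demazurePair (Finsupp.single (a, b) 1) := by
    intro a b hab
    rw [← Finset.Ioo_insert_left hab, Finset.sum_insert (by simp), map_add,
      demazurePair_sum_Ioo, add_zero]
    congr 3
    ring
  have anti : ∀ a b : ℤ, demazurePair (Finsupp.single (b, a) (1 : R)) =
      -demazurePair (Finsupp.single (a, b) 1) := fun a b => by
    have h1 := LinearMap.congr_fun (demazurePair_mul_swapPair (R := R)) (Finsupp.single (a, b) 1)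
    rwa [Module.End.mul_apply, swapPair_single, LinearMap.neg_apply] at h1
  refine linearMap_ext_single fun ⟨a, b⟩ => ?_
  rw [Module.End.mul_apply, LinearMap.neg_apply]
  conv_lhs => rw [demazurePair_single, map_sub]
  rcases lt_trichotomy a b with hab | hab | hab
  · rw [key a b hab, Finset.Ico_eq_empty_of_le hab.le]
    simp
  · subst hab
    simp [demazurePair_diag]
  · rw [add_comm a b, key b a hab, Finset.Ico_eq_empty_of_le hab.le, anti a b]
    simp

theorem atPlaceHom_apply (i : ℕ) (f : Module.End R (ℤ × ℤ →₀ R)) :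
    atPlaceHom i f = atPlace i f := rfl

theorem onLeftHom_apply {α β : Type*} (f : Module.End R (α →₀ R)) :
    onLeftHom β f = onLeft β f := rfl

theorem onRightHom_apply {α β : Type*} (f : Module.End R (β →₀ R)) :
    onRightHom α f = onRight α f := rfl

theorem mulFst_eq (i : ℕ) : shift (R := R) i = atPlace i mulFst := shift_eq_left i

theorem mulSnd_eq (i : ℕ) : shift (R := R) (i + 1) = atPlace i mulSnd := shift_eq_right i

section Params

variable (h κ : R)

theorem affHecke_mul_self (hκ : κ * κ = 1 - h * κ) (i : ℕ) :
    affHecke h κ i * affHecke h κ i = 1 - algebraMap R _ h * affHecke h κ i := by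
  refine affHecke_mul_self_aux (E := Module.End R ((ℕ → ℤ) × (ℕ → ℤ) →₀ R)) (Algebra.commutes h) ?_ ?_ ?_ ?_ (onLeft_commute_onRight _ _)
    (onLeft_commute_onRight _ _) ?_
  · have := congrArg (onLeftHom (R := R) (ℕ → ℤ) ∘ atPlaceHom i)
      (eq_sub_iff_add_eq.1 (heckePair_mul_self hκ))
    simp only [Function.comp_apply, map_add, map_mul, map_one, map_smul, onLeftHom_apply,
      atPlaceHom_apply] at this
    rw [Algebra.smul_def] at this
    exact eq_sub_of_add_eq this
  · have := congrArg (onRightHom (R := R) (ℕ → ℤ) ∘ atPlaceHom i) (swapPair_mul_self (R := R))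
    simpa only [Function.comp_apply, map_mul, map_one, onRightHom_apply,
      atPlaceHom_apply] using this
  · have := congrArg (onRightHom (R := R) (ℕ → ℤ) ∘ atPlaceHom i)
      (eq_neg_iff_add_eq_zero.1 (demazurePair_mul_swapPair (R := R)))
    simp only [Function.comp_apply, map_add, map_mul, map_zero, onRightHom_apply,
      atPlaceHom_apply] at this
    exact eq_neg_of_add_eq_zero_left this
  · have := congrArg (onRightHom (R := R) (ℕ → ℤ) ∘ atPlaceHom i)
      (eq_sub_iff_add_eq.1 (swapPair_mul_demazurePair (R := R)))
    simp only [Function.comp_apply, map_add, map_mul, map_one, onRightHom_apply,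
      atPlaceHom_apply] at this
    exact eq_sub_of_add_eq this
  · have := congrArg (onRightHom (R := R) (ℕ → ℤ) ∘ atPlaceHom i)
      (eq_neg_iff_add_eq_zero.1 (demazurePair_mul_self (R := R)))
    simp only [Function.comp_apply, map_add, map_mul, map_zero, onRightHom_apply,
      atPlaceHom_apply] at this
    exact eq_neg_of_add_eq_zero_left this

/-- Multiplication by the variable with index `j`. -/
def mulVar (j : ℕ) : Module.End R ((ℕ → ℤ) × (ℕ → ℤ) →₀ R) := onRight _ (shift j)

theorem mulVar_single (j : ℕ) (c m : ℕ → ℤ) : mulVar j (Finsupp.single (c, m) (1 : R)) =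
    Finsupp.single (c, Function.update m j (m j + 1)) 1 := by
  simp [mulVar, onRight_single, shift_single, Finsupp.mapDomain_single]

theorem mulVar_injective (j : ℕ) : Function.Injective (mulVar (R := R) j) := by
  have : mulVar (R := R) j = Finsupp.lmapDomain R R
      fun p => (p.1, Function.update p.2 j (p.2 j + 1)) :=
    linearMap_ext_single fun ⟨c, m⟩ => by simp [mulVar_single, Finsupp.mapDomain_single]
  rw [this]
  refine Finsupp.mapDomain_injective ?_
  rintro ⟨c, m⟩ ⟨c', m'⟩ hcm
  simp only [Prod.mk.injEq] at hcm ⊢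
  refine ⟨hcm.1, ?_⟩
  ext l
  have := congrFun hcm.2 l
  by_cases hl : l = j
  · subst hl; simpa using this
  · simpa [hl] using this

theorem affHecke_commute_mulVar {i j : ℕ} (h1 : j ≠ i) (h2 : j ≠ i + 1) :
    affHecke h κ i * mulVar j = mulVar j * affHecke h κ i := by
  have c1 := (onLeft_commute_onRight (atPlace i (heckePair h κ)) (shift j)).eq
  have c2 := congrArg (onRightHom (R := R) (ℕ → ℤ)) (shift_commute h1 h2 swapPair).eq
  have c3 := congrArg (onRightHom (R := R) (ℕ → ℤ)) (shift_commute h1 h2 demazurePair).eq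
  simp only [map_mul, onRightHom_apply] at c2 c3
  exact (affHecke_mul_aux (E := Module.End R ((ℕ → ℤ) × (ℕ → ℤ) →₀ R)) (Algebra.commutes h) c1
    c2.symm).1 c3.symm

theorem affHecke_mul_mulVar (i : ℕ) : affHecke h κ i * mulVar i =
    mulVar (i + 1) * (affHecke h κ i + algebraMap R _ h) := by
  have c1 := (onLeft_commute_onRight (atPlace i (heckePair h κ)) (shift (R := R) (i + 1))).eq
  have c2 := congrArg (onRightHom (R := R) (ℕ → ℤ) ∘ atPlaceHom i)
    (swapPair_mul_mulFst (R := R))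
  have c3 := congrArg (onRightHom (R := R) (ℕ → ℤ) ∘ atPlaceHom i)
    (demazurePair_mul_mulFst (R := R))
  simp only [Function.comp_apply, map_add, map_mul, onRightHom_apply, atPlaceHom_apply] at c2 c3
  rw [← mulFst_eq, ← mulSnd_eq] at c2 c3
  exact (affHecke_mul_aux (E := Module.End R ((ℕ → ℤ) × (ℕ → ℤ) →₀ R)) (Algebra.commutes h) c1
    c2).2.1 c3

theorem affHecke_mul_mulVar_succ (i : ℕ) : affHecke h κ i * mulVar (i + 1) =
    mulVar i * affHecke h κ i - algebraMap R _ h * mulVar (i + 1) := by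
  have c1 := (onLeft_commute_onRight (atPlace i (heckePair h κ)) (shift (R := R) i)).eq
  have c2 := congrArg (onRightHom (R := R) (ℕ → ℤ) ∘ atPlaceHom i)
    (swapPair_mul_mulSnd (R := R))
  have c3 := congrArg (onRightHom (R := R) (ℕ → ℤ) ∘ atPlaceHom i)
    ((eq_sub_iff_add_eq (G := Module.End R (ℤ × ℤ →₀ R))).1 (demazurePair_mul_mulSnd (R := R)))
  simp only [Function.comp_apply, map_add, map_mul, onRightHom_apply, atPlaceHom_apply] at c2 c3
  rw [← mulFst_eq, ← mulSnd_eq] at c2 c3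
  exact (affHecke_mul_aux (E := Module.End R ((ℕ → ℤ) × (ℕ → ℤ) →₀ R)) (Algebra.commutes h) c1
    c2).2.2 c3

theorem affHecke_commute {i j : ℕ} (hij : i + 2 ≤ j) :
    Commute (affHecke h κ i) (affHecke h κ j) := by
  have c1 : ∀ f g : Module.End R (ℤ × ℤ →₀ R), Commute
      (onLeft (ℕ → ℤ) (atPlace i f)) (onLeft (ℕ → ℤ) (atPlace j g)) := fun f g =>
    (atPlace_commute hij f g).map (onLeftHom (R := R) (ℕ → ℤ))
  have c2 : ∀ f g : Module.End R (ℤ × ℤ →₀ R), Commute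
      (onRight (ℕ → ℤ) (atPlace i f)) (onRight (ℕ → ℤ) (atPlace j g)) := fun f g =>
    (atPlace_commute hij f g).map (onRightHom (R := R) (ℕ → ℤ))
  have c3 : ∀ x : Module.End R ((ℕ → ℤ) × (ℕ → ℤ) →₀ R), Commute (algebraMap R _ h) x :=
    Algebra.commutes h
  refine Commute.add_left ?_ ?_
  · refine Commute.add_right ?_ ?_
    · exact ((c1 _ _).mul_right (onLeft_commute_onRight _ _)).mul_left
        ((onLeft_commute_onRight _ _).symm.mul_right (c2 _ _))
    · exact (c3 _).symm.mul_right ((onLeft_commute_onRight _ _).mul_left (c2 _ _))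
  · refine (c3 _).mul_left (Commute.add_right ?_ ?_)
    · exact (onLeft_commute_onRight _ _).symm.mul_right (c2 _ _)
    · exact (c3 _).symm.mul_right (c2 _ _)

theorem affHecke_single_of_eq (i : ℕ) (c m : ℕ → ℤ) (hm : m i = m (i + 1)) :
    affHecke h κ i (Finsupp.single (c, m) 1) =
      onLeft _ (atPlace i (heckePair h κ)) (Finsupp.single (c, m) 1) := by
  rw [affHecke, LinearMap.add_apply, Module.End.mul_apply, Module.End.mul_apply, onRight_single,
    onRight_single, atPlace_single, atPlace_single, swapPair_single, ← hm, demazurePair_diag]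
  have : upd m i (m i) (m i) = m := by conv_rhs => rw [← upd_self m i, ← hm]
  simp [Finsupp.mapDomain_single, this]

/-- The affine Hecke operators satisfy the braid relation: the defect intertwines multiplication by
the variables, so it suffices to test it on monomials of degree `0`, where the finite Hecke
operators act. -/
theorem affHecke_braid (hκ : κ * κ = 1 - h * κ) (i : ℕ) :
    affHecke h κ i * affHecke h κ (i + 1) * affHecke h κ i =
    affHecke h κ (i + 1) * affHecke h κ i * affHecke h κ (i + 1) := by
  obtain ⟨hx, hy, hz⟩ := braid_defect_mul (E := Module.End R ((ℕ → ℤ) × (ℕ → ℤ) →₀ R))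
    (Algebra.commutes h) (affHecke_mul_self h κ hκ i)
    (affHecke_mul_self h κ hκ (i + 1)) (affHecke_mul_mulVar h κ i) (affHecke_mul_mulVar_succ h κ i)
    (affHecke_commute_mulVar h κ (i := i) (j := i + 1 + 1) (by omega) (by omega))
    (affHecke_commute_mulVar h κ (i := i + 1) (j := i) (by omega) (by omega))
    (affHecke_mul_mulVar h κ (i + 1)) (affHecke_mul_mulVar_succ h κ (i + 1))
  set δ := affHecke h κ i * affHecke h κ (i + 1) * affHecke h κ i -
    affHecke h κ (i + 1) * affHecke h κ i * affHecke h κ (i + 1) with hδ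
  have step : ∀ (j j' : ℕ), δ * mulVar j = mulVar j' * δ → ∀ c m,
      δ (Finsupp.single (c, Function.update m j (m j + 1)) 1) = 0 ↔
      δ (Finsupp.single (c, m) 1) = 0 := by
    intro j j' hj c m
    have h1 := LinearMap.congr_fun hj (Finsupp.single (c, m) 1)
    rw [Module.End.mul_apply, Module.End.mul_apply, mulVar_single] at h1
    rw [h1, map_eq_zero_iff _ (mulVar_injective j')]
  have step' : ∀ (j j' : ℕ), δ * mulVar j = mulVar j' * δ → ∀ c m (a : ℤ),
      δ (Finsupp.single (c, Function.update m j a) 1) = 0 ↔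
      δ (Finsupp.single (c, m) 1) = 0 := by
    intro j j' hj c m a
    have h1 : ∀ b : ℤ, δ (Finsupp.single (c, Function.update m j (b + 1)) 1) = 0 ↔
        δ (Finsupp.single (c, Function.update m j b) 1) = 0 := fun b => by
      simpa using step j j' hj c (Function.update m j b)
    have h2 : ∀ b : ℤ, δ (Finsupp.single (c, Function.update m j b) 1) = 0 ↔
        δ (Finsupp.single (c, Function.update m j 0) 1) = 0 := fun b => by
      induction b with
      | zero => rfl
      | succ n ih => rw [h1, ih]
      | pred n ih => rw [← ih, ← h1, sub_add_cancel]
    rw [h2, ← h2 (m j), Function.update_eq_self]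
  have hall : ∀ c m, δ (Finsupp.single (c, m) 1) = 0 := by
    intro c m
    rw [← step' i _ hx c m 0, ← step' (i + 1) _ hy c _ 0, ← step' (i + 1 + 1) _ hz c _ 0]
    set m' := Function.update (Function.update (Function.update m i 0) (i + 1) 0) (i + 1 + 1) 0
      with hm'
    have e1 : m' i = m' (i + 1) := by simp [hm', Function.update_apply]
    have e2 : m' (i + 1) = m' (i + 1 + 1) := by simp [hm']
    have f1 : ∀ y, affHecke h κ i (Finsupp.mapDomain (fun c => (c, m')) y) =
        Finsupp.mapDomain (fun c => (c, m')) (atPlace i (heckePair h κ) y) := by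
      intro y
      induction y using Finsupp.induction_linear with
      | zero => simp
      | add y z hy hz => rw [Finsupp.mapDomain_add, map_add, map_add, Finsupp.mapDomain_add, hy, hz]
      | single p r =>
        rw [single_eq_smul p, Finsupp.mapDomain_smul, map_smul, map_smul, Finsupp.mapDomain_smul,
          Finsupp.mapDomain_single, affHecke_single_of_eq h κ i p m' e1, onLeft_single]
    have f2 : ∀ y, affHecke h κ (i + 1) (Finsupp.mapDomain (fun c => (c, m')) y) =
        Finsupp.mapDomain (fun c => (c, m')) (atPlace (i + 1) (heckePair h κ) y) := by
      intro y
      induction y using Finsupp.induction_linear with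
      | zero => simp
      | add y z hy hz => rw [Finsupp.mapDomain_add, map_add, map_add, Finsupp.mapDomain_add, hy, hz]
      | single p r =>
        rw [single_eq_smul p, Finsupp.mapDomain_smul, map_smul, map_smul, Finsupp.mapDomain_smul,
          Finsupp.mapDomain_single, affHecke_single_of_eq h κ (i + 1) p m' e2, onLeft_single]
    have e3 : Finsupp.single (c, m') (1 : R) =
        Finsupp.mapDomain (fun c => (c, m')) (Finsupp.single c 1) := by
      rw [Finsupp.mapDomain_single]
    have br := LinearMap.congr_fun (heckePair_braid hκ i) (Finsupp.single c 1)
    simp only [Module.End.mul_apply] at br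
    rw [hδ, LinearMap.sub_apply, e3]
    simp only [Module.End.mul_apply, f1, f2]
    rw [br, sub_self]
  rw [← sub_eq_zero, ← hδ]
  exact linearMap_ext_single fun ⟨c, m⟩ => hall c m

end Params

end HeckeSequences

section Casimir

variable {R : Type*} [CommRing R]

/-- Sequences of labels: the colours `c` and the exponents `m`, and the abacus indices `d`. -/
abbrev LabelSeq : Type := ((ℕ → ℤ) × (ℕ → ℤ)) × (ℕ → ℤ)

/-- The affine Hecke action on the labels `c`, `m`. -/
def hA (h κ : R) (i : ℕ) : Module.End R (LabelSeq →₀ R) := onLeft _ (affHecke h κ i)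

/-- The finite Hecke action on the labels `d`. -/
def hB (h κ : R) (i : ℕ) : Module.End R (LabelSeq →₀ R) := onRight _ (atPlace i (heckePair h κ))

/-- The intertwiner `∑_w a_w b_w`. -/
def casimir (h κ κ' : R) (r : ℕ) : Module.End R (LabelSeq →₀ R) :=
  symSum (fun i => hA h κ i * hB h κ' i) r

section
variable {h κ κ' : R}

theorem hA_mul_self (hκ : κ * κ = 1 - h * κ) (i : ℕ) :
    hA h κ i * hA h κ i = 1 - algebraMap R _ h * hA h κ i := by
  have := congrArg (onLeftHom (R := R) (ℕ → ℤ))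
    ((eq_sub_iff_add_eq (G := Module.End R ((ℕ → ℤ) × (ℕ → ℤ) →₀ R))).1
      (affHecke_mul_self h κ hκ i))
  rw [← Algebra.smul_def] at this
  simp only [map_add, map_mul, map_one, map_smul, onLeftHom_apply] at this
  rw [Algebra.smul_def] at this
  exact (eq_sub_iff_add_eq (G := Module.End R (LabelSeq →₀ R))).2 this

theorem hB_mul_self (hκ : κ * κ = 1 - h * κ) (i : ℕ) :
    hB h κ i * hB h κ i = 1 - algebraMap R _ h * hB h κ i := by
  have := congrArg (onRightHom (R := R) ((ℕ → ℤ) × (ℕ → ℤ)) ∘ atPlaceHom i)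
    ((eq_sub_iff_add_eq (G := Module.End R (ℤ × ℤ →₀ R))).1 (heckePair_mul_self hκ))
  simp only [Function.comp_apply, map_add, map_mul, map_one, map_smul, onRightHom_apply,
    atPlaceHom_apply] at this
  rw [Algebra.smul_def] at this
  exact (eq_sub_iff_add_eq (G := Module.End R (LabelSeq →₀ R))).2 this

/-- The intertwiner takes the same values on `a_i` and `b_i`, hence kills the straightening
relations. -/
theorem casimir_mul (hκ : κ * κ = 1 - h * κ) (hκ' : κ' * κ' = 1 - h * κ') {r i : ℕ}
    (hi : i + 1 < r) : casimir h κ κ' r * hA h κ i = casimir h κ κ' r * hB h κ' i := by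
  refine symSum_mul_eq (E := Module.End R (LabelSeq →₀ R)) (h := algebraMap R _ h)
    (hA_mul_self hκ) (hB_mul_self hκ') (fun i => show Commute (algebraMap R (Module.End R (LabelSeq →₀ R)) h) _ from
      Algebra.commutes h _)
    (fun i j => onLeft_commute_onRight _ _) ?_ ?_ ?_ ?_ r i hi
  · exact fun i j hij => (affHecke_commute h κ hij).map (onLeftHom (R := R) (ℕ → ℤ))
  · exact fun i j hij => (atPlace_commute hij _ _).map
      (onRightHom (R := R) ((ℕ → ℤ) × (ℕ → ℤ)))
  · intro i
    have := congrArg (onLeftHom (R := R) (ℕ → ℤ)) (affHecke_braid h κ hκ i)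
    simp only [map_mul] at this
    exact this
  · intro i
    have := congrArg (onRightHom (R := R) ((ℕ → ℤ) × (ℕ → ℤ))) (heckePair_braid hκ' i)
    simp only [map_mul] at this
    exact this

end

/-! ### Change of rings -/

section BaseChange

variable {R' : Type*} [CommRing R'] (φ : R →+* R')

/-- Extension of scalars for vectors. -/
def mapCoeff {α : Type*} : (α →₀ R) →+ (α →₀ R') := Finsupp.mapRange.addMonoidHom φ.toAddMonoidHom

@[simp] theorem mapCoeff_apply {α : Type*} (x : α →₀ R) (a : α) : mapCoeff φ x a = φ (x a) := rfl

theorem mapCoeff_single {α : Type*} (a : α) (r : R) :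
    mapCoeff φ (Finsupp.single a r) = Finsupp.single a (φ r) := by
  simp [mapCoeff]

theorem mapCoeff_smul {α : Type*} (r : R) (x : α →₀ R) :
    mapCoeff φ (r • x) = φ r • mapCoeff φ x := by
  ext a; simp

theorem mapCoeff_mapDomain {α β : Type*} (f : α → β) (x : α →₀ R) :
    mapCoeff φ (Finsupp.mapDomain f x) = Finsupp.mapDomain f (mapCoeff φ x) := by
  induction x using Finsupp.induction_linear with
  | zero => simp
  | add x y hx hy => rw [Finsupp.mapDomain_add, map_add, hx, hy, map_add, Finsupp.mapDomain_add]
  | single a r => simp [mapCoeff_single, Finsupp.mapDomain_single]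

/-- `f'` is obtained from `f` by extension of scalars. -/
def IsScalarExtension {α : Type*} (f : Module.End R (α →₀ R)) (f' : Module.End R' (α →₀ R')) : Prop :=
  ∀ x, mapCoeff φ (f x) = f' (mapCoeff φ x)

variable {φ} {α β : Type*}

theorem isScalarExtension_of_single {f : Module.End R (α →₀ R)} {f' : Module.End R' (α →₀ R')}
    (h : ∀ a, mapCoeff φ (f (Finsupp.single a 1)) = f' (Finsupp.single a 1)) :
    IsScalarExtension φ f f' := by
  intro x
  induction x using Finsupp.induction_linear with
  | zero => simp
  | add x y hx hy => rw [map_add, map_add, hx, hy, map_add, map_add]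
  | single a r =>
    rw [single_eq_smul, map_smul, mapCoeff_smul, mapCoeff_smul, map_smul, h, mapCoeff_single,
      map_one]

theorem IsScalarExtension.mul {f g : Module.End R (α →₀ R)} {f' g' : Module.End R' (α →₀ R')}
    (hf : IsScalarExtension φ f f') (hg : IsScalarExtension φ g g') : IsScalarExtension φ (f * g) (f' * g') :=
  fun x => by rw [Module.End.mul_apply, hf, hg, Module.End.mul_apply]

theorem IsScalarExtension.add {f g : Module.End R (α →₀ R)} {f' g' : Module.End R' (α →₀ R')}
    (hf : IsScalarExtension φ f f') (hg : IsScalarExtension φ g g') : IsScalarExtension φ (f + g) (f' + g') :=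
  fun x => by rw [LinearMap.add_apply, map_add, hf, hg, LinearMap.add_apply]

theorem isScalarExtension_one : IsScalarExtension φ (1 : Module.End R (α →₀ R)) 1 := fun _ => rfl

theorem isScalarExtension_algebraMap (r : R) : IsScalarExtension φ
    (algebraMap R (Module.End R (α →₀ R)) r) (algebraMap R' (Module.End R' (α →₀ R')) (φ r)) :=
  fun x => by simp [Module.algebraMap_end_apply, mapCoeff_smul]

theorem isScalarExtension_sum {ι : Type*} (s : Finset ι) {f : ι → Module.End R (α →₀ R)}
    {f' : ι → Module.End R' (α →₀ R')} (hf : ∀ i, IsScalarExtension φ (f i) (f' i)) :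
    IsScalarExtension φ (∑ i ∈ s, f i) (∑ i ∈ s, f' i) :=
  fun x => by simp [LinearMap.sum_apply, map_sum, hf _ x]

theorem IsScalarExtension.symSum {f : ℕ → Module.End R (α →₀ R)} {f' : ℕ → Module.End R' (α →₀ R')}
    (hf : ∀ i, IsScalarExtension φ (f i) (f' i)) (r : ℕ) :
    IsScalarExtension φ (symSum f r) (symSum f' r) := by
  have h1 : ∀ i k, IsScalarExtension φ (descProd f i k) (descProd f' i k) := by
    intro i k
    induction k with
    | zero => exact isScalarExtension_one
    | succ k ih => exact (hf _).mul ih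
  induction r with
  | zero => exact isScalarExtension_one
  | succ r ih => exact ih.mul (isScalarExtension_sum _ fun j => h1 _ _)

theorem IsScalarExtension.atPlace {f : Module.End R (ℤ × ℤ →₀ R)} {f' : Module.End R' (ℤ × ℤ →₀ R')}
    (hf : IsScalarExtension φ f f') (i : ℕ) : IsScalarExtension φ (atPlace i f) (atPlace i f') :=
  isScalarExtension_of_single fun k => by
    rw [atPlace_single, atPlace_single, mapCoeff_mapDomain, hf, mapCoeff_single, map_one]

theorem IsScalarExtension.onLeft {f : Module.End R (α →₀ R)} {f' : Module.End R' (α →₀ R')}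
    (hf : IsScalarExtension φ f f') : IsScalarExtension φ (onLeft β f) (onLeft β f') :=
  isScalarExtension_of_single fun ⟨a, b⟩ => by
    rw [onLeft_single, onLeft_single, mapCoeff_mapDomain, hf, mapCoeff_single, map_one]

theorem IsScalarExtension.onRight {f : Module.End R (β →₀ R)} {f' : Module.End R' (β →₀ R')}
    (hf : IsScalarExtension φ f f') : IsScalarExtension φ (onRight α f) (onRight α f') :=
  isScalarExtension_of_single fun ⟨a, b⟩ => by
    rw [onRight_single, onRight_single, mapCoeff_mapDomain, hf, mapCoeff_single, map_one]

theorem isScalarExtension_heckePair (h κ : R) :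
    IsScalarExtension φ (heckePair h κ) (heckePair (φ h) (φ κ)) :=
  isScalarExtension_of_single fun ⟨a, b⟩ => by
    rw [heckePair_single, heckePair_single]
    split_ifs <;> simp [mapCoeff_single]

theorem isScalarExtension_casimir (h κ κ' : R) (r : ℕ) :
    IsScalarExtension φ (casimir h κ κ' r) (casimir (φ h) (φ κ) (φ κ') r) := by
  refine IsScalarExtension.symSum (fun i => IsScalarExtension.mul ?_ ?_) r
  · refine IsScalarExtension.onLeft (IsScalarExtension.add (IsScalarExtension.mul ?_ ?_)
      (IsScalarExtension.mul (isScalarExtension_algebraMap h) ?_))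
    · exact ((isScalarExtension_heckePair h κ).atPlace i).onLeft
    · refine (IsScalarExtension.atPlace (isScalarExtension_of_single fun ⟨a, b⟩ => ?_) i).onRight
      simp [swapPair_single, mapCoeff_single]
    · refine (IsScalarExtension.atPlace (isScalarExtension_of_single fun ⟨a, b⟩ => ?_) i).onRight
      simp [demazurePair_single, mapCoeff_single]
  · exact ((isScalarExtension_heckePair h κ').atPlace i).onRight

end BaseChange

/-! ### The specialisation `q = 1` -/

/-- Rearrangement of a sequence of labels. -/
def LabelSeq.perm (p : LabelSeq) (π : Equiv.Perm ℕ) : LabelSeq :=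
  ((p.1.1 ∘ π, p.1.2 ∘ π), p.2 ∘ π)

theorem LabelSeq.perm_mul (p : LabelSeq) (π ρ : Equiv.Perm ℕ) :
    p.perm (π * ρ) = (p.perm π).perm ρ := rfl

theorem upd_eq_comp_swap (k : ℕ → ℤ) (i : ℕ) :
    upd k i (k (i + 1)) (k i) = k ∘ Equiv.swap i (i + 1) := by
  ext j
  simp only [upd_apply, Function.comp, Equiv.swap_apply_def]
  split_ifs <;> rfl

theorem heckePair_one_single (κ : R) (i : ℕ) (k : ℕ → ℤ) :
    ∃ ε : R, atPlace i (heckePair 0 κ) (Finsupp.single k 1) =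
      ε • Finsupp.single (k ∘ Equiv.swap i (i + 1)) 1 := by
  rw [atPlace_heckePair_single, ← upd_eq_comp_swap]
  split_ifs with h1 h2
  · refine ⟨κ, ?_⟩
    conv_lhs => rw [← upd_self k i, h1]
    rw [h1]
  · exact ⟨1, by simp⟩
  · exact ⟨1, by simp⟩

theorem hA_hB_single (κ κ' : R) (i : ℕ) (p : LabelSeq) :
    ∃ ε : R, (hA 0 κ i * hB 0 κ' i) (Finsupp.single p 1) =
      ε • Finsupp.single (p.perm (Equiv.swap i (i + 1))) 1 := by
  obtain ⟨⟨c, m⟩, d⟩ := p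
  obtain ⟨ε, hε⟩ := heckePair_one_single κ i c
  obtain ⟨ε', hε'⟩ := heckePair_one_single κ' i d
  refine ⟨ε' * ε, ?_⟩
  have hm : upd m i (m (i + 1)) (m i) = m ∘ Equiv.swap i (i + 1) := upd_eq_comp_swap m i
  rw [Module.End.mul_apply, hB, onRight_single, hε', Finsupp.mapDomain_smul, map_smul,
    Finsupp.mapDomain_single, hA, onLeft_single, affHecke, LinearMap.add_apply, map_zero, zero_mul,
    LinearMap.zero_apply, add_zero, Module.End.mul_apply, onRight_single, atPlace_single,
    swapPair_single, Finsupp.mapDomain_single, Finsupp.mapDomain_single, onLeft_single, hε,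
    Finsupp.mapDomain_smul, Finsupp.mapDomain_smul, Finsupp.mapDomain_single,
    Finsupp.mapDomain_single, smul_smul, hm]
  rfl

theorem descProd_single (κ κ' : R) (j k : ℕ) (p : LabelSeq) :
    ∃ (ε : R) (π : Equiv.Perm ℕ), π (j + k) = j ∧ (∀ l, j + k < l → π l = l) ∧
      descProd (fun i => hA 0 κ i * hB 0 κ' i) j k (Finsupp.single p 1) =
        ε • Finsupp.single (p.perm π) 1 := by
  induction k with
  | zero => exact ⟨1, 1, by simp, by simp, by simp [descProd]; rfl⟩
  | succ k ih =>
    obtain ⟨ε, π, h1, h2, h3⟩ := ih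
    obtain ⟨ε', h4⟩ := hA_hB_single κ κ' (j + k) (p.perm π)
    refine ⟨ε * ε', π * Equiv.swap (j + k) (j + k + 1), ?_, ?_, ?_⟩
    · rw [Equiv.Perm.mul_apply, ← add_assoc, Equiv.swap_apply_right, h1]
    · intro l hl
      rw [Equiv.Perm.mul_apply, Equiv.swap_apply_of_ne_of_ne (by omega) (by omega),
        h2 l (by omega)]
    · rw [descProd, Module.End.mul_apply, h3, map_smul, h4, smul_smul, LabelSeq.perm_mul]

/-- For `h = 0` both Hecke actions permute labels up to scalars, so that the intertwiner yields a
combination of rearrangements. -/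
theorem casimir_one_support (κ κ' : R) (r : ℕ) (p p' : LabelSeq)
    (hp : casimir 0 κ κ' r (Finsupp.single p 1) p' ≠ 0) :
    ∃ π : Equiv.Perm ℕ, (∀ l, r ≤ l → π l = l) ∧ p' = p.perm π := by
  induction r generalizing p with
  | zero =>
    refine ⟨1, by simp, ?_⟩
    by_contra hne
    refine hp ?_
    simp only [casimir, symSum, Module.End.one_apply]
    exact Finsupp.single_eq_of_ne hne
  | succ r ih =>
    have e : casimir 0 κ κ' (r + 1) (Finsupp.single p 1) = ∑ j ∈ Finset.range (r + 1),
        casimir 0 κ κ' r (descProd (fun i => hA 0 κ i * hB 0 κ' i) j (r - j)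
          (Finsupp.single p 1)) := by
      rw [casimir, symSum, Module.End.mul_apply, LinearMap.sum_apply, map_sum]
      rfl
    rw [e, Finsupp.finsetSum_apply] at hp
    obtain ⟨j, hj, hne⟩ := Finset.exists_ne_zero_of_sum_ne_zero hp
    rw [Finset.mem_range] at hj
    obtain ⟨ε, π, h1, h2, h3⟩ := descProd_single κ κ' j (r - j) p
    rw [h3, map_smul, Finsupp.smul_apply] at hne
    obtain ⟨ρ, h4, h5⟩ := ih _ (right_ne_zero_of_smul hne)
    refine ⟨π * ρ, fun l hl => ?_, h5⟩
    rw [Equiv.Perm.mul_apply, h4 l (by omega), h2 l (by omega)]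

/-- If the entries have distinct labels, the only permutation that fixes the sequence is the
identity, whose coefficient in the intertwiner is `1`. -/
theorem casimir_one_diag (κ κ' : R) (r : ℕ) (p : LabelSeq)
    (hp : ∀ i j, i < j → j < r → ¬ (p.1.1 i = p.1.1 j ∧ p.1.2 i = p.1.2 j ∧ p.2 i = p.2 j)) :
    casimir 0 κ κ' r (Finsupp.single p 1) p = 1 := by
  induction r with
  | zero => simp [casimir, symSum]
  | succ r ih =>
    have e : casimir 0 κ κ' (r + 1) (Finsupp.single p 1) = ∑ j ∈ Finset.range (r + 1),
        casimir 0 κ κ' r (descProd (fun i => hA 0 κ i * hB 0 κ' i) j (r - j)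
          (Finsupp.single p 1)) := by
      rw [casimir, symSum, Module.End.mul_apply, LinearMap.sum_apply, map_sum]
      rfl
    rw [e, Finsupp.finsetSum_apply, Finset.sum_range_succ, Finset.sum_eq_zero, zero_add,
      Nat.sub_self]
    · exact ih fun i j h1 h2 => hp i j h1 (by omega)
    · intro j hj
      rw [Finset.mem_range] at hj
      obtain ⟨ε, π, h1, h2, h3⟩ := descProd_single κ κ' j (r - j) p
      rw [h3, map_smul, Finsupp.smul_apply]
      by_contra hne
      obtain ⟨ρ, h4, h5⟩ := casimir_one_support κ κ' r _ _ (right_ne_zero_of_smul hne)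
      have h6 : π (ρ r) = j := by
        rw [h4 r le_rfl, ← h1]; congr 1; omega
      refine hp j r hj (by omega) ⟨?_, ?_, ?_⟩
      · have := congrFun (congrArg (fun p : LabelSeq => p.1.1) h5) r
        simpa [LabelSeq.perm, h6] using this.symm
      · have := congrFun (congrArg (fun p : LabelSeq => p.1.2) h5) r
        simpa [LabelSeq.perm, h6] using this.symm
      · have := congrFun (congrArg (fun p : LabelSeq => p.2) h5) r
        simpa [LabelSeq.perm, h6] using this.symm

end Casimir

/-! ### Labels -/

section Labels

variable {n ℓ : ℕ}

theorem cPart_mem (hn : 0 < n) (k : ℤ) : 1 ≤ cPart n k ∧ cPart n k ≤ n := by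
  have h1 : (0 : ℤ) < n := by exact_mod_cast hn
  have h2 := Int.emod_nonneg (k - 1) h1.ne'
  have h3 := Int.emod_lt_of_pos (k - 1) h1
  unfold cPart
  omega

theorem dPart_mem (hℓ : 0 < ℓ) (k : ℤ) : 1 ≤ dPart n ℓ k ∧ dPart n ℓ k ≤ ℓ := by
  have h1 : (0 : ℤ) < ℓ := by exact_mod_cast hℓ
  have h2 := Int.emod_nonneg ((k - 1) / n) h1.ne'
  have h3 := Int.emod_lt_of_pos ((k - 1) / n) h1
  unfold dPart
  omega

/-- The labels are determined by the integer: uniqueness in `k = c + n (d - 1) - n ℓ m`. -/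
theorem parts_eq {k c d m : ℤ} (hc1 : 1 ≤ c) (hc2 : c ≤ n) (hd1 : 1 ≤ d) (hd2 : d ≤ ℓ)
    (hk : k = c + n * (d - 1) - n * ℓ * m) :
    cPart n k = c ∧ dPart n ℓ k = d ∧ mPart n ℓ k = m := by
  have hn : (0 : ℤ) < n := by omega
  have hl : (0 : ℤ) < ℓ := by omega
  have e1 : k - 1 = (c - 1) + n * ((d - 1) + ℓ * (-m)) := by rw [hk]; ring
  have e2 : (k - 1) % n = c - 1 := by
    rw [e1, Int.add_mul_emod_self_left, Int.emod_eq_of_lt (by omega) (by omega)]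
  have e3 : (k - 1) / n = (d - 1) + ℓ * (-m) := by
    rw [e1, Int.add_mul_ediv_left _ _ hn.ne', Int.ediv_eq_zero_of_lt (by omega) (by omega),
      zero_add]
  refine ⟨by unfold cPart; omega, ?_, ?_⟩
  · unfold dPart
    rw [e3, Int.add_mul_emod_self_left, Int.emod_eq_of_lt (by omega) (by omega)]
    omega
  · unfold mPart
    rw [e3, Int.add_mul_ediv_left _ _ hl.ne', Int.ediv_eq_zero_of_lt (by omega) (by omega)]
    omega

/-- The order of the integers in terms of their labels. -/
theorem lt_iff_parts (hn : 0 < n) (hℓ : 0 < ℓ) (k k' : ℤ) : k < k' ↔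
    mPart n ℓ k' < mPart n ℓ k ∨ (mPart n ℓ k' = mPart n ℓ k ∧ (dPart n ℓ k < dPart n ℓ k' ∨
      (dPart n ℓ k = dPart n ℓ k' ∧ cPart n k < cPart n k'))) := by
  have key : ∀ k k' : ℤ, mPart n ℓ k' < mPart n ℓ k ∨ (mPart n ℓ k' = mPart n ℓ k ∧
      (dPart n ℓ k < dPart n ℓ k' ∨ (dPart n ℓ k = dPart n ℓ k' ∧ cPart n k < cPart n k'))) →
      k < k' := by
    intro k k' h
    obtain ⟨c1, c2⟩ := cPart_mem hn k
    obtain ⟨c1', c2'⟩ := cPart_mem hn k'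
    obtain ⟨d1, d2⟩ := dPart_mem (n := n) hℓ k
    obtain ⟨d1', d2'⟩ := dPart_mem (n := n) hℓ k'
    have e := cdm_eq n ℓ k
    have e' := cdm_eq n ℓ k'
    generalize cPart n k = c at *
    generalize cPart n k' = c' at *
    generalize dPart n ℓ k = d at *
    generalize dPart n ℓ k' = d' at *
    generalize mPart n ℓ k = m at *
    generalize mPart n ℓ k' = m' at *
    have hn0 : (0 : ℤ) < n := by omega
    rcases h with h | ⟨h0, h | ⟨h, h'⟩⟩
    · have : (n : ℤ) * ℓ * (m - m' - 1) ≥ 0 := by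
        have : (0 : ℤ) ≤ n * ℓ := by positivity
        exact mul_nonneg this (by omega)
      have h2 : (n : ℤ) * (d' - 1) ≥ 0 := mul_nonneg hn0.le (by omega)
      have h3 : (n : ℤ) * (ℓ - d) ≥ 0 := mul_nonneg hn0.le (by omega)
      nlinarith
    · have h3 : (n : ℤ) * (d' - d - 1) ≥ 0 := mul_nonneg hn0.le (by omega)
      rw [h0] at e'
      linarith
    · rw [h0, ← h] at e'
      linarith
  refine ⟨fun h => ?_, key k k'⟩
  by_contra hc
  by_cases heq : cPart n k = cPart n k' ∧ dPart n ℓ k = dPart n ℓ k' ∧ mPart n ℓ k = mPart n ℓ k'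
  · have e := cdm_eq n ℓ k
    have e' := cdm_eq n ℓ k'
    rw [heq.1, heq.2.1, heq.2.2] at e
    omega
  · have := key k' k (by omega)
    omega

theorem cPart_correction (k c' : ℤ) (hℓ : 0 < ℓ) (hc1 : 1 ≤ c') (hc2 : c' ≤ n)
    (j : ℤ) : cPart n (k - cPart n k + c' - n * ℓ * j) = c' ∧
      dPart n ℓ (k - cPart n k + c' - n * ℓ * j) = dPart n ℓ k ∧
      mPart n ℓ (k - cPart n k + c' - n * ℓ * j) = mPart n ℓ k + j := by
  obtain ⟨d1, d2⟩ := dPart_mem (n := n) hℓ k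
  refine parts_eq hc1 hc2 d1 d2 ?_
  have e := cdm_eq n ℓ k
  linear_combination e

end Labels

/-! ### The straightening relations in terms of the Hecke actions -/

section Relators

variable {n ℓ : ℕ}

/-- The labels of the entries of a sequence of integers. -/
def labels (n ℓ : ℕ) (k : ℕ → ℤ) : LabelSeq :=
  ((fun i => cPart n (k i), fun i => mPart n ℓ (k i)), fun i => dPart n ℓ (k i))

theorem labels_injective (n ℓ : ℕ) : Function.Injective (labels n ℓ) := by
  intro k k' h
  ext i
  simp only [labels, Prod.mk.injEq] at h
  rw [cdm_eq n ℓ (k i), cdm_eq n ℓ (k' i), congrFun h.1.1 i, congrFun h.1.2 i, congrFun h.2 i]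

/-- The map on the free modules that replaces a sequence of integers by its labels. -/
def labelMap (n ℓ : ℕ) (s : ℤ) : (P s →₀ Kq) →ₗ[Kq] (LabelSeq →₀ Kq) :=
  Finsupp.lmapDomain Kq Kq fun k => labels n ℓ k.1

theorem labelMap_single {s : ℤ} (k : P s) :
    labelMap n ℓ s (Finsupp.single k 1) = Finsupp.single (labels n ℓ k.1) 1 := by
  simp [labelMap, Finsupp.mapDomain_single]

theorem labels_upd (k : ℕ → ℤ) (i : ℕ) (a b : ℤ) : labels n ℓ (upd k i a b) =
    ((upd (labels n ℓ k).1.1 i (cPart n a) (cPart n b),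
      upd (labels n ℓ k).1.2 i (mPart n ℓ a) (mPart n ℓ b)),
      upd (labels n ℓ k).2 i (dPart n ℓ a) (dPart n ℓ b)) := by
  simp only [labels, Prod.mk.injEq]
  refine ⟨⟨?_, ?_⟩, ?_⟩ <;> ext j <;> simp only [upd_apply] <;> split_ifs <;> rfl

theorem q_ne_zero : q ≠ 0 := RatFunc.X_ne_zero

theorem q_sq_add_one_ne_zero : q * q + 1 ≠ 0 := by
  have h : (algebraMap (Polynomial ℚ) Kq) (Polynomial.X * Polynomial.X + 1) = q * q + 1 := by
    simp [q, RatFunc.algebraMap_X]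
  rw [← h, Ne, map_eq_zero_iff _ (RatFunc.algebraMap_injective ℚ)]
  intro h0
  have := congrArg (Polynomial.eval 0) h0
  simp at this

/-- The action on the labels `c`, `m`, for the parameters of the straightening rule. -/
abbrev opA (i : ℕ) : Module.End Kq (LabelSeq →₀ Kq) := hA (q - q⁻¹) q⁻¹ i

/-- The action on the labels `d`, for the parameters of the straightening rule. -/
abbrev opB (i : ℕ) : Module.End Kq (LabelSeq →₀ Kq) := hB (q - q⁻¹) (-q) i

theorem param_A : q⁻¹ * q⁻¹ = 1 - (q - q⁻¹) * q⁻¹ := by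
  have := q_ne_zero
  field_simp
  ring

theorem param_B : -q * -q = 1 - (q - q⁻¹) * -q := by
  have := q_ne_zero
  field_simp
  ring

theorem sum_Icc_correction {M : Type*} [AddCommGroup M] (f : ℤ → M) {m₁ m₂ : ℤ} {p r : Prop}
    [Decidable p] [Decidable r] (h : m₁ < m₂ ∨ (m₁ = m₂ ∧ (¬ r ∨ ¬ p))) :
    ∑ j ∈ Finset.Icc (if p then 1 else 0 : ℤ) (m₂ - m₁ - (if r then 1 else 0)), f (m₁ + j) =
      ∑ t ∈ Finset.Ico m₁ m₂, f t - (if p then f m₁ else 0) + (if r then 0 else f m₂) := by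
  have e : ∀ a b : ℤ, ∑ j ∈ Finset.Icc a b, f (m₁ + j) =
      ∑ t ∈ Finset.Icc (m₁ + a) (m₁ + b), f t := by
    intro a b
    refine Finset.sum_nbij' (fun t => m₁ + t) (fun t => t - m₁) ?_ ?_ ?_ ?_ ?_ <;>
      (simp only [Finset.mem_Icc]; intros; first | omega | trivial)
  rw [e]
  rcases h with h | ⟨rfl, h⟩
  · have e1 : ∀ a, m₁ + (m₂ - m₁ - a) = m₂ - a := fun a => by ring
    rw [e1]
    split_ifs
    · rw [show m₂ - 1 = m₂ + -1 by ring, ← Finset.Ico_add_one_right_eq_Icc, neg_add_cancel_right,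
        ← Finset.insert_Ico_add_one_left_eq_Ico h, Finset.sum_insert (by simp)]
      abel
    · rw [sub_zero, ← Finset.insert_Ico_add_one_left_eq_Ico h, Finset.sum_insert (by simp),
        ← Finset.Ico_insert_right (by omega : m₁ + 1 ≤ m₂), Finset.sum_insert (by simp)]
      abel
    · rw [show m₂ - 1 = m₂ + -1 by ring, ← Finset.Ico_add_one_right_eq_Icc, neg_add_cancel_right]
      simp
    · rw [sub_zero, ← Finset.Ico_insert_right (by omega : m₁ + 0 ≤ m₂), add_zero,
        Finset.sum_insert (by simp)]
      abel
  · by_cases hp : p <;> by_cases hr : r <;> simp [hp, hr] <;> simp_all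

theorem mapDomain_neg' {R α β : Type*} [CommRing R] (f : α → β) (y : α →₀ R) :
    Finsupp.mapDomain f (-y) = -Finsupp.mapDomain f y :=
  map_neg (Finsupp.lmapDomain R R f) y

theorem hA_single {R : Type*} [CommRing R] (h κ : R) (i : ℕ) (c m d : ℕ → ℤ)
    (hm : m (i + 1) ≤ m i) : hA h κ i (Finsupp.single ((c, m), d) 1) =
      (if c i = c (i + 1) then
        κ • Finsupp.single ((c, upd m i (m (i + 1)) (m i)), d) 1
      else if c i < c (i + 1) then
        Finsupp.single ((upd c i (c (i + 1)) (c i), upd m i (m (i + 1)) (m i)), d) 1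
      else Finsupp.single ((upd c i (c (i + 1)) (c i), upd m i (m (i + 1)) (m i)), d) 1 -
        h • Finsupp.single ((c, upd m i (m (i + 1)) (m i)), d) 1) +
      h • ∑ t ∈ Finset.Ico (m (i + 1)) (m i),
        Finsupp.single ((c, upd m i t (m (i + 1) + m i - t)), d) 1 := by
  rw [hA, onLeft_single, affHecke, LinearMap.add_apply, Module.End.mul_apply, Module.End.mul_apply,
    onRight_single, onRight_single, atPlace_single, atPlace_single, swapPair_single,
    demazurePair_single, Finset.Ico_eq_empty_of_le hm, Finsupp.mapDomain_single,
    Finsupp.mapDomain_single, onLeft_single, atPlace_heckePair_single,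
    Module.algebraMap_end_apply, Finset.sum_empty, sub_zero, Finsupp.mapDomain_add,
    Finsupp.mapDomain_smul]
  congr 1
  · split_ifs <;> simp only [sub_eq_add_neg, Finsupp.mapDomain_smul, Finsupp.mapDomain_single,
      Finsupp.mapDomain_add, mapDomain_neg']
  · congr 1
    rw [Finsupp.mapDomain_finsetSum, Finsupp.mapDomain_finsetSum, Finsupp.mapDomain_finsetSum]
    refine Finset.sum_congr rfl fun t _ => ?_
    simp only [Finsupp.mapDomain_single, add_comm (m i)]

theorem hB_single {R : Type*} [CommRing R] (h κ : R) (i : ℕ) (c m d : ℕ → ℤ) :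
    hB h κ i (Finsupp.single ((c, m), d) 1) =
      if d i = d (i + 1) then κ • Finsupp.single ((c, m), d) 1
      else if d i < d (i + 1) then Finsupp.single ((c, m), upd d i (d (i + 1)) (d i)) 1
      else Finsupp.single ((c, m), upd d i (d (i + 1)) (d i)) 1 -
        h • Finsupp.single ((c, m), d) 1 := by
  rw [hB, onRight_single, atPlace_heckePair_single]
  split_ifs <;> simp only [sub_eq_add_neg, Finsupp.mapDomain_smul, Finsupp.mapDomain_single,
      Finsupp.mapDomain_add, mapDomain_neg']

theorem P.replace_val {s : ℤ} (k : P s) (i : ℕ) (a b : ℤ) :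
    (k.replace i a b).1 = upd k.1 i a b := rfl

/-- The identity behind `labelMap_relator`, with the vectors that occur replaced by variables. -/
theorem relator_identity {K M : Type*} [Field K] [AddCommGroup M] [Module K M] {q : K}
    (hq : q ≠ 0) {c₁ c₂ d₁ d₂ : ℤ}
    {p p' S S' X : M} (hd : d₁ = d₂ → p' = p) (hc : c₁ = c₂ → S' = S) :
    p - (if d₁ = d₂ then -q⁻¹ else 1 : K) • ((if c₁ = c₂ then q else 1 : K) • S' +
        (q - q⁻¹) • ((X - if c₁ ≤ c₂ then S else 0) + if d₁ ≤ d₂ then 0 else p')) =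
      (if d₁ = d₂ then -q⁻¹ else 1 : K) •
        ((if d₁ = d₂ then -q • p' else if d₁ < d₂ then p else p - (q - q⁻¹) • p') -
          ((if c₂ = c₁ then q⁻¹ • S else if c₂ < c₁ then S' else S' - (q - q⁻¹) • S) +
            (q - q⁻¹) • X)) := by
  obtain ⟨h, hh⟩ : ∃ h, h = q - q⁻¹ := ⟨_, rfl⟩
  rw [← hh]
  by_cases h1 : d₁ = d₂ <;> by_cases h2 : c₁ = c₂
  · rw [hd h1, hc h2]
    simp only [h1, h2, if_true, le_refl, smul_sub, smul_add, smul_smul, add_zero]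
    match_scalars <;> (try rw [hh]) <;> field_simp <;> ring
  · rw [hd h1]
    simp only [h1, if_true, le_refl, if_neg h2, if_neg (Ne.symm h2), smul_sub, smul_add, smul_smul, add_zero]
    rcases lt_or_gt_of_ne h2 with h3 | h3
    · simp only [if_pos h3.le, if_neg h3.not_gt, smul_sub, smul_smul]
      match_scalars <;> (try rw [hh]) <;> field_simp
    · simp only [if_neg h3.not_ge, if_pos h3]
      match_scalars <;> (try rw [hh]) <;> field_simp
  · rw [hc h2]
    simp only [h2, if_true, le_refl, if_neg h1]
    rcases lt_or_gt_of_ne h1 with h3 | h3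
    · simp only [if_pos h3.le, if_pos h3]
      match_scalars <;> (try rw [hh]) <;> field_simp <;> ring
    · simp only [if_neg h3.not_ge, if_neg h3.not_gt]
      match_scalars <;> (try rw [hh]) <;> field_simp <;> ring
  · simp only [if_neg h1, if_neg h2, if_neg (Ne.symm h2)]
    rcases lt_or_gt_of_ne h1 with h3 | h3 <;> rcases lt_or_gt_of_ne h2 with h4 | h4 <;>
    simp only [if_pos h3.le, if_pos h3, if_neg h3.not_ge, if_neg h3.not_gt, if_pos h4.le,
      if_pos h4, if_neg h4.not_ge, if_neg h4.not_gt] <;>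
    module

/-- A straightening relation is, in terms of the labels, of the form `(b_i - a_i) w`. -/
theorem labelMap_relator (hn : 0 < n) (hℓ : 0 < ℓ) {s : ℤ} (k : P s) (i : ℕ)
    (hk : k.1 i ≤ k.1 (i + 1)) : ∃ (r : Kq) (p : LabelSeq),
      labelMap n ℓ s (Finsupp.single k 1 - straighten n ℓ k i) =
        (opB i - opA i) (r • Finsupp.single p 1) := by
  have hq := q_ne_zero
  obtain ⟨c1, c1'⟩ := cPart_mem hn (k.1 (i + 1))
  obtain ⟨c2, c2'⟩ := cPart_mem hn (k.1 i)
  rcases hk.eq_or_lt with hk | hk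
  · have e1 : straighten n ℓ k i = -Finsupp.single k 1 := by
      have e2 : k.replace i (k.1 (i + 1)) (k.1 i) = k := by
        refine Subtype.ext ?_
        rw [P.replace_val, ← hk]
        conv_rhs => rw [← upd_self k.1 i, ← hk]
      simp only [straighten, e2]
      simp [hk, hq]
    refine ⟨-2 * q * (q * q + 1)⁻¹, labels n ℓ k.1, ?_⟩
    have hm : (labels n ℓ k.1).1.2 (i + 1) = (labels n ℓ k.1).1.2 i := by simp [labels, hk]
    have hc : (labels n ℓ k.1).1.1 (i + 1) = (labels n ℓ k.1).1.1 i := by simp [labels, hk]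
    have hd : (labels n ℓ k.1).2 (i + 1) = (labels n ℓ k.1).2 i := by simp [labels, hk]
    have hm' : upd (labels n ℓ k.1).1.2 i ((labels n ℓ k.1).1.2 i) ((labels n ℓ k.1).1.2 i) =
        (labels n ℓ k.1).1.2 := by
      conv_rhs => rw [← upd_self (labels n ℓ k.1).1.2 i, hm]
    rw [e1, sub_neg_eq_add, map_add, labelMap_single, map_smul, LinearMap.sub_apply,
      hA_single _ _ _ _ _ _ hm.le, hB_single, if_pos hd.symm, if_pos hc.symm, hm, hm',
      Finset.Ico_self, Finset.sum_empty, smul_zero, add_zero, ← sub_smul, smul_smul, ← two_smul Kq]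
    congr 1
    have := q_sq_add_one_ne_zero
    have hx : (q * q + 1) * (q * q + 1)⁻¹ = 1 := mul_inv_cancel₀ this
    field_simp
    linear_combination -hx
  · refine ⟨if dPart n ℓ (k.1 (i + 1)) = dPart n ℓ (k.1 i) then -q⁻¹ else 1,
      ((labels n ℓ k.1).1, upd (labels n ℓ k.1).2 i (dPart n ℓ (k.1 (i + 1))) (dPart n ℓ (k.1 i))),
      ?_⟩
    have hlt := (lt_iff_parts hn hℓ _ _).1 hk
    have hm : (labels n ℓ k.1).1.2 (i + 1) ≤ (labels n ℓ k.1).1.2 i := by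
      simp only [labels]; omega
    obtain ⟨f, hf⟩ : ∃ f : ℤ → (LabelSeq →₀ Kq), f = fun t => Finsupp.single (((labels n ℓ k.1).1.1,
        upd (labels n ℓ k.1).1.2 i t ((labels n ℓ k.1).1.2 (i + 1) + (labels n ℓ k.1).1.2 i - t)),
        upd (labels n ℓ k.1).2 i (dPart n ℓ (k.1 (i + 1))) (dPart n ℓ (k.1 i))) 1 := ⟨_, rfl⟩
    have hterm : ∀ j : ℤ, labelMap n ℓ s (Finsupp.single (k.replace i
        (k.1 (i + 1) - cPart n (k.1 (i + 1)) + cPart n (k.1 i) - n * ℓ * j)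
        (k.1 i + cPart n (k.1 (i + 1)) - cPart n (k.1 i) + n * ℓ * j)) 1) =
        f (mPart n ℓ (k.1 (i + 1)) + j) := by
      intro j
      obtain ⟨a1, a2, a3⟩ := cPart_correction (k.1 (i + 1)) (cPart n (k.1 i)) hℓ c2 c2' j
      obtain ⟨b1, b2, b3⟩ := cPart_correction (k.1 i) (cPart n (k.1 (i + 1))) hℓ c1 c1' (-j)
      rw [show k.1 i - cPart n (k.1 i) + cPart n (k.1 (i + 1)) - n * ℓ * -j =
        k.1 i + cPart n (k.1 (i + 1)) - cPart n (k.1 i) + n * ℓ * j by ring] at b1 b2 b3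
      rw [labelMap_single, P.replace_val, labels_upd, a1, a2, a3, b1, b2, b3, hf]
      have : upd (labels n ℓ k.1).1.1 i (cPart n (k.1 i)) (cPart n (k.1 (i + 1))) =
        (labels n ℓ k.1).1.1 := upd_self (labels n ℓ k.1).1.1 i
      rw [this]
      simp only [labels]
      congr 4
      ring
    have hf1 : f (mPart n ℓ (k.1 (i + 1))) = Finsupp.single (((labels n ℓ k.1).1.1,
        upd (labels n ℓ k.1).1.2 i (mPart n ℓ (k.1 (i + 1))) (mPart n ℓ (k.1 i))),
        upd (labels n ℓ k.1).2 i (dPart n ℓ (k.1 (i + 1))) (dPart n ℓ (k.1 i))) 1 := by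
      rw [hf]; simp only [labels, add_sub_cancel_left]
    have hf2 : f (mPart n ℓ (k.1 i)) = Finsupp.single ((labels n ℓ k.1).1,
        upd (labels n ℓ k.1).2 i (dPart n ℓ (k.1 (i + 1))) (dPart n ℓ (k.1 i))) 1 := by
      rw [hf]
      have : upd (labels n ℓ k.1).1.2 i (mPart n ℓ (k.1 i)) (mPart n ℓ (k.1 (i + 1))) =
        (labels n ℓ k.1).1.2 := upd_self (labels n ℓ k.1).1.2 i
      simp only [labels, add_sub_cancel_right] at this ⊢
      rw [this]
    have hsum : ∑ t ∈ Finset.Ico ((labels n ℓ k.1).1.2 (i + 1)) ((labels n ℓ k.1).1.2 i),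
        Finsupp.single (((labels n ℓ k.1).1.1, upd (labels n ℓ k.1).1.2 i t
          ((labels n ℓ k.1).1.2 (i + 1) + (labels n ℓ k.1).1.2 i - t)),
          upd (labels n ℓ k.1).2 i (dPart n ℓ (k.1 (i + 1))) (dPart n ℓ (k.1 i))) (1 : Kq) =
        ∑ t ∈ Finset.Ico (mPart n ℓ (k.1 (i + 1))) (mPart n ℓ (k.1 i)), f t := by
      rw [hf]; rfl
    simp only [straighten, map_sub, map_smul, map_add, map_sum, hterm, LinearMap.sub_apply]
    rw [sum_Icc_correction f (by omega), hA_single _ _ _ _ _ _ hm, hB_single, hsum]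
    rw [labelMap_single, labelMap_single, P.replace_val, labels_upd]
    simp only [upd_left, upd_right, upd_upd]
    have hdself : upd (labels n ℓ k.1).2 i (dPart n ℓ (k.1 i)) (dPart n ℓ (k.1 (i + 1))) =
      (labels n ℓ k.1).2 := upd_self (labels n ℓ k.1).2 i
    rw [hdself, hf1, hf2]
    refine relator_identity hq (fun h => ?_) (fun h => ?_)
    · have := upd_self (labels n ℓ k.1).2 i
      rw [show (labels n ℓ k.1).2 i = dPart n ℓ (k.1 i) from rfl,
        show (labels n ℓ k.1).2 (i + 1) = dPart n ℓ (k.1 (i + 1)) from rfl, ← h] at this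
      rw [← h, this]
    · have := upd_self (labels n ℓ k.1).1.1 i
      rw [show (labels n ℓ k.1).1.1 i = cPart n (k.1 i) from rfl,
        show (labels n ℓ k.1).1.1 (i + 1) = cPart n (k.1 (i + 1)) from rfl, ← h] at this
      rw [← h, this]

end Relators

/-! ### Linear independence of the ordered wedges -/

section Independence

/-- The inclusion of the Laurent polynomials in `ℚ(q)`. -/
def laurentToKq : LaurentPolynomial ℚ →+* Kq :=
  LaurentPolynomial.eval₂ (algebraMap ℚ Kq) (Units.mk0 q q_ne_zero)

/-- The evaluation of Laurent polynomials at `1`. -/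
def laurentToRat : LaurentPolynomial ℚ →+* ℚ := LaurentPolynomial.eval₂ (RingHom.id ℚ) 1

theorem laurentToKq_injective : Function.Injective laurentToKq := by
  rw [injective_iff_map_eq_zero]
  intro f hf
  obtain ⟨n, p, hp⟩ := LaurentPolynomial.exists_T_pow f
  have h1 : laurentToKq (Polynomial.toLaurent p) = 0 := by rw [hp, map_mul, hf, zero_mul]
  rw [laurentToKq, LaurentPolynomial.eval₂_toLaurent] at h1
  have h2 : p = 0 := by
    have ht : Transcendental ℚ q := fun hq => RatFunc.transcendental_X (K := ℚ) (by
      convert! hq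
      exact Subsingleton.elim _ _)
    exact (transcendental_iff.1 ht) p h1
  rw [h2, map_zero] at hp
  exact (mul_eq_zero.1 hp.symm).resolve_right (LaurentPolynomial.isUnit_T n).ne_zero

theorem exists_casimir_eq_zero {z : LabelSeq →₀ Kq}
    (hz : z ∈ ⨆ i, LinearMap.range (opB i - opA i)) :
    ∃ r, casimir (q - q⁻¹) q⁻¹ (-q) r z = 0 := by
  suffices h : ∃ r₀, ∀ r, r₀ ≤ r → casimir (q - q⁻¹) q⁻¹ (-q) r z = 0 from
    h.imp fun r₀ h => h r₀ le_rfl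
  induction hz using Submodule.iSup_induction' with
  | mem i z hz =>
    obtain ⟨y, rfl⟩ := hz
    refine ⟨i + 2, fun r hr => ?_⟩
    have := LinearMap.congr_fun (casimir_mul param_A param_B (show i + 1 < r by omega)) y
    rw [Module.End.mul_apply, Module.End.mul_apply] at this
    rw [LinearMap.sub_apply, map_sub, this, sub_self]
  | zero => exact ⟨0, fun r _ => map_zero _⟩
  | add x y _ _ hx hy =>
    obtain ⟨r₁, h₁⟩ := hx
    obtain ⟨r₂, h₂⟩ := hy
    exact ⟨max r₁ r₂, fun r hr => by
      rw [map_add, h₁ r (le_of_max_le_left hr), h₂ r (le_of_max_le_right hr), add_zero]⟩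

theorem strictAnti_eq_of_comp_perm {k k' : ℕ → ℤ} (hk : StrictAnti k) (hk' : StrictAnti k')
    (π : Equiv.Perm ℕ) (h : k' = k ∘ π) : k' = k := by
  have h1 : StrictMono (fun i => -k i) := fun i j hij => neg_lt_neg (hk hij)
  have h2 : StrictMono (fun i => -k' i) := fun i j hij => neg_lt_neg (hk' hij)
  have h3 : (fun i => -k' i) = fun i => -k i := by
    rw [← StrictMono.range_inj h2 h1, h]
    exact (π.surjective.range_comp fun i => -k i)
  ext i
  exact neg_injective (congrFun h3 i)

/-- A combination of strictly decreasing sequences that lies in the span of the straightening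
relations vanishes: it is killed by the intertwiner, whose matrix with respect to these sequences
becomes the identity at `q = 1`, and so is invertible over `ℚ(q)`. -/
theorem eq_zero_of_labelMap_mem {n ℓ : ℕ} {s : ℤ} {x : P s →₀ Kq}
    (hx : ∀ k ∈ x.support, StrictAnti k.1)
    (hz : labelMap n ℓ s x ∈ ⨆ i, LinearMap.range (opB i - opA i)) : x = 0 := by
  classical
  obtain ⟨r, hr⟩ := exists_casimir_eq_zero hz
  let h : LaurentPolynomial ℚ := LaurentPolynomial.T 1 - LaurentPolynomial.T (-1)
  let C := casimir h (LaurentPolynomial.T (-1)) (-LaurentPolynomial.T 1) r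
  let Q : Matrix x.support x.support (LaurentPolynomial ℚ) := Matrix.of fun k k' =>
    C (Finsupp.single (labels n ℓ k.1.1) 1) (labels n ℓ k'.1.1)
  have hT : laurentToKq (LaurentPolynomial.T 1) = q := by
    simp [laurentToKq, LaurentPolynomial.eval₂_T]
  have hT' : laurentToKq (LaurentPolynomial.T (-1)) = q⁻¹ := by
    simp [laurentToKq, LaurentPolynomial.eval₂_T]
  have hT1 : laurentToRat (LaurentPolynomial.T 1) = 1 := by
    simp [laurentToRat, LaurentPolynomial.eval₂_T]
  have hT1' : laurentToRat (LaurentPolynomial.T (-1)) = 1 := by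
    simp [laurentToRat, LaurentPolynomial.eval₂_T]
  have hdet1 : laurentToRat Q.det = 1 := by
    rw [RingHom.map_det]
    have : laurentToRat.mapMatrix Q = 1 := by
      ext k k'
      have e := DFunLike.congr_fun (isScalarExtension_casimir (φ := laurentToRat) h
        (LaurentPolynomial.T (-1)) (-LaurentPolynomial.T 1) r
        (Finsupp.single (labels n ℓ k.1.1) 1)) (labels n ℓ k'.1.1)
      rw [mapCoeff_apply, mapCoeff_single, map_one] at e
      rw [RingHom.mapMatrix_apply, Matrix.map_apply]
      refine e.trans ?_
      rw [show laurentToRat h = 0 by simp [h, hT1, hT1']]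
      by_cases hkk : k = k'
      · subst hkk
        rw [Matrix.one_apply_eq]
        refine casimir_one_diag _ _ r _ fun i j hij _ hc => ?_
        have h2 := (hx k.1 k.2) hij
        have h3 : k.1.1 i = k.1.1 j := by
          rw [cdm_eq n ℓ (k.1.1 i), cdm_eq n ℓ (k.1.1 j)]
          simp only [labels] at hc
          rw [hc.1, hc.2.1, hc.2.2]
        omega
      · rw [Matrix.one_apply_ne hkk]
        by_contra hne
        obtain ⟨π, -, hπ⟩ := casimir_one_support _ _ r _ _ hne
        have h4 : labels n ℓ k'.1.1 = labels n ℓ (k.1.1 ∘ π) := hπ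
        exact hkk (Subtype.ext (Subtype.ext (strictAnti_eq_of_comp_perm (hx k.1 k.2)
          (hx k'.1 k'.2) π (labels_injective n ℓ h4)))).symm
    rw [this, Matrix.det_one]
  have hdet : (laurentToKq.mapMatrix Q).det ≠ 0 := by
    rw [← RingHom.map_det, Ne, map_eq_zero_iff _ laurentToKq_injective]
    intro h0
    rw [h0, map_zero] at hdet1
    exact zero_ne_one hdet1
  have hv : Matrix.vecMul (fun k : x.support => x k.1) (laurentToKq.mapMatrix Q) = 0 := by
    ext k'
    have e2 := DFunLike.congr_fun hr (labels n ℓ k'.1.1)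
    have e3 : labelMap n ℓ s x = ∑ k ∈ x.support, x k • Finsupp.single (labels n ℓ k.1) 1 := by
      conv_lhs => rw [← Finsupp.sum_single x, Finsupp.sum, map_sum]
      refine Finset.sum_congr rfl fun k _ => ?_
      rw [single_eq_smul, map_smul, labelMap_single]
    rw [e3, map_sum, Finsupp.finsetSum_apply, ← Finset.sum_coe_sort] at e2
    rw [Matrix.vecMul, dotProduct]
    refine Eq.trans (Finset.sum_congr rfl fun k _ => ?_) e2
    have e := DFunLike.congr_fun (isScalarExtension_casimir (φ := laurentToKq) h
        (LaurentPolynomial.T (-1)) (-LaurentPolynomial.T 1) r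
        (Finsupp.single (labels n ℓ k.1.1) 1)) (labels n ℓ k'.1.1)
    rw [mapCoeff_apply, mapCoeff_single, map_one, hT', map_neg, hT,
      show laurentToKq h = q - q⁻¹ by simp [h, hT, hT']] at e
    rw [map_smul, Finsupp.smul_apply, smul_eq_mul, ← e]
    rfl
  have h0 := Matrix.eq_zero_of_vecMul_eq_zero hdet hv
  ext k
  by_cases hk : k ∈ x.support
  · exact congrFun h0 ⟨k, hk⟩
  · simpa using hk

theorem labelMap_mem_of_mem_relations {n ℓ : ℕ} (hn : 0 < n) (hℓ : 0 < ℓ) {s : ℤ} {x : P s →₀ Kq}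
    (hx : x ∈ relations n ℓ s) :
    labelMap n ℓ s x ∈ ⨆ i, LinearMap.range (opB i - opA i) := by
  induction hx using Submodule.span_induction with
  | mem x hx =>
    obtain ⟨k, i, hk, rfl⟩ := hx
    obtain ⟨r, p, h⟩ := labelMap_relator hn hℓ k i hk
    rw [h]
    exact Submodule.mem_iSup_of_mem i ⟨_, rfl⟩
  | zero => rw [map_zero]; exact zero_mem _
  | add x y _ _ hx hy => rw [map_add]; exact add_mem hx hy
  | smul a x _ hx => rw [map_smul]; exact Submodule.smul_mem _ _ hx

/-- The wedges of the strictly decreasing sequences are linearly independent. -/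
theorem linearIndependent_wedge {n ℓ : ℕ} (hn : 0 < n) (hℓ : 0 < ℓ) (s : ℤ) :
    LinearIndependent Kq fun k : {k : P s // StrictAnti k.1} => wedge n ℓ k.1 := by
  rw [linearIndependent_iff]
  intro x hx
  have hinj : Function.Injective (Subtype.val : {k : P s // StrictAnti k.1} → P s) :=
    Subtype.val_injective
  have h1 : (relations n ℓ s).mkQ (Finsupp.mapDomain Subtype.val x) = 0 := by
    rw [← hx, Finsupp.linearCombination_apply, Finsupp.mapDomain, Finsupp.sum, Finsupp.sum, map_sum]
    refine Finset.sum_congr rfl fun k _ => ?_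
    rw [single_eq_smul, map_smul]
    rfl
  rw [Submodule.mkQ_apply, Submodule.Quotient.mk_eq_zero] at h1
  have h2 := eq_zero_of_labelMap_mem (x := Finsupp.mapDomain Subtype.val x) (fun k hk => by
    classical
    obtain ⟨k', _, rfl⟩ := Finset.mem_image.1 (Finsupp.mapDomain_support hk)
    exact k'.2) (labelMap_mem_of_mem_relations hn hℓ h1)
  exact Finsupp.mapDomain_injective hinj (h2.trans Finsupp.mapDomain_zero.symm)

open Classical in
/-- The coefficient of an ordered wedge, as a functional on `Λ^s`. -/
theorem exists_coord {n ℓ : ℕ} (hn : 0 < n) (hℓ : 0 < ℓ) {s : ℤ} (k₀ : P s)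
    (h₀ : StrictAnti k₀.1) : ∃ f : Wedge n ℓ s →ₗ[Kq] Kq,
      ∀ k : P s, StrictAnti k.1 → f (wedge n ℓ k) = if k = k₀ then 1 else 0 := by
  have hli := linearIndependent_wedge hn hℓ s
  obtain ⟨f, hf⟩ := LinearMap.exists_extend
    ((Finsupp.lapply ⟨k₀, h₀⟩ : ({k : P s // StrictAnti k.1} →₀ Kq) →ₗ[Kq] Kq) ∘ₗ hli.repr)
  refine ⟨f, fun k hk => ?_⟩
  have h1 : wedge n ℓ k ∈ Submodule.span Kq
      (Set.range fun k : {k : P s // StrictAnti k.1} => wedge n ℓ k.1) :=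
    Submodule.subset_span ⟨⟨k, hk⟩, rfl⟩
  have h2 := LinearMap.congr_fun hf ⟨_, h1⟩
  rw [LinearMap.comp_apply, Submodule.subtype_apply] at h2
  rw [h2, LinearMap.comp_apply, hli.repr_eq_single ⟨k, hk⟩ _ rfl, Finsupp.lapply_apply,
    Finsupp.single_apply]
  simp only [Subtype.mk.injEq]

end Independence

/-! ### The straightening rule for finite lists -/

section Straightening

variable {n ℓ : ℕ}

/-- The range of summation in the straightening rule for `u_{k₂} ∧ u_{k₁}`. -/
def corrRange (n ℓ : ℕ) (k₂ k₁ : ℤ) : Finset ℤ :=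
  Finset.Icc (if cPart n k₁ ≤ cPart n k₂ then 1 else 0)
    (mPart n ℓ k₂ - mPart n ℓ k₁ - if dPart n ℓ k₁ ≤ dPart n ℓ k₂ then 1 else 0)

/-- The index of the left factor of a correction term. -/
def corrFst (n ℓ : ℕ) (k₂ k₁ j : ℤ) : ℤ := k₁ - cPart n k₁ + cPart n k₂ - n * ℓ * j

/-- The index of the right factor of a correction term. -/
def corrSnd (n ℓ : ℕ) (k₂ k₁ j : ℤ) : ℤ := k₂ + cPart n k₁ - cPart n k₂ + n * ℓ * j

/-- The factor `(-q⁻¹)^{[d₁ = d₂]}`. -/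
def dFactor (n ℓ : ℕ) (k₂ k₁ : ℤ) : Kq := if dPart n ℓ k₁ = dPart n ℓ k₂ then -q⁻¹ else 1

/-- The factor `q^{[c₁ = c₂]}`. -/
def cFactor (n : ℕ) (k₂ k₁ : ℤ) : Kq := if cPart n k₁ = cPart n k₂ then q else 1

/-- The position on its abacus of the bead at `k`: the integer `x` with `k = pos n ℓ d x`. -/
def xPart (n ℓ : ℕ) (k : ℤ) : ℤ := cPart n k - n * mPart n ℓ k

theorem corr_add (k₂ k₁ j : ℤ) : corrFst n ℓ k₂ k₁ j + corrSnd n ℓ k₂ k₁ j = k₂ + k₁ := by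
  unfold corrFst corrSnd; ring

theorem corrFst_parts (hn : 0 < n) (hℓ : 0 < ℓ) (k₂ k₁ j : ℤ) :
    cPart n (corrFst n ℓ k₂ k₁ j) = cPart n k₂ ∧
      dPart n ℓ (corrFst n ℓ k₂ k₁ j) = dPart n ℓ k₁ ∧
      mPart n ℓ (corrFst n ℓ k₂ k₁ j) = mPart n ℓ k₁ + j :=
  cPart_correction k₁ _ hℓ (cPart_mem hn k₂).1 (cPart_mem hn k₂).2 j

theorem corrSnd_parts (hn : 0 < n) (hℓ : 0 < ℓ) (k₂ k₁ j : ℤ) :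
    cPart n (corrSnd n ℓ k₂ k₁ j) = cPart n k₁ ∧
      dPart n ℓ (corrSnd n ℓ k₂ k₁ j) = dPart n ℓ k₂ ∧
      mPart n ℓ (corrSnd n ℓ k₂ k₁ j) = mPart n ℓ k₂ - j := by
  have := cPart_correction k₂ (cPart n k₁) hℓ (cPart_mem hn k₁).1 (cPart_mem hn k₁).2 (-j)
  rw [show k₂ - cPart n k₂ + cPart n k₁ - n * ℓ * -j = corrSnd n ℓ k₂ k₁ j by
    unfold corrSnd; ring] at this
  exact this

theorem corr_lt (hn : 0 < n) (hℓ : 0 < ℓ) {k₂ k₁ j : ℤ} (hj : j ∈ corrRange n ℓ k₂ k₁) :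
    k₂ < corrFst n ℓ k₂ k₁ j ∧ corrFst n ℓ k₂ k₁ j < k₁ := by
  obtain ⟨h1, h2, h3⟩ := corrFst_parts hn hℓ k₂ k₁ j
  rw [lt_iff_parts hn hℓ k₂, lt_iff_parts hn hℓ _ k₁, h1, h2, h3]
  rw [corrRange, Finset.mem_Icc] at hj
  split_ifs at hj <;> omega

theorem corr_xPart (hn : 0 < n) (hℓ : 0 < ℓ) {k₂ k₁ j : ℤ} (hj : j ∈ corrRange n ℓ k₂ k₁) :
    xPart n ℓ k₂ ≤ xPart n ℓ (corrFst n ℓ k₂ k₁ j) ∧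
      xPart n ℓ (corrFst n ℓ k₂ k₁ j) < xPart n ℓ k₁ := by
  obtain ⟨h1, h2, h3⟩ := corrFst_parts hn hℓ k₂ k₁ j
  unfold xPart
  rw [h1, h3]
  have h4 := cPart_mem hn k₁
  have h5 := cPart_mem hn k₂
  rw [corrRange, Finset.mem_Icc] at hj
  have hn' : (0 : ℤ) < n := by exact_mod_cast hn
  have e1 : mPart n ℓ k₁ + j ≤ mPart n ℓ k₂ := by split_ifs at hj <;> omega
  refine ⟨by nlinarith, ?_⟩
  by_cases hc : cPart n k₁ ≤ cPart n k₂
  · rw [if_pos hc] at hj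
    nlinarith
  · rw [if_neg hc] at hj
    nlinarith

theorem corr_xPart_add (hn : 0 < n) (hℓ : 0 < ℓ) (k₂ k₁ j : ℤ) :
    xPart n ℓ (corrFst n ℓ k₂ k₁ j) + xPart n ℓ (corrSnd n ℓ k₂ k₁ j) =
      xPart n ℓ k₂ + xPart n ℓ k₁ := by
  obtain ⟨h1, h2, h3⟩ := corrFst_parts hn hℓ k₂ k₁ j
  obtain ⟨h4, h5, h6⟩ := corrSnd_parts hn hℓ k₂ k₁ j
  unfold xPart
  rw [h1, h3, h4, h6]
  ring

theorem corrRange_self (k : ℤ) : corrRange n ℓ k k = ∅ := by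
  simp [corrRange]

/-- A function on lists of integers that satisfies the straightening rule. -/
def IsStraight (n ℓ : ℕ) {M : Type*} [AddCommGroup M] [Module Kq M] (F : List ℤ → M) : Prop :=
  ∀ (pre post : List ℤ) (k₂ k₁ : ℤ), k₂ ≤ k₁ →
    F (pre ++ k₂ :: k₁ :: post) = dFactor n ℓ k₂ k₁ •
      (cFactor n k₂ k₁ • F (pre ++ k₁ :: k₂ :: post) + (q - q⁻¹) •
        ∑ j ∈ corrRange n ℓ k₂ k₁,
          F (pre ++ corrFst n ℓ k₂ k₁ j :: corrSnd n ℓ k₂ k₁ j :: post))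

theorem IsStraight.comp {M M' : Type*} [AddCommGroup M] [Module Kq M] [AddCommGroup M']
    [Module Kq M'] {F : List ℤ → M} (hF : IsStraight n ℓ F) (f : M →ₗ[Kq] M') :
    IsStraight n ℓ fun l => f (F l) := fun pre post k₂ k₁ h => by
  beta_reduce
  rw [hF pre post k₂ k₁ h, map_smul, map_add, map_smul, map_smul, map_sum]

theorem IsStraight.append {M : Type*} [AddCommGroup M] [Module Kq M] {F : List ℤ → M}
    (hF : IsStraight n ℓ F) (pre post : List ℤ) : IsStraight n ℓ fun l => F (pre ++ l ++ post) := by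
  intro pre' post' k₂ k₁ h
  have := hF (pre ++ pre') (post' ++ post) k₂ k₁ h
  simpa using this

/-- The sequence in `P(s)` that begins with the entries of `l` and goes on with `s - i` at the
place `i`. -/
def ofList (s : ℤ) (l : List ℤ) : P s :=
  ⟨fun i => l.getD i (s - i), by
    filter_upwards [eventually_ge_atTop l.length] with i hi
    exact List.getD_eq_default _ _ hi⟩

theorem ofList_apply (s : ℤ) (l : List ℤ) (i : ℕ) : (ofList s l).1 i = l.getD i (s - i) := rfl

theorem ofList_replace (s : ℤ) (pre post : List ℤ) (x y a b : ℤ) :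
    (ofList s (pre ++ x :: y :: post)).replace pre.length a b =
      ofList s (pre ++ a :: b :: post) := by
  refine Subtype.ext (funext fun i => ?_)
  rw [P.replace_val, upd_apply, ofList_apply, ofList_apply]
  rcases lt_trichotomy i pre.length with h | h | h
  · rw [if_neg (by omega), if_neg (by omega), List.getD_append _ _ _ _ h,
      List.getD_append _ _ _ _ h]
  · subst h
    rw [if_pos rfl, List.getD_append_right _ _ _ _ le_rfl, Nat.sub_self, List.getD_cons_zero]
  · obtain ⟨t, rfl⟩ : ∃ t, i = pre.length + (t + 1) := ⟨i - pre.length - 1, by omega⟩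
    rw [if_neg (by omega), List.getD_append_right _ _ _ _ (by omega),
      List.getD_append_right _ _ _ _ (by omega), Nat.add_sub_cancel_left, List.getD_cons_succ,
      List.getD_cons_succ]
    cases t with
    | zero => rw [if_pos rfl, List.getD_cons_zero]
    | succ t => rw [if_neg (by omega), List.getD_cons_succ, List.getD_cons_succ]

theorem isStraight_wedge (n ℓ : ℕ) (s : ℤ) : IsStraight n ℓ fun l => wedge n ℓ (ofList s l) := by
  intro pre post k₂ k₁ h
  have e2 : (ofList s (pre ++ k₂ :: k₁ :: post)).1 pre.length = k₂ := by
    rw [ofList_apply, List.getD_append_right _ _ _ _ le_rfl, Nat.sub_self, List.getD_cons_zero]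
  have e1 : (ofList s (pre ++ k₂ :: k₁ :: post)).1 (pre.length + 1) = k₁ := by
    rw [ofList_apply, List.getD_append_right _ _ _ _ (by omega), Nat.add_sub_cancel_left,
      List.getD_cons_succ, List.getD_cons_zero]
  have h1 : Finsupp.single (ofList s (pre ++ k₂ :: k₁ :: post)) 1 -
      straighten n ℓ (ofList s (pre ++ k₂ :: k₁ :: post)) pre.length ∈ relations n ℓ s :=
    Submodule.subset_span ⟨_, _, by rw [e1, e2]; exact h, rfl⟩
  have h2 := (Submodule.Quotient.eq _).2 h1
  refine (show wedge n ℓ (ofList s (pre ++ k₂ :: k₁ :: post)) = _ from h2).trans ?_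
  rw [← Submodule.mkQ_apply]
  simp only [straighten, e1, e2, ofList_replace, map_smul, map_add, map_sum]
  rfl

/-- The lists to which a list is reduced when the straightening rule is applied once. -/
inductive Step (n ℓ : ℕ) : List ℤ → List ℤ → Prop
  | swap (pre post : List ℤ) (k₂ k₁ : ℤ) (h : k₂ < k₁) :
    Step n ℓ (pre ++ k₂ :: k₁ :: post) (pre ++ k₁ :: k₂ :: post)
  | corr (pre post : List ℤ) (k₂ k₁ j : ℤ) (h : k₂ < k₁) (hj : j ∈ corrRange n ℓ k₂ k₁) :
    Step n ℓ (pre ++ k₂ :: k₁ :: post)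
      (pre ++ corrFst n ℓ k₂ k₁ j :: corrSnd n ℓ k₂ k₁ j :: post)

/-- `l'` is reached from `l` by repeated use of the straightening rule. -/
abbrev Reach (n ℓ : ℕ) : List ℤ → List ℤ → Prop := Relation.ReflTransGen (Step n ℓ)

/-- A measure of disorder, which straightening decreases; `M` is a lower bound of the entries. -/
def disorder (M : ℤ) : List ℤ → ℤ
  | [] => 0
  | _ :: l => disorder M l + (l.sum - l.length * M)

theorem disorder_nonneg (M : ℤ) (l : List ℤ) (h : ∀ x ∈ l, M ≤ x) : 0 ≤ disorder M l := by
  induction l with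
  | nil => exact le_rfl
  | cons a l ih =>
    have h1 : ∀ x ∈ l, M ≤ x := fun x hx => h x (List.mem_cons_of_mem _ hx)
    have h2 := List.card_nsmul_le_sum l M h1
    rw [nsmul_eq_mul] at h2
    have := ih h1
    unfold disorder
    linarith

theorem disorder_append_lt (M : ℤ) (pre : List ℤ) {l l' : List ℤ} (hs : l.sum = l'.sum)
    (hl : l.length = l'.length) (h : disorder M l < disorder M l') :
    disorder M (pre ++ l) < disorder M (pre ++ l') := by
  induction pre with
  | nil => exact h
  | cons a pre ih => simpa [disorder, hs, hl] using ih

theorem Step.disorder_lt (hn : 0 < n) (hℓ : 0 < ℓ) {l l' : List ℤ} (h : Step n ℓ l l') (M : ℤ) :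
    disorder M l' < disorder M l := by
  cases h with
  | swap pre post k₂ k₁ h =>
    refine disorder_append_lt M pre ?_ rfl ?_
    · simp only [List.sum_cons]; ring
    · simp only [disorder, List.sum_cons, List.length_cons]; linarith
  | corr pre post k₂ k₁ j h hj =>
    have h1 := corr_lt hn hℓ hj
    have h2 := corr_add (n := n) (ℓ := ℓ) k₂ k₁ j
    refine disorder_append_lt M pre ?_ rfl ?_
    · simp only [List.sum_cons]; linarith
    · simp only [disorder, List.sum_cons, List.length_cons]; linarith

theorem Step.le_of_forall_le (hn : 0 < n) (hℓ : 0 < ℓ) {l l' : List ℤ} (h : Step n ℓ l l') {M : ℤ}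
    (hM : ∀ x ∈ l, M ≤ x) : ∀ x ∈ l', M ≤ x := by
  cases h with
  | swap pre post k₂ k₁ h =>
    intro x hx
    refine hM x ?_
    simp only [List.mem_append, List.mem_cons] at hx ⊢
    tauto
  | corr pre post k₂ k₁ j h hj =>
    have h1 := corr_lt hn hℓ hj
    have h2 := corr_add (n := n) (ℓ := ℓ) k₂ k₁ j
    have h3 := hM k₂ (by simp)
    intro x hx
    simp only [List.mem_append, List.mem_cons] at hx
    rcases hx with hx | rfl | rfl | hx
    · exact hM x (by simp [hx])
    · linarith
    · linarith
    · exact hM x (by simp [hx])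

/-- The ring `ℚ[q, q⁻¹]`. -/
def laurent : Subalgebra ℚ Kq := Algebra.adjoin ℚ {q, q⁻¹}

theorem q_mem_laurent : q ∈ laurent := Algebra.subset_adjoin (by simp)

theorem q_inv_mem_laurent : q⁻¹ ∈ laurent := Algebra.subset_adjoin (by simp)

theorem dFactor_mem (k₂ k₁ : ℤ) : dFactor n ℓ k₂ k₁ ∈ laurent := by
  unfold dFactor
  split_ifs
  · exact neg_mem q_inv_mem_laurent
  · exact one_mem _

theorem cFactor_mem (k₂ k₁ : ℤ) : cFactor n k₂ k₁ ∈ laurent := by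
  unfold cFactor
  split_ifs
  · exact q_mem_laurent
  · exact one_mem _

theorem exists_ascent {l : List ℤ} (h : ¬ l.Pairwise (· > ·)) :
    ∃ (pre post : List ℤ) (k₂ k₁ : ℤ), l = pre ++ k₂ :: k₁ :: post ∧ k₂ ≤ k₁ := by
  rw [← List.isChain_iff_pairwise, List.isChain_iff_forall_rel_of_append_cons_cons] at h
  push Not at h
  obtain ⟨a, b, pre, post, h1, h2⟩ := h
  exact ⟨pre, post, a, b, h1, h2⟩

/-- `e` gives the expansion of `l` in terms of strictly decreasing lists, simultaneously for all
functions that satisfy the straightening rule. -/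
structure IsExpansion (n ℓ : ℕ) (l : List ℤ) (e : List ℤ →₀ Kq) : Prop where
  mem_laurent : ∀ l', e l' ∈ laurent
  pairwise : ∀ l' ∈ e.support, l'.Pairwise (· > ·)
  reach : ∀ l' ∈ e.support, Reach n ℓ l l'
  eq_sum : ∀ {M : Type} [AddCommGroup M] [Module Kq M] {F : List ℤ → M}, IsStraight n ℓ F →
    F l = e.sum fun l' a => a • F l'

theorem isExpansion_single {l : List ℤ} (h : l.Pairwise (· > ·)) :
    IsExpansion n ℓ l (Finsupp.single l 1) where
  mem_laurent l' := by
    rw [Finsupp.single_apply]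
    split_ifs
    exacts [one_mem _, zero_mem _]
  pairwise l' hl' := by
    have := Finsupp.support_single_subset hl'
    rw [Finset.mem_singleton.1 this]
    exact h
  reach l' hl' := by
    have := Finsupp.support_single_subset hl'
    rw [Finset.mem_singleton.1 this]
  eq_sum _ := by simp

/-- Straightening terminates since it decreases `disorder`, which is bounded below. -/
theorem exists_expansion (hn : 0 < n) (hℓ : 0 < ℓ) (l : List ℤ) : ∃ e, IsExpansion n ℓ l e := by
  classical
  obtain ⟨M, hM⟩ : ∃ M, ∀ x ∈ l, M ≤ x := by
    obtain ⟨M, hM⟩ := l.toFinset.bddBelow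
    exact ⟨M, fun x hx => hM (by simpa using hx)⟩
  obtain ⟨N, hN⟩ : ∃ N : ℕ, disorder M l < N := ⟨(disorder M l).toNat + 1, by omega⟩
  induction N generalizing l with
  | zero => exact absurd (disorder_nonneg M l hM) (by simpa using hN)
  | succ N ih =>
    by_cases hl : l.Pairwise (· > ·)
    · exact ⟨_, isExpansion_single hl⟩
    obtain ⟨pre, post, k₂, k₁, rfl, hk⟩ := exists_ascent hl
    rcases hk.eq_or_lt with hk | hk
    · subst hk
      refine ⟨0, ⟨fun _ => zero_mem _, by simp, by simp, fun {M _ _ F} hF => ?_⟩⟩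
      have h1 := hF pre post k₂ k₂ le_rfl
      rw [corrRange_self, Finset.sum_empty, smul_zero, add_zero, dFactor, cFactor, if_pos rfl,
        if_pos rfl, smul_smul, neg_mul, inv_mul_cancel₀ q_ne_zero, neg_smul, one_smul,
        eq_neg_iff_add_eq_zero, ← two_smul Kq] at h1
      rw [Finsupp.sum_zero_index]
      exact (smul_eq_zero.1 h1).resolve_left two_ne_zero
    · have key : ∀ l', Step n ℓ (pre ++ k₂ :: k₁ :: post) l' → ∃ e, IsExpansion n ℓ l' e := by
        intro l' hs
        have := hs.disorder_lt hn hℓ M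
        push_cast at hN
        exact ih l' (hs.le_of_forall_le hn hℓ hM) (by omega)
      obtain ⟨e₀, h₀⟩ := key _ (Step.swap pre post k₂ k₁ hk)
      choose! e he using fun j hj => key _ (Step.corr pre post k₂ k₁ j hk hj)
      have hsupp : ∀ l' ∈ (dFactor n ℓ k₂ k₁ • (cFactor n k₂ k₁ • e₀ + (q - q⁻¹) •
          ∑ j ∈ corrRange n ℓ k₂ k₁, e j)).support, l' ∈ e₀.support ∨
          ∃ j ∈ corrRange n ℓ k₂ k₁, l' ∈ (e j).support := by
        intro l' hl'
        by_contra hc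
        push Not at hc
        refine Finsupp.mem_support_iff.1 hl' ?_
        have h1 : ∑ j ∈ corrRange n ℓ k₂ k₁, e j l' = 0 :=
          Finset.sum_eq_zero fun j hj => Finsupp.notMem_support_iff.1 (hc.2 j hj)
        simp only [Finsupp.smul_apply, Finsupp.add_apply, Finsupp.finsetSum_apply, h1,
          Finsupp.notMem_support_iff.1 hc.1, smul_zero, add_zero]
      refine ⟨dFactor n ℓ k₂ k₁ • (cFactor n k₂ k₁ • e₀ + (q - q⁻¹) •
        ∑ j ∈ corrRange n ℓ k₂ k₁, e j), ?_, ?_, ?_, ?_⟩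
      · intro l'
        simp only [Finsupp.smul_apply, Finsupp.add_apply, Finsupp.finsetSum_apply, smul_eq_mul]
        exact mul_mem (dFactor_mem _ _) (add_mem (mul_mem (cFactor_mem _ _) (h₀.mem_laurent _))
          (mul_mem (sub_mem q_mem_laurent q_inv_mem_laurent)
            (sum_mem fun j hj => (he j hj).mem_laurent _)))
      · intro l' hl'
        rcases hsupp l' hl' with h | ⟨j, hj, h⟩
        exacts [h₀.pairwise l' h, (he j hj).pairwise l' h]
      · intro l' hl'
        rcases hsupp l' hl' with h | ⟨j, hj, h⟩
        exacts [(h₀.reach l' h).head (Step.swap pre post k₂ k₁ hk),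
          ((he j hj).reach l' h).head (Step.corr pre post k₂ k₁ j hk hj)]
      · intro M _ _ F hF
        change _ = Finsupp.linearCombination Kq F _
        rw [hF pre post k₂ k₁ hk.le, h₀.eq_sum hF, map_smul, map_add, map_smul, map_smul, map_sum,
          Finset.sum_congr rfl fun j hj => (he j hj).eq_sum hF]
        rfl

end Straightening

/-! ### Relations and reversal -/

section Spanning

variable {n ℓ : ℕ}

theorem eventually_eq_ofList {s : ℤ} (k : P s) :
    ∀ᶠ N : ℕ in atTop, k = ofList s ((List.range N).map k.1) := by
  obtain ⟨N₀, h⟩ := eventually_atTop.1 k.2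
  filter_upwards [eventually_ge_atTop N₀] with N hN
  refine Subtype.ext (funext fun i => ?_)
  rw [ofList_apply]
  by_cases hi : i < N
  · rw [List.getD_eq_getElem _ _ (by simpa using hi)]
    simp
  · rw [List.getD_eq_default _ _ (by simpa using hi)]
    exact h i (by omega)

theorem eventually_entries_gt {s : ℤ} (k : P s) :
    ∀ᶠ N : ℕ in atTop, ∀ i < N, s - N < k.1 i := by
  obtain ⟨N₀, h⟩ := eventually_atTop.1 k.2
  have h1 : ∀ᶠ N : ℕ in atTop, ∀ i ∈ Finset.range N₀, s - N < k.1 i := by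
    rw [Filter.eventually_all_finset]
    intro i _
    filter_upwards [eventually_gt_atTop (s - k.1 i).toNat] with N hN
    omega
  filter_upwards [h1] with N hN i hi
  by_cases h2 : i < N₀
  · exact hN i (Finset.mem_range.2 h2)
  · rw [h i (by omega)]
    omega

theorem ofList_strictAnti {s : ℤ} {l : List ℤ} (h : l.Pairwise (· > ·))
    (h' : ∀ x ∈ l, s - l.length < x) : StrictAnti (ofList s l).1 := by
  refine strictAnti_nat_of_succ_lt fun i => ?_
  rw [ofList_apply, ofList_apply]
  by_cases h1 : i + 1 < l.length
  · rw [List.getD_eq_getElem _ _ h1, List.getD_eq_getElem _ _ (by omega)]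
    exact List.pairwise_iff_getElem.1 h _ _ _ _ (by omega)
  · rw [List.getD_eq_default _ _ (by omega)]
    by_cases h2 : i < l.length
    · rw [List.getD_eq_getElem _ _ h2]
      have := h' _ (List.getElem_mem h2)
      push_cast
      omega
    · rw [List.getD_eq_default _ _ (by omega)]
      push_cast
      omega

theorem Step.length_eq {l l' : List ℤ} (h : Step n ℓ l l') : l'.length = l.length := by
  cases h <;> simp

theorem Reach.length_eq {l l' : List ℤ} (h : Reach n ℓ l l') : l'.length = l.length := by
  induction h with
  | refl => rfl
  | tail _ h ih => exact h.length_eq.trans ih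

theorem Reach.le_of_forall_le (hn : 0 < n) (hℓ : 0 < ℓ) {l l' : List ℤ} (h : Reach n ℓ l l')
    {M : ℤ} (hM : ∀ x ∈ l, M ≤ x) : ∀ x ∈ l', M ≤ x := by
  induction h with
  | refl => exact hM
  | tail _ h ih => exact h.le_of_forall_le hn hℓ ih

theorem exists_ordered_sub_mem (hn : 0 < n) (hℓ : 0 < ℓ) {s : ℤ} (x : P s →₀ Kq) :
    ∃ y : P s →₀ Kq, (∀ k ∈ y.support, StrictAnti k.1) ∧ x - y ∈ relations n ℓ s := by
  classical
  induction x using Finsupp.induction_linear with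
  | zero => exact ⟨0, by simp, by simp⟩
  | add x x' hx hx' =>
    obtain ⟨y, h1, h2⟩ := hx
    obtain ⟨y', h1', h2'⟩ := hx'
    refine ⟨y + y', fun k hk => ?_, ?_⟩
    · rcases Finset.mem_union.1 (Finsupp.support_add hk) with h | h
      exacts [h1 k h, h1' k h]
    · have := add_mem h2 h2'
      rwa [show x - y + (x' - y') = x + x' - (y + y') by abel] at this
  | single k a =>
    obtain ⟨N, hN, hN'⟩ := ((eventually_eq_ofList k).and (eventually_entries_gt k)).exists
    obtain ⟨e, he⟩ := exists_expansion hn hℓ ((List.range N).map k.1)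
    have hgt : ∀ l' ∈ e.support, ∀ x ∈ l', s - l'.length < x := by
      intro l' hl' x hx
      have h1 := (he.reach l' hl').le_of_forall_le hn hℓ (M := s - N + 1) (fun x hx => by
        obtain ⟨i, hi, rfl⟩ := List.mem_map.1 hx
        have := hN' i (List.mem_range.1 hi)
        omega) x hx
      rw [(he.reach l' hl').length_eq, List.length_map, List.length_range]
      omega
    refine ⟨a • Finsupp.mapDomain (ofList s) e, fun k' hk' => ?_, ?_⟩
    · obtain ⟨l', hl', rfl⟩ := Finset.mem_image.1
        (Finsupp.mapDomain_support (Finsupp.support_smul hk'))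
      exact ofList_strictAnti (he.pairwise l' hl') (hgt l' hl')
    · rw [single_eq_smul, ← smul_sub]
      refine Submodule.smul_mem _ _ ((Submodule.Quotient.eq _).1 ?_)
      have h1 := he.eq_sum (isStraight_wedge n ℓ s)
      beta_reduce at h1
      rw [← hN] at h1
      refine (show _ = wedge n ℓ k from rfl).trans (h1.trans ?_)
      rw [← Submodule.mkQ_apply, Finsupp.mapDomain, Finsupp.sum, Finsupp.sum, map_sum]
      refine Finset.sum_congr rfl fun l' _ => ?_
      rw [single_eq_smul, map_smul]
      rfl

/-- In terms of labels, the straightening relations are cut out by the operators `b_i - a_i`. The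
summands of a vector in the sum of the ranges need not come from sequences in `P s`; ordering the
vector reduces the claim to the linear independence of the ordered wedges. -/
theorem mem_relations_iff (hn : 0 < n) (hℓ : 0 < ℓ) {s : ℤ} {x : P s →₀ Kq} :
    x ∈ relations n ℓ s ↔ labelMap n ℓ s x ∈ ⨆ i, LinearMap.range (opB i - opA i) := by
  refine ⟨labelMap_mem_of_mem_relations hn hℓ, fun h => ?_⟩
  obtain ⟨y, h1, h2⟩ := exists_ordered_sub_mem hn hℓ x
  have h3 := sub_mem h (labelMap_mem_of_mem_relations hn hℓ h2)
  rw [← map_sub, sub_sub_cancel] at h3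
  rwa [eq_zero_of_labelMap_mem h1 h3, sub_zero] at h2

end Spanning

section Twist

variable {R : Type*} [CommRing R] {α β : Type*}

/-- `f'` is the transform of `f` under the semilinear map given by `φ` on the coefficients and by
`θ` on the basis. -/
def IsTwist (φ : R →+* R) (θ : α → α) (f f' : Module.End R (α →₀ R)) : Prop :=
  ∀ x, mapCoeff φ (Finsupp.mapDomain θ (f x)) = f' (mapCoeff φ (Finsupp.mapDomain θ x))

variable {φ : R →+* R} {θ : α → α} {f g f' g' : Module.End R (α →₀ R)}

theorem isTwist_of_single
    (h : ∀ a, mapCoeff φ (Finsupp.mapDomain θ (f (Finsupp.single a 1))) =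
      f' (Finsupp.single (θ a) 1)) : IsTwist φ θ f f' := by
  intro x
  induction x using Finsupp.induction_linear with
  | zero => simp
  | add x y hx hy => simp only [map_add, Finsupp.mapDomain_add, hx, hy]
  | single a r =>
    rw [single_eq_smul, map_smul, Finsupp.mapDomain_smul, mapCoeff_smul, Finsupp.mapDomain_smul,
      mapCoeff_smul, map_smul, h, Finsupp.mapDomain_single, mapCoeff_single, map_one]

theorem IsTwist.mul (hf : IsTwist φ θ f f') (hg : IsTwist φ θ g g') :
    IsTwist φ θ (f * g) (f' * g') :=
  fun x => by rw [Module.End.mul_apply, hf, hg, Module.End.mul_apply]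

theorem IsTwist.add (hf : IsTwist φ θ f f') (hg : IsTwist φ θ g g') :
    IsTwist φ θ (f + g) (f' + g') :=
  fun x => by
    rw [LinearMap.add_apply, Finsupp.mapDomain_add, map_add, hf, hg, LinearMap.add_apply]

theorem isTwist_algebraMap (r : R) : IsTwist φ θ (algebraMap R (Module.End R (α →₀ R)) r)
    (algebraMap R (Module.End R (α →₀ R)) (φ r)) :=
  fun x => by simp [Module.algebraMap_end_apply, mapCoeff_smul, Finsupp.mapDomain_smul]

theorem IsTwist.onLeft (hf : IsTwist φ θ f f') (η : β → β) :
    IsTwist φ (Prod.map θ η) (onLeft β f) (onLeft β f') :=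
  isTwist_of_single fun ⟨a, b⟩ => by
    have := hf (Finsupp.single a 1)
    rw [Finsupp.mapDomain_single, mapCoeff_single, map_one] at this
    rw [onLeft_single, Prod.map_apply, onLeft_single, ← this, ← mapCoeff_mapDomain,
      ← Finsupp.mapDomain_comp, ← Finsupp.mapDomain_comp]
    rfl

theorem IsTwist.onRight (hf : IsTwist φ θ f f') (η : β → β) :
    IsTwist φ (Prod.map η θ) (onRight β f) (onRight β f') :=
  isTwist_of_single fun ⟨b, a⟩ => by
    have := hf (Finsupp.single a 1)
    rw [Finsupp.mapDomain_single, mapCoeff_single, map_one] at this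
    rw [onRight_single, Prod.map_apply, onRight_single, ← this, ← mapCoeff_mapDomain,
      ← Finsupp.mapDomain_comp, ← Finsupp.mapDomain_comp]
    rfl

/-- The reversal of the first `r` entries of a sequence. -/
def revSeq (r : ℕ) (k : ℕ → ℤ) (i : ℕ) : ℤ := if i < r then k (r - 1 - i) else k i

theorem revSeq_upd {r i : ℕ} (hi : i + 1 < r) (k : ℕ → ℤ) (a b : ℤ) :
    revSeq r (upd k i a b) = upd (revSeq r k) (r - 2 - i) b a := by
  ext j
  simp only [revSeq, upd_apply]
  split_ifs <;> first | rfl | omega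

theorem IsTwist.atPlace {f f' : Module.End R (ℤ × ℤ →₀ R)} (hf : IsTwist φ Prod.swap f f')
    {r i : ℕ} (hi : i + 1 < r) : IsTwist φ (revSeq r) (atPlace i f) (atPlace (r - 2 - i) f') :=
  isTwist_of_single fun k => by
    have := hf (Finsupp.single (k i, k (i + 1)) 1)
    rw [Finsupp.mapDomain_single, mapCoeff_single, map_one, Prod.swap_prod_mk] at this
    have e1 : revSeq r k (r - 2 - i) = k (i + 1) := by
      rw [revSeq, if_pos (by omega)]; congr 1; omega
    have e2 : revSeq r k (r - 2 - i + 1) = k i := by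
      rw [revSeq, if_pos (by omega)]; congr 1; omega
    rw [atPlace_single, atPlace_single, e1, e2, ← this, ← mapCoeff_mapDomain,
      ← Finsupp.mapDomain_comp, ← Finsupp.mapDomain_comp]
    congr 2
    ext p : 1
    exact revSeq_upd hi k _ _

theorem isTwist_heckePair {h κ : R} (hh : φ h = -h) (hκ : φ κ = κ + h) :
    IsTwist φ Prod.swap (heckePair h κ) (heckePair h κ + algebraMap R _ h) := by
  refine isTwist_of_single fun ⟨a, b⟩ => ?_
  rw [heckePair_single, Prod.swap_prod_mk, LinearMap.add_apply, heckePair_single,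
    Module.algebraMap_end_apply, ← single_eq_smul]
  rcases lt_trichotomy a b with hab | rfl | hab
  · rw [if_neg hab.ne, if_pos hab, if_neg hab.ne', if_neg hab.not_gt]
    simp [Finsupp.mapDomain_single, mapCoeff_single]
  · simp [Finsupp.mapDomain_single, mapCoeff_single, hκ, Finsupp.single_add]
  · rw [if_neg hab.ne', if_neg hab.not_gt, if_neg hab.ne, if_pos hab, sub_eq_add_neg,
      Finsupp.mapDomain_add, mapDomain_neg']
    simp [Finsupp.mapDomain_single, mapCoeff_single, hh]

theorem isTwist_swapPair : IsTwist φ Prod.swap (swapPair : Module.End R _) swapPair :=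
  isTwist_of_single fun ⟨a, b⟩ => by
    rw [swapPair_single, Prod.swap_prod_mk, swapPair_single]
    simp [Finsupp.mapDomain_single, mapCoeff_single]

theorem swap_demazure_swap {E : Type*} [Ring E] {s D : E} (hDs : D * s = -D)
    (hsD : s * D = D + 1 - s) (hs : s * s = 1) : s * D = (s - D - 1) * s := by
  rw [hsD, sub_mul, sub_mul, hDs, hs, one_mul]; abel

theorem isTwist_demazurePair : IsTwist φ Prod.swap (demazurePair : Module.End R _)
    (swapPair - demazurePair - 1) := by
  have h0 := swap_demazure_swap (E := Module.End R (ℤ × ℤ →₀ R)) demazurePair_mul_swapPair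
    swapPair_mul_demazurePair swapPair_mul_self
  have hs : ∀ x, mapCoeff φ (swapPair x) = swapPair (mapCoeff φ x) := fun x =>
    mapCoeff_mapDomain φ _ x
  have hD : ∀ x, mapCoeff φ (demazurePair x) = demazurePair (mapCoeff φ x) :=
    isScalarExtension_of_single fun ⟨a, b⟩ => by simp [demazurePair_single, mapCoeff_single]
  intro x
  change mapCoeff φ (swapPair (demazurePair x)) =
    (swapPair - demazurePair - 1 : Module.End R (ℤ × ℤ →₀ R)) (mapCoeff φ (swapPair x))
  have h1 := LinearMap.congr_fun h0 (mapCoeff φ x)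
  rw [Module.End.mul_apply, Module.End.mul_apply] at h1
  rw [hs, hD, hs, h1]

end Twist

section Reversal

variable {n ℓ : ℕ}

theorem conj_q_inv : conj q⁻¹ = q := by rw [map_inv₀, conj_q, inv_inv]

/-- The reversal of the first `r` labels. -/
abbrev revLabel (r : ℕ) : LabelSeq → LabelSeq :=
  Prod.map (Prod.map (revSeq r) (revSeq r)) (revSeq r)

theorem twist_opA_identity {E : Type*} [Ring E] {T s D h h' : E} (hh : h' = -h) :
    (T + h) * s + h' * (s - D - 1) = T * s + h * D + h := by
  rw [hh]; noncomm_ring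

theorem onLeft_add (β : Type*) {α : Type*} (f g : Module.End Kq (α →₀ Kq)) :
    onLeft β (f + g) = onLeft β f + onLeft β g := map_add (onLeftHom β) f g

theorem onRight_add (α : Type*) {β : Type*} (f g : Module.End Kq (β →₀ Kq)) :
    onRight α (f + g) = onRight α f + onRight α g := map_add (onRightHom α) f g

theorem onLeft_algebraMap (β : Type*) {α : Type*} (a : Kq) :
    onLeft β (algebraMap Kq (Module.End Kq (α →₀ Kq)) a) = algebraMap Kq _ a :=
  (onLeftHom β).commutes a

theorem onRight_algebraMap (α : Type*) {β : Type*} (a : Kq) :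
    onRight α (algebraMap Kq (Module.End Kq (β →₀ Kq)) a) = algebraMap Kq _ a :=
  (onRightHom α).commutes a

theorem atPlace_algebraMap (i : ℕ) (a : Kq) :
    atPlace i (algebraMap Kq (Module.End Kq (ℤ × ℤ →₀ Kq)) a) = algebraMap Kq _ a :=
  (atPlaceHom i).commutes a

theorem map_sub_sub_one {E E' : Type*} [Ring E] [Ring E'] (φ : E →+* E') (a b : E) :
    φ (a - b - 1) = φ a - φ b - 1 := by rw [map_sub, map_sub, map_one]

theorem onRight_atPlace_demazure (α : Type*) (i : ℕ) :
    onRight α (atPlace i (swapPair - demazurePair - 1 : Module.End Kq (ℤ × ℤ →₀ Kq))) =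
      onRight α (atPlace i swapPair) - onRight α (atPlace i demazurePair) - 1 := by
  exact map_sub_sub_one (E := Module.End Kq (ℤ × ℤ →₀ Kq))
    (E' := Module.End Kq (α × (ℕ → ℤ) →₀ Kq))
    ((onRightHom α).comp (atPlaceHom i)).toRingHom swapPair demazurePair

/-- Conjugation by the semilinear reversal turns `a_i` into the inverse of the operator at the
reflected place; the same holds for `b_i`, so the differences `b_i - a_i` are permuted. -/
theorem isTwist_opA {r i : ℕ} (hi : i + 1 < r) : IsTwist conj (revLabel r) (opA i)
    (opA (r - 2 - i) + algebraMap Kq _ (q - q⁻¹)) := by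
  have hh : conj (q - q⁻¹) = -(q - q⁻¹) := by rw [map_sub, conj_q, conj_q_inv]; ring
  have h1 := (((isTwist_heckePair hh (κ := q⁻¹) (by rw [conj_q_inv]; ring)).atPlace hi).onLeft
    (revSeq r)).mul (((isTwist_swapPair (φ := conj)).atPlace hi).onRight (revSeq r))
  have h2 := (isTwist_algebraMap (φ := conj) (θ := Prod.map (revSeq r) (revSeq r))
    (q - q⁻¹)).mul (((isTwist_demazurePair (φ := conj)).atPlace hi).onRight (revSeq r))
  have h3 := (h1.add h2).onLeft (revSeq r)
  convert h3 using 1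
  · rfl
  refine Eq.trans ?_ (congrArg (onLeft (ℕ → ℤ)) (?_ : affHecke (q - q⁻¹) q⁻¹ (r - 2 - i) +
    algebraMap Kq (Module.End Kq ((ℕ → ℤ) × (ℕ → ℤ) →₀ Kq)) (q - q⁻¹) = _))
  · rw [onLeft_add, onLeft_algebraMap]
    rfl
  · rw [onRight_atPlace_demazure, atPlace_add, atPlace_algebraMap, onLeft_add, onLeft_algebraMap]
    refine (twist_opA_identity (E := Module.End Kq ((ℕ → ℤ) × (ℕ → ℤ) →₀ Kq)) ?_).symm
    rw [hh, map_neg]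

theorem isTwist_opB {r i : ℕ} (hi : i + 1 < r) : IsTwist conj (revLabel r) (opB i)
    (opB (r - 2 - i) + algebraMap Kq _ (q - q⁻¹)) := by
  have hh : conj (q - q⁻¹) = -(q - q⁻¹) := by rw [map_sub, conj_q, conj_q_inv]; ring
  have h1 := ((isTwist_heckePair hh (κ := -q) (by rw [map_neg, conj_q]; ring)).atPlace hi).onRight
    (Prod.map (revSeq r) (revSeq r))
  convert h1 using 1
  · rfl
  rw [atPlace_add, atPlace_algebraMap, onRight_add, onRight_algebraMap]
  rfl

/-- The semilinear reversal of the first `r` factors. -/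
def revConj (s : ℤ) (r : ℕ) (x : P s →₀ Kq) : P s →₀ Kq :=
  mapCoeff conj (Finsupp.mapDomain (fun k => k.rev r) x)

theorem labelMap_revConj {s : ℤ} (r : ℕ) (x : P s →₀ Kq) : labelMap n ℓ s (revConj s r x) =
    mapCoeff conj (Finsupp.mapDomain (revLabel r) (labelMap n ℓ s x)) := by
  change Finsupp.mapDomain _ _ = mapCoeff conj (Finsupp.mapDomain _ (Finsupp.mapDomain _ _))
  rw [revConj, ← mapCoeff_mapDomain, ← Finsupp.mapDomain_comp, ← Finsupp.mapDomain_comp]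
  congr 2
  ext k : 1
  simp only [Function.comp, labels, Prod.map, Prod.mk.injEq, P.rev]
  refine ⟨⟨?_, ?_⟩, ?_⟩ <;> ext i <;> simp only [revSeq] <;> split_ifs <;> rfl

/-- Reversal respects each straightening relation that involves only the reversed factors. -/
theorem revConj_mem_relations (hn : 0 < n) (hℓ : 0 < ℓ) {s : ℤ} (k : P s) {r i : ℕ}
    (hi : i + 1 < r) (hk : k.1 i ≤ k.1 (i + 1)) :
    revConj s r (Finsupp.single k 1 - straighten n ℓ k i) ∈ relations n ℓ s := by
  rw [mem_relations_iff hn hℓ, labelMap_revConj]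
  obtain ⟨a, p, h⟩ := labelMap_relator hn hℓ k i hk
  generalize a • Finsupp.single p (1 : Kq) = z at h
  rw [h, LinearMap.sub_apply, sub_eq_add_neg, Finsupp.mapDomain_add, mapDomain_neg', map_add,
    map_neg, isTwist_opA hi, isTwist_opB hi, ← sub_eq_add_neg, LinearMap.add_apply,
    LinearMap.add_apply, add_sub_add_right_eq_sub, ← LinearMap.sub_apply]
  exact Submodule.mem_iSup_of_mem (r - 2 - i) ⟨_, rfl⟩

end Reversal

/-! ### Moving a factor, and the prefactor of the bar involution -/

section Move

variable {n ℓ : ℕ}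

/-- `x` to the power of the number of pairs of equal entries. -/
def pairProd (x : Kq) : List ℤ → Kq
  | [] => 1
  | a :: l => x ^ l.count a * pairProd x l

theorem pairProd_perm (x : Kq) {l l' : List ℤ} (h : l.Perm l') : pairProd x l = pairProd x l' := by
  induction h with
  | nil => rfl
  | cons a h ih => rw [pairProd, pairProd, ih, h.count_eq]
  | swap a b l =>
    simp only [pairProd, List.count_cons]
    by_cases hab : a = b
    · subst hab; rfl
    · have h1 : (a == b) = false := by simpa using hab
      have h2 : (b == a) = false := by simpa using Ne.symm hab
      rw [h1, h2]
      simp only [Bool.false_eq_true, if_false, add_zero]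
      ring
  | trans _ _ h1 h2 => exact h1.trans h2

theorem pairProd_mul (x y : Kq) (l : List ℤ) :
    pairProd x l * pairProd y l = pairProd (x * y) l := by
  induction l with
  | nil => exact one_mul 1
  | cons a l ih => simp only [pairProd, ← ih, mul_pow]; ring

theorem pairProd_one (l : List ℤ) : pairProd 1 l = 1 := by
  induction l with
  | nil => rfl
  | cons a l ih => rw [pairProd, ih, one_pow, one_mul]

theorem conj_pairProd (x : Kq) (l : List ℤ) : conj (pairProd x l) = pairProd (conj x) l := by
  induction l with
  | nil => exact map_one conj
  | cons a l ih => simp only [pairProd, map_mul, map_pow, ih]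

theorem pairProd_mem {x : Kq} (hx : x ∈ laurent) (l : List ℤ) : pairProd x l ∈ laurent := by
  induction l with
  | nil => exact one_mem _
  | cons a l ih => exact mul_mem (pow_mem hx _) ih

/-- The prefactor `(-q)^{κ(d)} q^{-κ(c)}` of the bar involution. -/
def barFactor (n ℓ : ℕ) (l : List ℤ) : Kq :=
  pairProd (-q) (l.map (dPart n ℓ)) * pairProd q⁻¹ (l.map (cPart n))

/-- The contribution to the prefactor of the pairs formed by `a` and the entries of `w`. -/
def moveFactor (n ℓ : ℕ) (a : ℤ) (w : List ℤ) : Kq :=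
  (-q) ^ (w.map (dPart n ℓ)).count (dPart n ℓ a) * (q⁻¹) ^ (w.map (cPart n)).count (cPart n a)

theorem barFactor_nil : barFactor n ℓ [] = 1 := one_mul 1

theorem barFactor_cons (a : ℤ) (l : List ℤ) :
    barFactor n ℓ (a :: l) = moveFactor n ℓ a l * barFactor n ℓ l := by
  simp only [barFactor, moveFactor, List.map_cons, pairProd]; ring

theorem barFactor_congr {l l' : List ℤ} (hd : (l.map (dPart n ℓ)).Perm (l'.map (dPart n ℓ)))
    (hc : (l.map (cPart n)).Perm (l'.map (cPart n))) : barFactor n ℓ l = barFactor n ℓ l' := by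
  rw [barFactor, barFactor, pairProd_perm _ hd, pairProd_perm _ hc]

theorem barFactor_perm {l l' : List ℤ} (h : l.Perm l') : barFactor n ℓ l = barFactor n ℓ l' :=
  barFactor_congr (h.map _) (h.map _)

theorem moveFactor_perm (a : ℤ) {l l' : List ℤ} (h : l.Perm l') :
    moveFactor n ℓ a l = moveFactor n ℓ a l' := by
  rw [moveFactor, moveFactor, (h.map _).count_eq, (h.map _).count_eq]

theorem moveFactor_append (a : ℤ) (w w' : List ℤ) :
    moveFactor n ℓ a (w ++ w') = moveFactor n ℓ a w * moveFactor n ℓ a w' := by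
  simp only [moveFactor, List.map_append, List.count_append, pow_add]; ring

theorem barFactor_append_singleton (l : List ℤ) (a : ℤ) :
    barFactor n ℓ (l ++ [a]) = moveFactor n ℓ a l * barFactor n ℓ l := by
  rw [barFactor_perm (List.perm_append_singleton _ _), barFactor_cons]

theorem conj_barFactor_mul (l : List ℤ) : conj (barFactor n ℓ l) * barFactor n ℓ l = 1 := by
  have hq := q_ne_zero
  rw [barFactor, map_mul, conj_pairProd, conj_pairProd, mul_mul_mul_comm, pairProd_mul,
    pairProd_mul, map_neg, conj_q, conj_q_inv, neg_mul_neg, inv_mul_cancel₀ hq, mul_inv_cancel₀ hq,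
    pairProd_one, pairProd_one, one_mul]

theorem barFactor_mem (l : List ℤ) : barFactor n ℓ l ∈ laurent :=
  mul_mem (pairProd_mem (neg_mem q_mem_laurent) _) (pairProd_mem q_inv_mem_laurent _)

theorem kappa_succ (a : ℕ → ℤ) (r : ℕ) :
    kappa a (r + 1) = kappa a r + ((List.range r).map a).count (a r) := by
  classical
  have h1 : (((Finset.range (r + 1)) ×ˢ (Finset.range (r + 1))).filter
      fun p => p.1 < p.2 ∧ a p.1 = a p.2) =
      ((Finset.range r ×ˢ Finset.range r).filter fun p => p.1 < p.2 ∧ a p.1 = a p.2) ∪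
      ((Finset.range r).filter fun i => a i = a r).image fun i => (i, r) := by
    ext ⟨i, j⟩
    simp only [Finset.mem_filter, Finset.mem_product, Finset.mem_range, Finset.mem_union,
      Finset.mem_image, Prod.mk.injEq]
    constructor
    · rintro ⟨⟨h1, h2⟩, h3, h4⟩
      rcases (Nat.lt_succ_iff.1 h2).eq_or_lt with rfl | h5
      · exact Or.inr ⟨i, ⟨h3, h4⟩, rfl, rfl⟩
      · exact Or.inl ⟨⟨by omega, h5⟩, h3, h4⟩
    · rintro (⟨⟨h1, h2⟩, h3, h4⟩ | ⟨i', ⟨h1, h2⟩, rfl, rfl⟩)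
      · exact ⟨⟨by omega, by omega⟩, h3, h4⟩
      · exact ⟨⟨by omega, by omega⟩, h1, h2⟩
  have h2 : ∀ r : ℕ, ∀ x, ((Finset.range r).filter fun i => a i = x).card =
      ((List.range r).map a).count x := by
    intro r x
    induction r with
    | zero => simp
    | succ r ih =>
      rw [Finset.range_add_one, Finset.filter_insert, List.range_succ, List.map_append,
        List.count_append, ← ih]
      split_ifs with h
      · rw [Finset.card_insert_of_notMem (by simp)]
        simp [h]
      · simp [h]
  rw [kappa, h1, Finset.card_union_of_disjoint, Finset.card_image_of_injective, h2]
  · rfl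
  · intro i j h
    exact (Prod.mk.inj h).1
  · rw [Finset.disjoint_left]
    rintro ⟨i, j⟩ h1 h2
    simp only [Finset.mem_filter, Finset.mem_product, Finset.mem_range, Finset.mem_image,
      Prod.mk.injEq] at h1 h2
    obtain ⟨_, _, _, h3⟩ := h2
    omega

theorem pow_kappa (x : Kq) (a : ℕ → ℤ) (r : ℕ) :
    x ^ kappa a r = pairProd x ((List.range r).map a) := by
  induction r with
  | zero => simp [kappa, pairProd]
  | succ r ih =>
    rw [kappa_succ, pow_add, ih, List.range_succ, List.map_append, List.map_singleton,
      pairProd_perm x (List.perm_append_singleton _ _), pairProd, mul_comm]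

theorem moveFactor_cons (a b : ℤ) (w : List ℤ) : moveFactor n ℓ a (b :: w) *
    (dFactor n ℓ a b * cFactor n a b) = moveFactor n ℓ a w := by
  have hq := q_ne_zero
  simp only [moveFactor, List.map_cons, List.count_cons, dFactor, cFactor, beq_iff_eq]
  generalize (w.map (dPart n ℓ)).count (dPart n ℓ a) = x
  generalize (w.map (cPart n)).count (cPart n a) = y
  split_ifs <;> simp only [add_zero, pow_succ] <;> generalize (-q) ^ x = X <;>
    generalize q⁻¹ ^ y = Y <;> field_simp

/-- A factor `u_a` can be moved to the right past larger factors if the corrections vanish. -/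
theorem IsStraight.move {M : Type*} [AddCommGroup M] [Module Kq M] {F : List ℤ → M}
    (hF : IsStraight n ℓ F) (a : ℤ) (pre w post : List ℤ) (hw : ∀ b ∈ w, a < b)
    (hz : ∀ w₁ b w₂, w = w₁ ++ b :: w₂ → ∀ j ∈ corrRange n ℓ a b,
      F (pre ++ w₁ ++ corrFst n ℓ a b j :: corrSnd n ℓ a b j :: (w₂ ++ post)) = 0) :
    moveFactor n ℓ a w • F (pre ++ a :: (w ++ post)) = F (pre ++ (w ++ a :: post)) := by
  induction w generalizing pre with
  | nil => simp [moveFactor]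
  | cons b w ih =>
    have h1 := ih (pre ++ [b]) (fun b' hb' => hw b' (List.mem_cons_of_mem _ hb'))
      (fun w₁ b' w₂ h j hj => by
        simpa using hz (b :: w₁) b' w₂ (by rw [h, List.cons_append]) j hj)
    have h2 := hF pre (w ++ post) a b (hw b List.mem_cons_self).le
    have h3 : ∑ j ∈ corrRange n ℓ a b,
        F (pre ++ corrFst n ℓ a b j :: corrSnd n ℓ a b j :: (w ++ post)) = 0 :=
      Finset.sum_eq_zero fun j hj => by simpa using hz [] b w rfl j hj
    rw [h3, smul_zero, add_zero, smul_smul] at h2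
    simp only [List.append_assoc, List.cons_append, List.nil_append] at h1 ⊢
    rw [h2, smul_smul, moveFactor_cons, h1]

end Move

section Stability

variable {n ℓ : ℕ}

/-- The sum of the differences of the entries of `l` to those of the vacuum. -/
def excess (s : ℤ) (l : List ℤ) : ℤ := l.sum - ∑ i ∈ Finset.range l.length, (s - i)

/-- A condition under which the reversal of the factors in `l` gives the bar involution: moving one
more factor of the tail `u_{s - r} ∧ ⋯` past the reversed factors, `r` being the length of `l`, then
yields only corrections that vanish. -/
def IsStable (s : ℤ) (l : List ℤ) : Prop :=
  (∀ x ∈ l, s - l.length < x) ∧ excess s l ≤ l.length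

theorem Step.sum_eq {l l' : List ℤ} (h : Step n ℓ l l') : l'.sum = l.sum := by
  cases h with
  | swap pre post k₂ k₁ h => simp only [List.sum_append, List.sum_cons]; ring
  | corr pre post k₂ k₁ j h hj =>
    have := corr_add (n := n) (ℓ := ℓ) k₂ k₁ j
    simp only [List.sum_append, List.sum_cons]; linarith

theorem Reach.sum_eq {l l' : List ℤ} (h : Reach n ℓ l l') : l'.sum = l.sum := by
  induction h with
  | refl => rfl
  | tail _ h ih => exact h.sum_eq.trans ih

theorem le_sum_of_pairwise {l : List ℤ} (h : l.Pairwise (· > ·)) {m : ℤ} (hm : ∀ x ∈ l, m ≤ x) :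
    ∑ i ∈ Finset.range l.length, (m + i) ≤ l.sum := by
  induction l with
  | nil => simp
  | cons a l ih =>
    rw [List.pairwise_cons] at h
    have h1 := ih h.2 fun x hx => hm x (List.mem_cons_of_mem _ hx)
    have h2 : l.toFinset ⊆ Finset.Ico m a := fun x hx => by
      rw [List.mem_toFinset] at hx
      exact Finset.mem_Ico.2 ⟨hm x (List.mem_cons_of_mem _ hx), h.1 x hx⟩
    have h3 := Finset.card_le_card h2
    have h4 := hm a List.mem_cons_self
    rw [List.toFinset_card_of_nodup (h.2.imp fun h => h.ne'), Int.card_Ico] at h3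
    rw [List.length_cons, Finset.sum_range_succ, List.sum_cons]
    omega

/-- A wedge of small excess vanishes if all its listed entries exceed the first entry of the tail
by at least `2`: ordered lists with such entries have a larger sum. -/
theorem wedge_eq_zero (hn : 0 < n) (hℓ : 0 < ℓ) {s : ℤ} {l : List ℤ}
    (h1 : ∀ x ∈ l, s - l.length + 2 ≤ x) (h2 : excess s l < l.length) :
    wedge n ℓ (ofList s l) = 0 := by
  obtain ⟨e, he⟩ := exists_expansion hn hℓ l
  have h3 := he.eq_sum (isStraight_wedge n ℓ s)
  beta_reduce at h3
  rw [h3]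
  refine Finset.sum_eq_zero fun l' hl' => ?_
  exfalso
  have h4 := le_sum_of_pairwise (he.pairwise l' hl') ((he.reach l' hl').le_of_forall_le hn hℓ h1)
  rw [(he.reach l' hl').sum_eq, (he.reach l' hl').length_eq,
    ← Finset.sum_range_reflect] at h4
  have h5 : ∑ i ∈ Finset.range l.length, (s - l.length + 2 + ((l.length - 1 - i : ℕ) : ℤ)) =
      ∑ i ∈ Finset.range l.length, (s - i) + l.length := by
    have h6 : ∑ i ∈ Finset.range l.length, (s - i) + (l.length : ℤ) =
        ∑ i ∈ Finset.range l.length, (s - i + 1) := by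
      rw [Finset.sum_add_distrib]; simp
    rw [h6]
    refine Finset.sum_congr rfl fun i hi => ?_
    have := Finset.mem_range.1 hi
    omega
  rw [h5] at h4
  unfold excess at h2
  omega

theorem ofList_append (s : ℤ) (l : List ℤ) : ofList s (l ++ [s - l.length]) = ofList s l := by
  refine Subtype.ext (funext fun i => ?_)
  rw [ofList_apply, ofList_apply]
  rcases lt_trichotomy i l.length with h | h | h
  · rw [List.getD_append _ _ _ _ h]
  · subst h
    rw [List.getD_append_right _ _ _ _ le_rfl, List.getD_eq_default _ _ le_rfl]
    simp
  · rw [List.getD_eq_default _ _ (by simp; omega), List.getD_eq_default _ _ h.le]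

theorem excess_append (s : ℤ) (l : List ℤ) : excess s (l ++ [s - l.length]) = excess s l := by
  unfold excess
  rw [List.length_append, List.length_singleton, Finset.sum_range_succ, List.sum_append,
    List.sum_singleton]
  ring

theorem IsStable.append {s : ℤ} {l : List ℤ} (h : IsStable s l) :
    IsStable s (l ++ [s - l.length]) := by
  refine ⟨fun x hx => ?_, ?_⟩
  · rw [List.length_append, List.length_singleton]
    push_cast
    rcases List.mem_append.1 hx with hx | hx
    · have := h.1 x hx
      omega
    · rw [List.mem_singleton.1 hx]
      omega
  · rw [excess_append, List.length_append]
    have := h.2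
    push_cast
    omega

theorem IsStable.congr {s : ℤ} {l l' : List ℤ} (h : IsStable s l) (hl : l'.length = l.length)
    (hs : l'.sum = l.sum) (hx : ∀ x ∈ l', s - l.length < x) : IsStable s l' := by
  refine ⟨by rwa [hl], ?_⟩
  have := h.2
  rwa [excess, hl, hs]

theorem IsStable.perm {s : ℤ} {l l' : List ℤ} (h : IsStable s l) (hl : l.Perm l') :
    IsStable s l' :=
  h.congr hl.length_eq.symm hl.sum_eq.symm fun x hx => h.1 x (hl.mem_iff.2 hx)

/-- The reversed wedge, with its prefactor. -/
def barWedge (n ℓ : ℕ) (s : ℤ) (l : List ℤ) : Wedge n ℓ s :=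
  barFactor n ℓ l • wedge n ℓ (ofList s l.reverse)

theorem IsStable.barWedge_append (hn : 0 < n) (hℓ : 0 < ℓ) {s : ℤ} {l : List ℤ}
    (h : IsStable s l) : barWedge n ℓ s (l ++ [s - l.length]) = barWedge n ℓ s l := by
  have h1 := (isStraight_wedge n ℓ s).move (s - l.length) [] l.reverse []
    (fun b hb => h.1 b (List.mem_reverse.1 hb)) (fun w₁ b w₂ hw j hj => by
      have e1 : l.length = w₁.length + (w₂.length + 1) := by
        rw [← List.length_reverse, hw]; simp
      have e2 : l.sum = w₁.sum + (b + w₂.sum) := by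
        rw [← List.sum_reverse, hw]; simp
      have hc := corr_lt hn hℓ hj
      have hadd := corr_add (n := n) (ℓ := ℓ) (s - l.length) b j
      have hlen : ([] ++ w₁ ++ corrFst n ℓ (s - l.length) b j ::
          corrSnd n ℓ (s - l.length) b j :: (w₂ ++ [])).length = l.length + 1 := by
        simp; omega
      refine wedge_eq_zero hn hℓ (fun x hx => ?_) ?_
      · rw [hlen]
        have hmem : ∀ y, y ∈ w₁ ∨ y ∈ w₂ → s - l.length < y := fun y hy =>
          h.1 y (List.mem_reverse.1 (by rw [hw]; simp; tauto))
        simp only [List.nil_append, List.append_nil, List.mem_append, List.mem_cons] at hx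
        push_cast
        rcases hx with hx | rfl | rfl | hx
        · have := hmem x (Or.inl hx); omega
        · omega
        · have := hc.2; omega
        · have := hmem x (Or.inr hx); omega
      · have h2 := h.2
        unfold excess at h2 ⊢
        rw [hlen, Finset.sum_range_succ]
        simp only [List.nil_append, List.append_nil, List.sum_append, List.sum_cons]
        push_cast
        omega)
  have e3 : ofList s (l.reverse ++ [s - l.length]) = ofList s l.reverse := by
    rw [← List.length_reverse, ofList_append]
  simp only [List.nil_append, List.append_nil, e3] at h1
  rw [barWedge, barFactor_append_singleton, List.reverse_append, List.reverse_singleton,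
    List.singleton_append, barWedge, ← h1, smul_smul, mul_comm (moveFactor _ _ _ _),
    moveFactor_perm _ (List.reverse_perm l)]

/-- The first `N` entries of a sequence. -/
def firstEntries (N : ℕ) (k : ℕ → ℤ) : List ℤ := (List.range N).map k

/-- Reversing the first `N` factors of `u_k` gives the bar involution. -/
def StableAt {s : ℤ} (k : P s) (N : ℕ) : Prop :=
  k = ofList s (firstEntries N k.1) ∧ IsStable s (firstEntries N k.1)

theorem eventually_stableAt {s : ℤ} (k : P s) : ∀ᶠ N : ℕ in atTop, StableAt k N := by
  obtain ⟨N₀, h⟩ := eventually_atTop.1 k.2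
  have h1 : ∀ N, N₀ ≤ N → excess s (firstEntries N k.1) = excess s (firstEntries N₀ k.1) := by
    intro N hN
    induction N, hN using Nat.le_induction with
    | base => rfl
    | succ N hN ih =>
      rw [← ih, firstEntries, List.range_succ, List.map_append, List.map_singleton, h N hN]
      have := excess_append s (firstEntries N k.1)
      rw [firstEntries, List.length_map, List.length_range] at this
      exact this
  filter_upwards [eventually_eq_ofList k, eventually_entries_gt k, eventually_ge_atTop N₀,
    eventually_ge_atTop (excess s (firstEntries N₀ k.1)).toNat] with N hN1 hN2 hN3 hN4
  refine ⟨hN1, fun x hx => ?_, ?_⟩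
  · obtain ⟨i, hi, rfl⟩ := List.mem_map.1 hx
    rw [firstEntries, List.length_map, List.length_range]
    exact hN2 i (List.mem_range.1 hi)
  · rw [h1 N hN3]
    simp only [firstEntries, List.length_map, List.length_range] at hN4 ⊢
    omega

theorem length_firstEntries (N : ℕ) (k : ℕ → ℤ) : (firstEntries N k).length = N := by
  rw [firstEntries, List.length_map, List.length_range]

theorem firstEntries_ofList (s : ℤ) (l : List ℤ) : firstEntries l.length (ofList s l).1 = l := by
  refine List.ext_getElem (length_firstEntries _ _) fun i h1 h2 => ?_
  simp only [firstEntries, List.getElem_map, List.getElem_range, ofList_apply]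
  exact List.getD_eq_getElem _ _ h2

theorem stableAt_ofList {s : ℤ} {l : List ℤ} (h : IsStable s l) :
    StableAt (ofList s l) l.length := by
  rw [StableAt, firstEntries_ofList]
  exact ⟨rfl, h⟩

theorem StableAt.succ {s : ℤ} {k : P s} {N : ℕ} (h : StableAt k N) :
    firstEntries (N + 1) k.1 = firstEntries N k.1 ++ [s - (firstEntries N k.1).length] := by
  have h1 : k.1 N = s - N := by
    rw [h.1, ofList_apply, List.getD_eq_default]
    rw [length_firstEntries]
  rw [length_firstEntries, ← h1]
  simp [firstEntries, List.range_succ]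

theorem StableAt.of_le (hn : 0 < n) (hℓ : 0 < ℓ) {s : ℤ} {k : P s} {N N' : ℕ} (h : StableAt k N)
    (hN : N ≤ N') : StableAt k N' ∧
      barWedge n ℓ s (firstEntries N' k.1) = barWedge n ℓ s (firstEntries N k.1) := by
  induction N', hN using Nat.le_induction with
  | base => exact ⟨h, rfl⟩
  | succ N' hN ih =>
    refine ⟨⟨?_, ?_⟩, ?_⟩
    · rw [ih.1.succ, ofList_append]; exact ih.1.1
    · rw [ih.1.succ]; exact ih.1.2.append
    · rw [ih.1.succ, ih.1.2.barWedge_append hn hℓ, ih.2]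

end Stability

section Bar

variable {n ℓ : ℕ}

/-- The image of `u_k` under the bar involution. -/
def barValue (n ℓ : ℕ) {s : ℤ} (k : P s) : Wedge n ℓ s :=
  barWedge n ℓ s (firstEntries (eventually_stableAt k).exists.choose k.1)

theorem StableAt.barValue_eq (hn : 0 < n) (hℓ : 0 < ℓ) {s : ℤ} {k : P s} {N : ℕ}
    (h : StableAt k N) : barValue n ℓ k = barWedge n ℓ s (firstEntries N k.1) := by
  have h' := (eventually_stableAt k).exists.choose_spec
  rw [barValue, ← (h'.of_le hn hℓ (le_max_left _ N)).2, (h.of_le hn hℓ (le_max_right _ N)).2]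

theorem rev_ofList (s : ℤ) (l : List ℤ) : (ofList s l).rev l.length = ofList s l.reverse := by
  refine Subtype.ext (funext fun i => ?_)
  simp only [P.rev, ofList_apply]
  split_ifs with h
  · rw [List.getD_eq_getElem _ _ (by omega), List.getD_eq_getElem _ _ (by simpa using h),
      List.getElem_reverse]
  · rw [List.getD_eq_default _ _ (by omega), List.getD_eq_default _ _ (by simpa using h)]

/-- The semilinear map on the free module that becomes the bar involution. -/
def barFree (n ℓ : ℕ) (s : ℤ) : (P s →₀ Kq) →ₛₗ[conj] Wedge n ℓ s where
  toFun x := Finsupp.linearCombination Kq (barValue n ℓ) (mapCoeff conj x)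
  map_add' x y := by rw [map_add, map_add]
  map_smul' a x := by rw [mapCoeff_smul, map_smul]

/-- The semilinear reversal of the first `r` factors, with values in `Λ^s`. -/
def revFree (n ℓ : ℕ) (s : ℤ) (r : ℕ) (a : Kq) : (P s →₀ Kq) →ₛₗ[conj] Wedge n ℓ s where
  toFun x := a • (relations n ℓ s).mkQ (revConj s r x)
  map_add' x y := by rw [revConj, Finsupp.mapDomain_add, map_add, map_add, smul_add]; rfl
  map_smul' b x := by
    rw [revConj, Finsupp.mapDomain_smul, mapCoeff_smul, map_smul, smul_comm]; rfl

theorem barFree_single {s : ℤ} (k : P s) : barFree n ℓ s (Finsupp.single k 1) = barValue n ℓ k := by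
  simp [barFree, mapCoeff_single]

theorem barFree_eq_revFree (hn : 0 < n) (hℓ : 0 < ℓ) {s : ℤ} {l : List ℤ} (h : IsStable s l) :
    barFree n ℓ s (Finsupp.single (ofList s l) 1) =
      revFree n ℓ s l.length (barFactor n ℓ l) (Finsupp.single (ofList s l) 1) := by
  rw [barFree_single, (stableAt_ofList h).barValue_eq hn hℓ, firstEntries_ofList, barWedge]
  simp only [revFree, LinearMap.coe_mk, AddHom.coe_mk, revConj, Finsupp.mapDomain_single,
    mapCoeff_single, map_one, rev_ofList]
  rfl

/-- The bar involution respects the relations. On the terms of one relation it is the reversal of a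
fixed number of factors with a fixed prefactor, since straightening does not change the multisets
of labels `c` and `d`. -/
theorem barFree_relator (hn : 0 < n) (hℓ : 0 < ℓ) {s : ℤ} (k : P s) (i : ℕ)
    (hk : k.1 i ≤ k.1 (i + 1)) :
    barFree n ℓ s (Finsupp.single k 1 - straighten n ℓ k i) = 0 := by
  obtain ⟨N, hN, hi⟩ := ((eventually_stableAt k).and (eventually_gt_atTop (i + 1))).exists
  obtain ⟨l, hl⟩ : ∃ l, l = firstEntries N k.1 := ⟨_, rfl⟩
  have hlen : l.length = N := by rw [hl, length_firstEntries]
  obtain ⟨pre, post, k₂, k₁, hsplit, hpre⟩ : ∃ pre post k₂ k₁, l = pre ++ k₂ :: k₁ :: post ∧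
      pre.length = i := by
    refine ⟨l.take i, l.drop (i + 2), l[i], l[i + 1], ?_, by simp; omega⟩
    rw [← List.drop_eq_getElem_cons, ← List.drop_eq_getElem_cons, List.take_append_drop]
  have hkl : k = ofList s l := by rw [hl]; exact hN.1
  have hst : IsStable s l := by rw [hl]; exact hN.2
  have e2 : k.1 i = k₂ := by
    rw [hkl, ofList_apply, hsplit, List.getD_append_right _ _ _ _ hpre.le, hpre, Nat.sub_self,
      List.getD_cons_zero]
  have e1 : k.1 (i + 1) = k₁ := by
    rw [hkl, ofList_apply, hsplit, List.getD_append_right _ _ _ _ (by omega), hpre,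
      Nat.add_sub_cancel_left, List.getD_cons_succ, List.getD_cons_zero]
  rw [e1, e2] at hk
  have hrep : ∀ a b, k.replace i a b = ofList s (pre ++ a :: b :: post) := by
    intro a b
    rw [hkl, hsplit, ← hpre, ofList_replace]
  have key : ∀ a b, a + b = k₂ + k₁ → k₂ ≤ a → k₂ ≤ b →
      ([dPart n ℓ a, dPart n ℓ b].Perm [dPart n ℓ k₂, dPart n ℓ k₁]) →
      ([cPart n a, cPart n b].Perm [cPart n k₂, cPart n k₁]) →
      barFree n ℓ s (Finsupp.single (k.replace i a b) 1) =
        revFree n ℓ s N (barFactor n ℓ l) (Finsupp.single (k.replace i a b) 1) := by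
    intro a b hab ha hb hd hc
    have hlen' : (pre ++ a :: b :: post).length = l.length := by rw [hsplit]; simp
    have hfac : barFactor n ℓ (pre ++ a :: b :: post) = barFactor n ℓ l := by
      rw [hsplit]
      refine barFactor_congr ?_ ?_ <;> simp only [List.map_append, List.map_cons]
      · exact (List.Perm.append_right (post.map _) hd).append_left _
      · exact (List.Perm.append_right (post.map _) hc).append_left _
    have hst' : IsStable s (pre ++ a :: b :: post) := by
      refine hst.congr hlen' ?_ fun x hx => ?_
      · rw [hsplit]
        simp only [List.sum_append, List.sum_cons]
        linarith
      · have h2 := hst.1 k₂ (by rw [hsplit]; simp)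
        simp only [List.mem_append, List.mem_cons] at hx
        rcases hx with hx | rfl | rfl | hx
        · exact hst.1 x (by rw [hsplit]; simp [hx])
        · omega
        · omega
        · exact hst.1 x (by rw [hsplit]; simp [hx])
    rw [hrep, barFree_eq_revFree hn hℓ hst', hlen', hfac, hlen]
  have hmem : Finsupp.single k 1 - straighten n ℓ k i ∈
      LinearMap.eqLocus (barFree n ℓ s) (revFree n ℓ s N (barFactor n ℓ l)) := by
    have hk0 : k.replace i k₂ k₁ = k := by rw [hrep, ← hsplit, hkl]
    refine sub_mem ?_ (Submodule.smul_mem _ _ (add_mem (Submodule.smul_mem _ _ ?_)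
      (Submodule.smul_mem _ _ (sum_mem fun j hj => ?_))))
    · have := key k₂ k₁ rfl le_rfl hk (List.Perm.refl _) (List.Perm.refl _)
      rwa [hk0] at this
    · rw [e1, e2]
      exact key k₁ k₂ (add_comm _ _) hk le_rfl (List.Perm.swap _ _ _) (List.Perm.swap _ _ _)
    · rw [e1, e2] at hj ⊢
      have hc := corr_lt hn hℓ hj
      have hadd := corr_add (n := n) (ℓ := ℓ) k₂ k₁ j
      obtain ⟨p1, p2, p3⟩ := corrFst_parts hn hℓ k₂ k₁ j
      obtain ⟨p4, p5, p6⟩ := corrSnd_parts hn hℓ k₂ k₁ j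
      refine key (corrFst n ℓ k₂ k₁ j) (corrSnd n ℓ k₂ k₁ j) hadd hc.1.le (by omega) ?_ ?_
      · rw [p2, p5]; exact List.Perm.swap _ _ _
      · rw [p1, p4]
  rw [LinearMap.mem_eqLocus] at hmem
  rw [hmem]
  have h0 := revConj_mem_relations hn hℓ k hi (by rw [e1, e2]; exact hk)
  change barFactor n ℓ l • (relations n ℓ s).mkQ _ = 0
  rw [(Submodule.mkQ_apply _ _).trans ((Submodule.Quotient.mk_eq_zero _).2 h0), smul_zero]

theorem conj_comp_conj : conj.comp conj = RingHom.id Kq := by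
  refine IsLocalization.ringHom_ext (nonZeroDivisors (Polynomial ℚ)) (Polynomial.ringHom_ext ?_ ?_)
  · intro a
    exact RingHom.congr_fun (Subsingleton.elim
      (((conj.comp conj).comp (algebraMap (Polynomial ℚ) Kq)).comp Polynomial.C)
      ((RingHom.id Kq).comp (algebraMap (Polynomial ℚ) Kq) |>.comp Polynomial.C)) a
  · have h : (algebraMap (Polynomial ℚ) Kq) Polynomial.X = q := RatFunc.algebraMap_X
    simp only [RingHom.comp_apply, h, conj_q, conj_q_inv, RingHom.id_apply]

/-- The bar involution of `Λ^s`. -/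
def bar (n ℓ : ℕ) (hn : 0 < n) (hℓ : 0 < ℓ) (s : ℤ) : Wedge n ℓ s →ₛₗ[conj] Wedge n ℓ s :=
  (relations n ℓ s).liftQ (barFree n ℓ s) (Submodule.span_le.2 (by
    rintro _ ⟨k, i, hk, rfl⟩
    exact barFree_relator hn hℓ k i hk))

theorem bar_ofList (hn : 0 < n) (hℓ : 0 < ℓ) {s : ℤ} {l : List ℤ} (h : IsStable s l) :
    bar n ℓ hn hℓ s (wedge n ℓ (ofList s l)) =
      barFactor n ℓ l • wedge n ℓ (ofList s l.reverse) := by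
  have h1 : bar n ℓ hn hℓ s (wedge n ℓ (ofList s l)) = barFree n ℓ s (Finsupp.single _ 1) :=
    (relations n ℓ s).liftQ_apply _ _
  rw [h1, barFree_single, (stableAt_ofList h).barValue_eq hn hℓ, firstEntries_ofList, barWedge]

theorem isBarInvolution_bar (hn : 0 < n) (hℓ : 0 < ℓ) (s : ℤ) :
    IsBarInvolution n ℓ s (bar n ℓ hn hℓ s) where
  involutive x := by
    obtain ⟨f, rfl⟩ := (relations n ℓ s).mkQ_surjective x
    induction f using Finsupp.induction_linear with
    | zero => simp
    | add f g hf hg => rw [map_add, map_add, map_add, hf, hg]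
    | single k a =>
      obtain ⟨N, hN⟩ := (eventually_stableAt k).exists
      have hconj : conj (conj a) = a := RingHom.congr_fun conj_comp_conj a
      have h1 : bar n ℓ hn hℓ s (bar n ℓ hn hℓ s (wedge n ℓ k)) = wedge n ℓ k := by
        rw [hN.1, bar_ofList hn hℓ hN.2, LinearMap.map_smulₛₗ,
          bar_ofList hn hℓ (hN.2.perm (List.reverse_perm _).symm), smul_smul, List.reverse_reverse,
          barFactor_perm (List.reverse_perm _), conj_barFactor_mul, one_smul]
      rw [single_eq_smul, map_smul, LinearMap.map_smulₛₗ, LinearMap.map_smulₛₗ, hconj]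
      exact congrArg _ h1
  apply_wedge k := by
    filter_upwards [eventually_stableAt k] with N hN
    conv_lhs => rw [hN.1]
    rw [bar_ofList hn hℓ hN.2, pow_kappa, pow_kappa]
    congr 1
    · simp [barFactor, firstEntries, Function.comp_def]
    · conv_rhs => rw [hN.1]
      have := rev_ofList s (firstEntries N k.1)
      rw [length_firstEntries] at this
      rw [this]

end Bar

/-! ### Coefficients of the bar involution -/

section Coefficients

variable {n ℓ : ℕ}

/-- The factors for which `p` fails can be moved to the right end, where they come in decreasing
order, if all the corrections that arise vanish. The lists `B` and `T` collect the
factors treated so far, for which `p` holds and fails, respectively. By `hfree`, the pairs of a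
factor moved and a smaller factor kept contribute nothing to the prefactor. -/
theorem IsStraight.move_all {M : Type*} [AddCommGroup M] [Module Kq M] {F : List ℤ → M}
    (hF : IsStraight n ℓ F) (p : ℤ → Prop) [DecidablePred p]
    (hfree : ∀ a b, ¬ p a → p b → b < a → dPart n ℓ b ≠ dPart n ℓ a ∧ cPart n b ≠ cPart n a)
    (L R B T : List ℤ) (hL : L.Perm (B ++ (R ++ T))) (hR : R.Pairwise (· < ·))
    (hB : ∀ b ∈ B, p b ∧ ∀ a ∈ R, b < a)
    (hz : ∀ w₁ a b w₂, ¬ p a → a < b → L.Perm (w₁ ++ a :: b :: w₂) → ∀ j ∈ corrRange n ℓ a b,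
      F (w₁ ++ corrFst n ℓ a b j :: corrSnd n ℓ a b j :: w₂) = 0) :
    barFactor n ℓ (B ++ R) • F (B ++ (R ++ T)) =
      barFactor n ℓ (B ++ R.filter p) •
        F (B ++ (R.filter p ++ ((R.filter (¬ p ·)).reverse ++ T))) := by
  induction R generalizing B T with
  | nil => simp
  | cons a R ih =>
    rw [List.pairwise_cons] at hR
    by_cases ha : p a
    · have := ih (B ++ [a]) T (by simpa using hL) hR.2 (fun b hb => by
        rcases List.mem_append.1 hb with hb | hb
        · exact ⟨(hB b hb).1, fun a' ha' => (hB b hb).2 a' (List.mem_cons_of_mem _ ha')⟩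
        · rw [List.mem_singleton.1 hb]
          exact ⟨ha, hR.1⟩)
      simp only [List.append_assoc, List.cons_append, List.nil_append] at this
      rw [List.filter_cons_of_pos (by simpa using ha), List.filter_cons_of_neg (by simpa using ha)]
      simpa using this
    · have h1 := hF.move a B R T hR.1 (fun w₁ b w₂ hw j hj => by
        refine hz (B ++ w₁) a b (w₂ ++ T) ha (hR.1 b (by rw [hw]; simp)) (hL.trans ?_) j hj
        rw [hw]
        simp only [List.append_assoc, List.cons_append]
        refine List.Perm.append_left _ ?_
        exact (List.perm_middle (l₁ := w₁)).symm)
      have h2 : moveFactor n ℓ a B = 1 := by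
        rw [moveFactor, List.count_eq_zero_of_not_mem, List.count_eq_zero_of_not_mem, pow_zero,
          pow_zero, one_mul]
        · intro hc
          obtain ⟨b, hb, hab⟩ := List.mem_map.1 hc
          exact (hfree a b ha (hB b hb).1 ((hB b hb).2 a List.mem_cons_self)).2 hab
        · intro hc
          obtain ⟨b, hb, hab⟩ := List.mem_map.1 hc
          exact (hfree a b ha (hB b hb).1 ((hB b hb).2 a List.mem_cons_self)).1 hab
      have h3 := ih B (a :: T) (hL.trans (List.Perm.append_left _ (List.perm_middle (l₁ := R)).symm))
        hR.2 (fun b hb => ⟨(hB b hb).1, fun a' ha' => (hB b hb).2 a' (List.mem_cons_of_mem _ ha')⟩)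
      rw [barFactor_perm List.perm_middle, barFactor_cons, moveFactor_append, h2, one_mul,
        mul_comm, ← smul_smul, List.cons_append, h1, h3,
        List.filter_cons_of_neg (by simpa using ha), List.filter_cons_of_pos (by simpa using ha)]
      simp

/-- Special case: the reversal of all factors, when all corrections vanish. -/
theorem IsStraight.reverse {M : Type*} [AddCommGroup M] [Module Kq M] {F : List ℤ → M}
    (hF : IsStraight n ℓ F) {L : List ℤ} (hL : L.Pairwise (· > ·))
    (hz : ∀ w₁ a b w₂, a < b → L.Perm (w₁ ++ a :: b :: w₂) → ∀ j ∈ corrRange n ℓ a b,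
      F (w₁ ++ corrFst n ℓ a b j :: corrSnd n ℓ a b j :: w₂) = 0) :
    barFactor n ℓ L • F L.reverse = F L := by
  have := hF.move_all (fun _ => False) (fun _ _ _ h => h.elim) L L.reverse [] []
    (by simp) (List.pairwise_reverse.2 hL) (by simp)
    (fun w₁ a b w₂ _ => hz w₁ a b w₂)
  simpa [barFactor_perm (List.reverse_perm L), barFactor_nil] using this

/-- `f` takes the coefficient of `u_{k₀}`. -/
def IsCoord (n ℓ : ℕ) {s : ℤ} (k₀ : P s) (f : Wedge n ℓ s →ₗ[Kq] Kq) : Prop :=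
  StrictAnti k₀.1 ∧ f (wedge n ℓ k₀) = 1 ∧
    ∀ k : P s, StrictAnti k.1 → k ≠ k₀ → f (wedge n ℓ k) = 0

theorem exists_isCoord (hn : 0 < n) (hℓ : 0 < ℓ) {s : ℤ} {k₀ : P s} (h₀ : StrictAnti k₀.1) :
    ∃ f, IsCoord n ℓ k₀ f := by
  obtain ⟨f, hf⟩ := exists_coord hn hℓ k₀ h₀
  exact ⟨f, h₀, by rw [hf _ h₀, if_pos rfl], fun k hk hne => by rw [hf k hk, if_neg hne]⟩

theorem IsCoord.apply_ofList {s : ℤ} {k₀ : P s} {f : Wedge n ℓ s →ₗ[Kq] Kq}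
    (hf : IsCoord n ℓ k₀ f) {l : List ℤ} (h : l.Pairwise (· > ·)) (h' : ∀ x ∈ l, s - l.length < x)
    (hne : l ≠ firstEntries l.length k₀.1) : f (wedge n ℓ (ofList s l)) = 0 :=
  hf.2.2 _ (ofList_strictAnti h h') fun he => hne (by rw [← he, firstEntries_ofList])

theorem Step.weight_le {g : ℤ → ℚ} (hg : ∀ k₂ k₁, k₂ < k₁ → ∀ j ∈ corrRange n ℓ k₂ k₁,
      g (corrFst n ℓ k₂ k₁ j) + g (corrSnd n ℓ k₂ k₁ j) ≤ g k₂ + g k₁) {l l' : List ℤ}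
    (h : Step n ℓ l l') : (l'.map g).sum ≤ (l.map g).sum := by
  cases h with
  | swap pre post k₂ k₁ h =>
    simp only [List.map_append, List.map_cons, List.sum_append, List.sum_cons]
    linarith
  | corr pre post k₂ k₁ j h hj =>
    have := hg k₂ k₁ h j hj
    simp only [List.map_append, List.map_cons, List.sum_append, List.sum_cons]
    linarith

theorem Reach.weight_le {g : ℤ → ℚ} (hg : ∀ k₂ k₁, k₂ < k₁ → ∀ j ∈ corrRange n ℓ k₂ k₁,
      g (corrFst n ℓ k₂ k₁ j) + g (corrSnd n ℓ k₂ k₁ j) ≤ g k₂ + g k₁) {l l' : List ℤ}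
    (h : Reach n ℓ l l') : (l'.map g).sum ≤ (l.map g).sum := by
  induction h with
  | refl => exact le_rfl
  | tail _ h ih => exact (h.weight_le hg).trans ih

/-- Coefficients vanish if a weight that straightening does not increase is too small. -/
theorem IsCoord.eq_zero_of_weight_lt (hn : 0 < n) (hℓ : 0 < ℓ) {s : ℤ} {k₀ : P s}
    {f : Wedge n ℓ s →ₗ[Kq] Kq} (hf : IsCoord n ℓ k₀ f) {g : ℤ → ℚ}
    (hg : ∀ k₂ k₁, k₂ < k₁ → ∀ j ∈ corrRange n ℓ k₂ k₁,
      g (corrFst n ℓ k₂ k₁ j) + g (corrSnd n ℓ k₂ k₁ j) ≤ g k₂ + g k₁) {l : List ℤ} {N : ℕ}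
    (hN : l.length = N) (hl : ∀ x ∈ l, s - N < x)
    (hlt : (l.map g).sum < ((firstEntries N k₀.1).map g).sum) :
    f (wedge n ℓ (ofList s l)) = 0 := by
  obtain ⟨e, he⟩ := exists_expansion hn hℓ l
  have h3 := he.eq_sum ((isStraight_wedge n ℓ s).comp f)
  beta_reduce at h3
  rw [h3]
  refine Finset.sum_eq_zero fun l' hl' => ?_
  beta_reduce
  have hr := he.reach l' hl'
  have hlen : l'.length = N := hr.length_eq.trans hN
  rw [hf.apply_ofList (he.pairwise l' hl') (fun x hx => ?_) (fun hc => ?_), smul_zero]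
  · rw [hlen]
    have := hr.le_of_forall_le hn hℓ (M := s - N + 1) (fun x hx => by have := hl x hx; omega) x hx
    omega
  · have h4 := hr.weight_le hg
    rw [hc, hlen] at h4
    exact absurd hlt h4.not_gt

/-- If a weight that straightening decreases is at least as large for `k₀` as for `l`, then the
coefficient of `u_{k₀}` in the bar image is trivial: the bar involution is unitriangular. -/
theorem IsCoord.bar_of_weight_le (hn : 0 < n) (hℓ : 0 < ℓ) {s : ℤ} {k₀ : P s}
    {f : Wedge n ℓ s →ₗ[Kq] Kq} (hf : IsCoord n ℓ k₀ f) {l : List ℤ} {N : ℕ}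
    (hN : l.length = N) (hl : IsStable s l) (hl' : l.Pairwise (· > ·))
    (hle : (l.map fun k => ((k.natAbs ^ 2 : ℕ) : ℚ)).sum ≤
      ((firstEntries N k₀.1).map fun k => ((k.natAbs ^ 2 : ℕ) : ℚ)).sum) :
    f (bar n ℓ hn hℓ s (wedge n ℓ (ofList s l))) = f (wedge n ℓ (ofList s l)) := by
  subst hN
  have hsq : ∀ k₂ k₁ j, j ∈ corrRange n ℓ k₂ k₁ →
      (((corrFst n ℓ k₂ k₁ j).natAbs ^ 2 : ℕ) : ℚ) + ((corrSnd n ℓ k₂ k₁ j).natAbs ^ 2 : ℕ) <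
        (k₂.natAbs ^ 2 : ℕ) + (k₁.natAbs ^ 2 : ℕ) := by
    intro k₂ k₁ j hj
    have h1 := corr_lt hn hℓ hj
    have h2 := corr_add (n := n) (ℓ := ℓ) k₂ k₁ j
    have h3 : ∀ k : ℤ, ((k.natAbs ^ 2 : ℕ) : ℚ) = ((k ^ 2 : ℤ) : ℚ) := by
      intro k
      simp [Nat.cast_natAbs, sq_abs]
    simp only [h3]
    have h4 : corrSnd n ℓ k₂ k₁ j = k₂ + k₁ - corrFst n ℓ k₂ k₁ j := by omega
    rw [h4]
    norm_cast
    nlinarith [mul_pos (sub_pos.2 h1.1) (sub_pos.2 h1.2)]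
  rw [bar_ofList hn hℓ hl, map_smul]
  refine ((isStraight_wedge n ℓ s).comp f).reverse hl' fun w₁ a b w₂ hab hp j hj => ?_
  have hc := corr_lt hn hℓ hj
  have hadd := corr_add (n := n) (ℓ := ℓ) a b j
  refine hf.eq_zero_of_weight_lt hn hℓ (N := l.length)
    (fun k₂ k₁ _ j hj => (hsq k₂ k₁ j hj).le) ?_ (fun x hx => ?_) (lt_of_lt_of_le ?_ hle)
  · rw [hp.length_eq]; simp
  · have h1 : ∀ y ∈ w₁ ++ a :: b :: w₂, s - l.length < y := fun y hy => hl.1 y (hp.mem_iff.2 hy)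
    have ha := h1 a (by simp)
    simp only [List.mem_append, List.mem_cons] at hx
    rcases hx with hx | rfl | rfl | hx
    · exact h1 x (by simp [hx])
    · omega
    · omega
    · exact h1 x (by simp [hx])
  · rw [(hp.map _).sum_eq]
    have := hsq a b j hj
    simp only [List.map_append, List.map_cons, List.sum_append, List.sum_cons]
    linarith

end Coefficients

section Full

variable {n ℓ : ℕ}

/-- Beads on opposite sides of `T` whose order as integers is reversed differ in both labels. -/
theorem parts_ne_of_xPart_lt (hn : 0 < n) (hℓ : 0 < ℓ) {a b : ℤ} (h : xPart n ℓ a < xPart n ℓ b)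
    (hab : b < a) : dPart n ℓ b ≠ dPart n ℓ a ∧ cPart n b ≠ cPart n a := by
  rw [lt_iff_parts hn hℓ] at hab
  have h1 := cPart_mem hn a
  have h2 := cPart_mem hn b
  unfold xPart at h
  rcases hab with hm | ⟨hm, hd⟩
  · exfalso
    have : (n : ℤ) * (mPart n ℓ b - mPart n ℓ a - 1) ≥ 0 :=
      mul_nonneg (by positivity) (by omega)
    nlinarith
  · rw [hm] at h
    omega

/-- The weight by which a bead at a position `x ≤ T` counts. With the base `1 / 3`, two beads above
`k₂` weigh together less than a bead at `k₂`, so that every correction to `u_{k₂} ∧ u_{k₁}` with `k₂`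
at a position `x ≤ T` loses weight. -/
def lowWeight (n ℓ : ℕ) (T k : ℤ) : ℚ := if xPart n ℓ k ≤ T then (1 / 3 : ℚ) ^ k else 0

theorem lowWeight_corr (hn : 0 < n) (hℓ : 0 < ℓ) (T : ℤ) {k₂ k₁ j : ℤ}
    (hj : j ∈ corrRange n ℓ k₂ k₁) :
    lowWeight n ℓ T (corrFst n ℓ k₂ k₁ j) + lowWeight n ℓ T (corrSnd n ℓ k₂ k₁ j) ≤
      lowWeight n ℓ T k₂ + lowWeight n ℓ T k₁ ∧ (xPart n ℓ k₂ ≤ T →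
    lowWeight n ℓ T (corrFst n ℓ k₂ k₁ j) + lowWeight n ℓ T (corrSnd n ℓ k₂ k₁ j) <
      lowWeight n ℓ T k₂ + lowWeight n ℓ T k₁) := by
  have h1 := corr_lt hn hℓ hj
  have h2 := corr_add (n := n) (ℓ := ℓ) k₂ k₁ j
  have h3 := corr_xPart hn hℓ hj
  have h4 := corr_xPart_add hn hℓ k₂ k₁ j
  have hpos : ∀ k : ℤ, (0 : ℚ) < (1 / 3) ^ k := fun k => by positivity
  have hnn : ∀ k, 0 ≤ lowWeight n ℓ T k := fun k => by
    unfold lowWeight; split_ifs; exacts [(hpos k).le, le_rfl]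
  by_cases hx : xPart n ℓ k₂ ≤ T
  · have h5 : ∀ k, k₂ < k → lowWeight n ℓ T k ≤ (1 / 3) ^ k₂ * (1 / 3) := by
      intro k hk
      unfold lowWeight
      split_ifs
      · rw [← zpow_add_one₀ (by norm_num)]
        exact (zpow_le_zpow_iff_right_of_lt_one₀ (by norm_num) (by norm_num)).2 hk
      · have := hpos k₂
        positivity
    have h6 : lowWeight n ℓ T k₂ = (1 / 3) ^ k₂ := if_pos hx
    have h7 : lowWeight n ℓ T (corrFst n ℓ k₂ k₁ j) + lowWeight n ℓ T (corrSnd n ℓ k₂ k₁ j) <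
        lowWeight n ℓ T k₂ + lowWeight n ℓ T k₁ := by
      have a1 := h5 _ h1.1
      have a2 := h5 (corrSnd n ℓ k₂ k₁ j) (by omega)
      have a3 := hnn k₁
      have a4 := hpos k₂
      linarith
    exact ⟨h7.le, fun _ => h7⟩
  · have h5 : ∀ k, xPart n ℓ k₂ ≤ xPart n ℓ k → lowWeight n ℓ T k = 0 := fun k hk =>
      if_neg (by omega)
    rw [h5 _ h3.1, h5 (corrSnd n ℓ k₂ k₁ j) (by omega), h5 k₂ le_rfl, h5 k₁ (by omega)]
    exact ⟨le_rfl, fun h => absurd h hx⟩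

/-- `M` contains all the beads at positions `x ≤ T` above `b`. -/
def IsFull (n ℓ : ℕ) (T b : ℤ) (M : List ℤ) : Prop := ∀ k, b < k → xPart n ℓ k ≤ T → k ∈ M

theorem sum_lowWeight (T : ℤ) {L : List ℤ} (hL : L.Pairwise (· > ·)) :
    (L.map (lowWeight n ℓ T)).sum =
      ∑ k ∈ L.toFinset with xPart n ℓ k ≤ T, (1 / 3 : ℚ) ^ k := by
  rw [Finset.sum_filter, List.sum_toFinset _ (hL.imp fun h => h.ne')]
  rfl

theorem sum_lowWeight_le {T b : ℤ} {L M : List ℤ} (hL : L.Pairwise (· > ·))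
    (hM : M.Pairwise (· > ·)) (hLb : ∀ x ∈ L, b < x) (hfull : IsFull n ℓ T b M) :
    (L.map (lowWeight n ℓ T)).sum ≤ (M.map (lowWeight n ℓ T)).sum := by
  rw [sum_lowWeight T hL, sum_lowWeight T hM]
  refine Finset.sum_le_sum_of_subset_of_nonneg (fun k hk => ?_) fun k _ _ => by positivity
  rw [Finset.mem_filter, List.mem_toFinset] at hk ⊢
  exact ⟨hfull k (hLb k hk.1) hk.2, hk.2⟩

theorem sum_lowWeight_lt {T b : ℤ} {L M : List ℤ} (hL : L.Pairwise (· > ·))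
    (hM : M.Pairwise (· > ·)) (hLb : ∀ x ∈ L, b < x) (hfull : IsFull n ℓ T b M)
    (hnot : ¬ IsFull n ℓ T b L) :
    (L.map (lowWeight n ℓ T)).sum < (M.map (lowWeight n ℓ T)).sum := by
  rw [sum_lowWeight T hL, sum_lowWeight T hM]
  unfold IsFull at hnot
  push Not at hnot
  obtain ⟨k, h1, h2, h3⟩ := hnot
  refine Finset.sum_lt_sum_of_subset (i := k) (fun k hk => ?_) ?_ ?_ (by positivity)
    fun k _ _ => by positivity
  · rw [Finset.mem_filter, List.mem_toFinset] at hk ⊢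
    exact ⟨hfull k (hLb k hk.1) hk.2, hk.2⟩
  · rw [Finset.mem_filter, List.mem_toFinset]
    exact ⟨hfull k h1 h2, h2⟩
  · rw [Finset.mem_filter, List.mem_toFinset]
    exact fun h => h3 h.1

theorem Step.xPart_le (hn : 0 < n) (hℓ : 0 < ℓ) {l l' : List ℤ} (h : Step n ℓ l l') {T : ℤ}
    (hT : ∀ x ∈ l, T < xPart n ℓ x) : ∀ x ∈ l', T < xPart n ℓ x := by
  cases h with
  | swap pre post k₂ k₁ h =>
    intro x hx
    refine hT x ?_
    simp only [List.mem_append, List.mem_cons] at hx ⊢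
    tauto
  | corr pre post k₂ k₁ j h hj =>
    have h1 := corr_xPart hn hℓ hj
    have h2 := corr_xPart_add hn hℓ k₂ k₁ j
    have h3 := hT k₂ (by simp)
    intro x hx
    simp only [List.mem_append, List.mem_cons] at hx
    rcases hx with hx | rfl | rfl | hx
    · exact hT x (by simp [hx])
    · omega
    · omega
    · exact hT x (by simp [hx])

theorem Reach.xPart_le (hn : 0 < n) (hℓ : 0 < ℓ) {l l' : List ℤ} (h : Reach n ℓ l l') {T : ℤ}
    (hT : ∀ x ∈ l, T < xPart n ℓ x) : ∀ x ∈ l', T < xPart n ℓ x := by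
  induction h with
  | refl => exact hT
  | tail _ h ih => exact h.xPart_le hn hℓ ih

/-- A factor `u_a` commutes with larger factors at smaller positions. -/
theorem IsStraight.orderedInsert (hn : 0 < n) (hℓ : 0 < ℓ) {M : Type*} [AddCommGroup M]
    [Module Kq M] {F : List ℤ → M} (hF : IsStraight n ℓ F) (a : ℤ) (pre W : List ℤ)
    (hW : ∀ b ∈ W, a < b → xPart n ℓ b < xPart n ℓ a) :
    F (pre ++ a :: W) = F (pre ++ W.orderedInsert (· ≥ ·) a) := by
  induction W generalizing pre with
  | nil => rfl
  | cons b W ih =>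
    rw [List.orderedInsert]
    split_ifs with hab
    · rfl
    · have hab' : a < b := not_le.1 hab
      have hx := hW b List.mem_cons_self hab'
      obtain ⟨h1, h2⟩ := parts_ne_of_xPart_lt hn hℓ hx hab'
      have h3 : corrRange n ℓ a b = ∅ := by
        refine Finset.eq_empty_of_forall_notMem fun j hj => ?_
        have := corr_xPart hn hℓ hj
        omega
      have h4 := ih (pre ++ [b]) fun b' hb' => hW b' (List.mem_cons_of_mem _ hb')
      simp only [List.append_assoc, List.cons_append, List.nil_append] at h4
      rw [hF pre W a b hab'.le, h3, Finset.sum_empty, smul_zero, add_zero, dFactor, cFactor,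
        if_neg (Ne.symm h1), if_neg (Ne.symm h2), one_smul, one_smul, h4]

theorem IsStraight.foldr_orderedInsert (hn : 0 < n) (hℓ : 0 < ℓ) {M : Type*} [AddCommGroup M]
    [Module Kq M] {F : List ℤ → M} (hF : IsStraight n ℓ F) {T : ℤ} (pre C W : List ℤ)
    (hC : C.Pairwise (· > ·)) (hCT : ∀ x ∈ C, T < xPart n ℓ x)
    (hWT : ∀ x ∈ W, xPart n ℓ x ≤ T) :
    F (pre ++ (C ++ W)) = F (pre ++ C.foldr (List.orderedInsert (· ≥ ·)) W) := by
  induction C generalizing pre with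
  | nil => rfl
  | cons a C ih =>
    rw [List.pairwise_cons] at hC
    have h1 := ih (pre ++ [a]) hC.2 fun x hx => hCT x (List.mem_cons_of_mem _ hx)
    simp only [List.append_assoc, List.cons_append, List.nil_append] at h1
    rw [List.cons_append, h1, List.foldr_cons]
    refine hF.orderedInsert hn hℓ a pre _ fun b hb hab => ?_
    have hmem : b ∈ C ∨ b ∈ W := by
      clear h1 ih hC hCT
      induction C with
      | nil => exact Or.inr hb
      | cons c C ih =>
        rw [List.foldr_cons, List.mem_orderedInsert] at hb
        rcases hb with rfl | hb
        · exact Or.inl List.mem_cons_self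
        · exact (ih hb).imp_left (List.mem_cons_of_mem _)
    rcases hmem with hb | hb
    · exact absurd (hC.1 b hb) hab.not_gt
    · exact (hWT b hb).trans_lt (hCT a List.mem_cons_self)

theorem foldr_orderedInsert_perm (C W : List ℤ) :
    (C.foldr (List.orderedInsert (· ≥ ·)) W).Perm (C ++ W) := by
  induction C with
  | nil => exact List.Perm.refl _
  | cons a C ih =>
    rw [List.foldr_cons]
    exact (List.perm_orderedInsert _ _ _).trans (ih.cons a)

theorem foldr_orderedInsert_pairwise (C : List ℤ) {W : List ℤ} (hW : W.Pairwise (· ≥ ·)) :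
    (C.foldr (List.orderedInsert (· ≥ ·)) W).Pairwise (· ≥ ·) := by
  induction C with
  | nil => exact hW
  | cons a C ih => exact ih.orderedInsert _ _

theorem eq_of_perm_of_pairwise {L L' : List ℤ} (hp : L.Perm L') (hL : L.Pairwise (· > ·))
    (hL' : L'.Pairwise (· > ·)) : L = L' :=
  hp.eq_of_pairwise (fun _ _ _ _ h h' => absurd h h'.not_gt) hL hL'

theorem eq_of_mem_iff_of_pairwise {L L' : List ℤ} (hp : ∀ x, x ∈ L ↔ x ∈ L')
    (hL : L.Pairwise (· > ·)) (hL' : L'.Pairwise (· > ·)) : L = L' :=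
  eq_of_perm_of_pairwise ((List.perm_ext_iff_of_nodup (hL.imp fun h => h.ne')
    (hL'.imp fun h => h.ne')).2 hp) hL hL'

/-- The beads of a list at positions `x > T`. -/
def high (n ℓ : ℕ) (T : ℤ) (L : List ℤ) : List ℤ := L.filter (T < xPart n ℓ ·)

/-- The beads of a list at positions `x ≤ T`. -/
def low (n ℓ : ℕ) (T : ℤ) (L : List ℤ) : List ℤ := L.filter (¬ T < xPart n ℓ ·)

theorem mem_high {T x : ℤ} {L : List ℤ} : x ∈ high n ℓ T L ↔ x ∈ L ∧ T < xPart n ℓ x := by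
  simp [high]

theorem mem_low {T x : ℤ} {L : List ℤ} : x ∈ low n ℓ T L ↔ x ∈ L ∧ xPart n ℓ x ≤ T := by
  simp [low]

theorem high_append_low_perm (T : ℤ) (L : List ℤ) :
    (high n ℓ T L ++ low n ℓ T L).Perm L := by
  have := List.filter_append_perm (fun x => decide (T < xPart n ℓ x)) L
  simpa only [high, low, decide_not] using this

/-- The coefficient at `u_{k₀}` of a wedge whose factors are the beads at positions `x > T`,
followed by all the beads at positions `x ≤ T`. -/
theorem IsCoord.apply_append_low (hn : 0 < n) (hℓ : 0 < ℓ) {s T : ℤ} {k₀ : P s}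
    {f : Wedge n ℓ s →ₗ[Kq] Kq} (hf : IsCoord n ℓ k₀ f) {M : List ℤ}
    (hM : M.Pairwise (· > ·)) (hMs : ∀ x ∈ M, s - M.length < x) (hk₀ : k₀ = ofList s M)
    {C : List ℤ} (hC : C.Pairwise (· > ·)) (hCT : ∀ x ∈ C, T < xPart n ℓ x)
    (hlen : C.length = (high n ℓ T M).length) (hCs : ∀ x ∈ C, s - M.length < x) :
    f (wedge n ℓ (ofList s (C ++ low n ℓ T M))) = if C = high n ℓ T M then 1 else 0 := by
  have hF := (isStraight_wedge n ℓ s).comp f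
  have hlow : ∀ x ∈ low n ℓ T M, xPart n ℓ x ≤ T := fun x hx => (mem_low.1 hx).2
  have hlowp : (low n ℓ T M).Pairwise (· > ·) := hM.filter _
  have h1 := hF.foldr_orderedInsert hn hℓ [] C (low n ℓ T M) hC hCT hlow
  simp only [List.nil_append] at h1
  rw [h1]
  have hperm := foldr_orderedInsert_perm C (low n ℓ T M)
  have hnd : (C ++ low n ℓ T M).Nodup := by
    rw [List.nodup_append]
    refine ⟨hC.imp fun h => h.ne', hlowp.imp fun h => h.ne', fun a ha b hb hab => ?_⟩
    have := hCT a ha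
    have := hlow b hb
    rw [hab] at *
    omega
  have hsort : (C.foldr (List.orderedInsert (· ≥ ·)) (low n ℓ T M)).Pairwise (· > ·) := by
    have a1 := foldr_orderedInsert_pairwise C (hlowp.imp fun h => le_of_lt h)
    have a2 : (C.foldr (List.orderedInsert (· ≥ ·)) (low n ℓ T M)).Nodup := hperm.nodup_iff.2 hnd
    exact (a1.and a2).imp fun h => lt_of_le_of_ne h.1 h.2.symm
  generalize C.foldr (List.orderedInsert (· ≥ ·)) (low n ℓ T M) = S at hperm hsort
  have hSlen : S.length = M.length := by
    rw [hperm.length_eq, List.length_append, hlen, ← List.length_append,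
      (high_append_low_perm T M).length_eq]
  split_ifs with hCM
  · rw [hCM] at hperm
    have : S = M := eq_of_perm_of_pairwise (hperm.trans (high_append_low_perm T M)) hsort hM
    rw [this, ← hk₀]
    exact hf.2.1
  · refine hf.apply_ofList hsort (fun x hx => ?_) fun hS => hCM ?_
    · rw [hSlen]
      rcases List.mem_append.1 (hperm.mem_iff.1 hx) with hx | hx
      · exact hCs x hx
      · exact hMs x (mem_low.1 hx).1
    · rw [hSlen, hk₀, firstEntries_ofList] at hS
      refine eq_of_mem_iff_of_pairwise (fun x => ?_) hC (hM.filter _)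
      rw [← hS, mem_high, hperm.mem_iff, List.mem_append]
      constructor
      · exact fun hx => ⟨Or.inl hx, hCT x hx⟩
      · rintro ⟨hx | hx, h⟩
        · exact hx
        · exact absurd (hlow x hx) h.not_ge

theorem low_eq_of_isFull {b T : ℤ} {L M : List ℤ} (hL : L.Pairwise (· > ·))
    (hM : M.Pairwise (· > ·)) (hLb : ∀ x ∈ L, b < x) (hMb : ∀ x ∈ M, b < x)
    (hLf : IsFull n ℓ T b L) (hMf : IsFull n ℓ T b M) : low n ℓ T L = low n ℓ T M := by
  refine eq_of_mem_iff_of_pairwise (fun x => ?_) (hL.filter _) (hM.filter _)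
  rw [mem_low, mem_low]
  exact ⟨fun h => ⟨hMf x (hLb x h.1) h.2, h.2⟩, fun h => ⟨hLf x (hMb x h.1) h.2, h.2⟩⟩

/-- For configurations that are full up to `T`, the coefficients of the bar involution depend on
the beads at positions `x > T` only. -/
theorem IsCoord.bar_of_isFull (hn : 0 < n) (hℓ : 0 < ℓ) {s T : ℤ} {k₀ : P s}
    {f : Wedge n ℓ s →ₗ[Kq] Kq} (hf : IsCoord n ℓ k₀ f) {L M : List ℤ}
    (hL : L.Pairwise (· > ·)) (hM : M.Pairwise (· > ·)) (hLs : IsStable s L)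
    (hMs : ∀ x ∈ M, s - M.length < x) (hlen : L.length = M.length) (hk₀ : k₀ = ofList s M)
    (hMf : IsFull n ℓ T (s - M.length) M) (hLf : IsFull n ℓ T (s - M.length) L)
    {e : List ℤ →₀ Kq} (he : IsExpansion n ℓ (high n ℓ T L).reverse e) :
    f (bar n ℓ hn hℓ s (wedge n ℓ (ofList s L))) =
      barFactor n ℓ (high n ℓ T L) * e (high n ℓ T M) := by
  have hF := (isStraight_wedge n ℓ s).comp f
  have hLb : ∀ x ∈ L, s - M.length < x := by rw [← hlen]; exact hLs.1
  have hlow := low_eq_of_isFull hL hM hLb hMs hLf hMf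
  have hlenh : (high n ℓ T L).length = (high n ℓ T M).length := by
    have h1 := (high_append_low_perm (n := n) (ℓ := ℓ) T L).length_eq
    have h2 := (high_append_low_perm (n := n) (ℓ := ℓ) T M).length_eq
    rw [List.length_append] at h1 h2
    rw [hlow] at h1
    omega
  have h1 := hF.move_all (T < xPart n ℓ ·)
    (fun a b ha hb hba => parts_ne_of_xPart_lt hn hℓ (by omega) hba) L L.reverse [] []
    (by simp) (List.pairwise_reverse.2 hL) (by simp)
    (fun w₁ a b w₂ ha hab hp j hj => by
      have hc := corr_lt hn hℓ hj
      have hadd := corr_add (n := n) (ℓ := ℓ) a b j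
      refine hf.eq_zero_of_weight_lt hn hℓ (g := lowWeight n ℓ T) (N := M.length)
        (fun k₂ k₁ _ j hj => (lowWeight_corr hn hℓ T hj).1) ?_ (fun x hx => ?_) ?_
      · rw [← hlen, hp.length_eq]; simp
      · have h1 : ∀ y ∈ w₁ ++ a :: b :: w₂, s - M.length < y :=
          fun y hy => hLb y (hp.mem_iff.2 hy)
        have ha := h1 a (by simp)
        simp only [List.mem_append, List.mem_cons] at hx
        rcases hx with hx | rfl | rfl | hx
        · exact h1 x (by simp [hx])
        · omega
        · omega
        · exact h1 x (by simp [hx])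
      · rw [hk₀, firstEntries_ofList]
        refine lt_of_lt_of_le ?_ (sum_lowWeight_le hL hM hLb hMf)
        rw [(hp.map _).sum_eq]
        have := (lowWeight_corr hn hℓ T hj).2 (not_lt.1 ha)
        simp only [List.map_append, List.map_cons, List.sum_append, List.sum_cons]
        linarith)
  simp only [List.nil_append, List.append_nil, List.filter_reverse, List.reverse_reverse,
    barFactor_perm (List.reverse_perm _)] at h1
  rw [bar_ofList hn hℓ hLs, map_smul]
  refine h1.trans ?_
  rw [smul_eq_mul]
  congr 1
  change f (wedge n ℓ (ofList s ((high n ℓ T L).reverse ++ low n ℓ T L))) = _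
  have h2 := he.eq_sum (hF.append [] (low n ℓ T L))
  simp only [List.nil_append] at h2
  rw [h2, hlow]
  have h3 : ∀ C ∈ e.support, f (wedge n ℓ (ofList s (C ++ low n ℓ T M))) =
      if C = high n ℓ T M then 1 else 0 := by
    intro C hC
    have hr := he.reach C hC
    refine hf.apply_append_low hn hℓ hM hMs hk₀ (he.pairwise C hC) ?_ ?_ ?_
    · exact hr.xPart_le hn hℓ fun x hx => (mem_high.1 (List.mem_reverse.1 hx)).2
    · rw [hr.length_eq, List.length_reverse, hlenh]
    · intro x hx
      have := hr.le_of_forall_le hn hℓ (M := s - M.length + 1) (fun x hx => by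
        have := hLb x (mem_high.1 (List.mem_reverse.1 hx)).1
        omega) x hx
      omega
  rw [Finsupp.sum, Finset.sum_congr rfl fun C hC => by rw [h3 C hC]]
  simp only [smul_eq_mul, mul_ite, mul_one, mul_zero]
  rw [Finset.sum_ite_eq']
  split_ifs with h
  · rfl
  · exact (Finsupp.notMem_support_iff.1 h).symm

/-- If `M` is full up to `T` and `L` is not, then `u_{k₀}` does not occur in the bar image. -/
theorem IsCoord.bar_of_not_isFull (hn : 0 < n) (hℓ : 0 < ℓ) {s T : ℤ} {k₀ : P s}
    {f : Wedge n ℓ s →ₗ[Kq] Kq} (hf : IsCoord n ℓ k₀ f) {L M : List ℤ}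
    (hL : L.Pairwise (· > ·)) (hM : M.Pairwise (· > ·)) (hLs : IsStable s L)
    (hlen : L.length = M.length) (hk₀ : k₀ = ofList s M)
    (hMf : IsFull n ℓ T (s - M.length) M) (hLf : ¬ IsFull n ℓ T (s - M.length) L) :
    f (bar n ℓ hn hℓ s (wedge n ℓ (ofList s L))) = 0 := by
  have hLb : ∀ x ∈ L, s - M.length < x := by rw [← hlen]; exact hLs.1
  rw [bar_ofList hn hℓ hLs, map_smul, hf.eq_zero_of_weight_lt hn hℓ (g := lowWeight n ℓ T)
    (N := M.length) (fun k₂ k₁ _ j hj => (lowWeight_corr hn hℓ T hj).1) (by simpa using hlen)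
    (fun x hx => hLb x (List.mem_reverse.1 hx)), smul_zero]
  rw [hk₀, firstEntries_ofList, List.map_reverse, List.sum_reverse]
  exact sum_lowWeight_lt hL hM hLb hMf hLf

end Full

/-! ### Multipartitions and bead configurations -/

section Beads

variable {n ℓ : ℕ}

theorem xPart_pos (hn : 0 < n) (d : Fin ℓ) (x : ℤ) : xPart n ℓ (pos n ℓ d x) = x := by
  have := Int.emod_add_mul_ediv (x - 1) n
  rw [xPart, cPart_pos, mPart_pos hn, cPart]
  linarith

theorem exists_eq_pos (hn : 0 < n) (hℓ : 0 < ℓ) (k : ℤ) :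
    ∃ d : Fin ℓ, k = pos n ℓ d (xPart n ℓ k) := by
  obtain ⟨d, x, rfl⟩ := exists_pos_eq hn hℓ k
  exact ⟨d, by rw [xPart_pos hn]⟩

theorem rowLen_eq_zero_of_colLen_le {Y : YoungDiagram} {r : ℕ} (h : Y.colLen 0 ≤ r) :
    Y.rowLen r = 0 := by
  by_contra hc
  have h1 : (r, 0) ∈ Y := YoungDiagram.mem_iff_lt_rowLen.2 (Nat.pos_of_ne_zero hc)
  have h2 := YoungDiagram.mem_iff_lt_colLen.1 h1
  omega

theorem colLen_le_of_rowLen_eq_zero {Y : YoungDiagram} {r : ℕ} (h : Y.rowLen r = 0) :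
    Y.colLen 0 ≤ r := by
  by_contra hc
  have h1 : (r, 0) ∈ Y := YoungDiagram.mem_iff_lt_colLen.2 (by omega)
  have h2 := YoungDiagram.mem_iff_lt_rowLen.1 h1
  omega

theorem ext_rowLen {Y Y' : YoungDiagram} (h : ∀ r, Y.rowLen r = Y'.rowLen r) : Y = Y' := by
  ext ⟨i, j⟩
  rw [YoungDiagram.mem_cells, YoungDiagram.mem_cells, YoungDiagram.mem_iff_lt_rowLen,
    YoungDiagram.mem_iff_lt_rowLen, h]

theorem card_eq_sum_rowLen (Y : YoungDiagram) {p : ℕ} (h : Y.colLen 0 ≤ p) :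
    Y.card = ∑ r ∈ Finset.range p, Y.rowLen r := by
  have h1 : Y.cells = (Finset.range p).biUnion fun r =>
      (Finset.range (Y.rowLen r)).image fun j => (r, j) := by
    ext ⟨i, j⟩
    simp only [YoungDiagram.mem_cells, YoungDiagram.mem_iff_lt_rowLen, Finset.mem_biUnion,
      Finset.mem_range, Finset.mem_image, Prod.mk.injEq]
    constructor
    · intro hj
      refine ⟨i, ?_, j, hj, rfl, rfl⟩
      by_contra hc
      rw [rowLen_eq_zero_of_colLen_le (by omega)] at hj
      omega
    · rintro ⟨i', _, j', h, rfl, rfl⟩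
      exact h
  rw [YoungDiagram.card, h1, Finset.card_biUnion]
  · refine Finset.sum_congr rfl fun r _ => ?_
    rw [Finset.card_image_of_injective _ (Prod.mk_right_injective r), Finset.card_range]
  · intro r _ r' _ hr
    rw [Function.onFun, Finset.disjoint_left]
    intro x hx hx'
    obtain ⟨_, _, rfl⟩ := Finset.mem_image.1 hx
    obtain ⟨_, _, h⟩ := Finset.mem_image.1 hx'
    exact hr (Prod.mk.inj h).1.symm

theorem exists_youngDiagram {row : ℕ → ℕ} (h : Antitone row) {p : ℕ}
    (hp : ∀ r, p ≤ r → row r = 0) : ∃ Y : YoungDiagram, ∀ r, Y.rowLen r = row r := by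
  let Y : YoungDiagram :=
    { cells := (Finset.range p).biUnion fun r => (Finset.range (row r)).image fun j => (r, j)
      isLowerSet := by
        rintro ⟨i, j⟩ ⟨i', j'⟩ hle hm
        simp only [Finset.coe_biUnion, Set.mem_iUnion, Finset.mem_coe, Finset.mem_image,
          Finset.mem_range, Prod.mk.injEq] at hm ⊢
        obtain ⟨a, h1, b, h2, rfl, rfl⟩ := hm
        have h3 : i' ≤ a := hle.1
        have h4 : j' ≤ b := hle.2
        have h5 : row a ≤ row i' := h h3
        exact ⟨i', by omega, j', by omega, rfl, rfl⟩ }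
  refine ⟨Y, fun r => eq_of_forall_lt_iff fun j => ?_⟩
  rw [← YoungDiagram.mem_iff_lt_rowLen, ← YoungDiagram.mem_cells]
  simp only [Y, Finset.mem_biUnion, Finset.mem_image, Finset.mem_range, Prod.mk.injEq]
  constructor
  · rintro ⟨_, _, _, h2, rfl, rfl⟩
    exact h2
  · intro hj
    refine ⟨r, ?_, j, hj, rfl, rfl⟩
    by_contra hc
    rw [hp r (by omega)] at hj
    omega

theorem bead_strictAnti (Y : YoungDiagram) (s : ℤ) :
    StrictAnti fun r : ℕ => (Y.rowLen r + s - r : ℤ) := by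
  refine strictAnti_nat_of_succ_lt fun r => ?_
  have := Y.rowLen_anti r (r + 1) (Nat.le_succ r)
  push_cast
  omega

/-- A large number of leading entries: with `∑ s + n ℓ M` of them one sees, on each abacus, the
beads at the positions `x > - n M`. -/
def numEntries (n : ℕ) {ℓ : ℕ} (s : Fin ℓ → ℤ) (M : ℕ) : ℕ := (∑ d, s d + n * ℓ * M).toNat

/-- `l` lists in decreasing order the beads of `|lam; s⟩` at positions `x > -n M`, and all other
positions are filled. -/
structure IsBeadList (n : ℕ) {ℓ : ℕ} (s : Fin ℓ → ℤ) (M : ℕ) (lam : MultiPartition ℓ)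
    (l : List ℤ) : Prop where
  colLen_le : ∀ d, ((lam d).colLen 0 : ℤ) ≤ s d + n * M
  pairwise : l.Pairwise (· > ·)
  mem_iff : ∀ k, k ∈ l ↔ k ∈ beads n lam s ∧ -(n * ℓ * M : ℤ) < k

variable {s : Fin ℓ → ℤ} {M : ℕ} {lam : MultiPartition ℓ} {l : List ℤ}

theorem IsBeadList.sum_eq (hn : 0 < n) (h : IsBeadList n s M lam l) {A : Type*} [AddCommMonoid A]
    (g : ℤ → A) : (l.map g).sum = ∑ d : Fin ℓ, ∑ r ∈ Finset.range (s d + n * M).toNat,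
      g (pos n ℓ d ((lam d).rowLen r + s d - r)) := by
  have h1 : ∀ d, 0 ≤ s d + n * M := fun d => (Int.natCast_nonneg _).trans (h.colLen_le d)
  rw [← List.sum_toFinset _ (h.pairwise.imp fun h => h.ne'), Finset.sum_sigma']
  refine (Finset.sum_bij (fun p _ => pos n ℓ p.1 ((lam p.1).rowLen p.2 + s p.1 - p.2))
    ?_ ?_ ?_ ?_).symm
  · rintro ⟨d, r⟩ hp
    have hr := Finset.mem_range.1 (Finset.mem_sigma.1 hp).2
    rw [List.mem_toFinset, h.mem_iff, lt_pos_iff hn]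
    refine ⟨⟨d, r, rfl⟩, ?_⟩
    dsimp only at hr ⊢
    omega
  · rintro ⟨d, r⟩ _ ⟨d', r'⟩ _ he
    obtain ⟨h2, h3⟩ := pos_inj hn he
    dsimp only at h2 h3
    subst h2
    rw [(bead_strictAnti (lam d) (s d)).injective h3]
  · intro k hk
    rw [List.mem_toFinset, h.mem_iff] at hk
    obtain ⟨⟨d, r, rfl⟩, hlt⟩ := hk
    rw [lt_pos_iff hn] at hlt
    refine ⟨⟨d, r⟩, Finset.mem_sigma.2 ⟨Finset.mem_univ _, Finset.mem_range.2 ?_⟩, rfl⟩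
    by_contra hc
    have h2 := h.colLen_le d
    have h3 := h1 d
    dsimp only at hc
    rw [rowLen_eq_zero_of_colLen_le (by omega)] at hlt
    push_cast at hlt
    omega
  · intro p _
    rfl

theorem IsBeadList.length_eq (hn : 0 < n) (h : IsBeadList n s M lam l) :
    (l.length : ℤ) = ∑ d, s d + n * ℓ * M := by
  have h1 : ∀ d, 0 ≤ s d + n * M := fun d => (Int.natCast_nonneg _).trans (h.colLen_le d)
  have h2 := h.sum_eq hn fun _ => (1 : ℤ)
  simp only [List.map_const', List.sum_replicate, Finset.sum_const, Finset.card_range, nsmul_eq_mul,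
    mul_one, Int.toNat_of_nonneg (h1 _), Finset.sum_add_distrib, Finset.card_univ,
    Fintype.card_fin] at h2
  rw [h2]; ring

theorem IsBeadList.sum_xPart (hn : 0 < n) (h : IsBeadList n s M lam l) :
    (l.map (xPart n ℓ)).sum = size lam +
      ∑ d, ∑ r ∈ Finset.range (s d + n * M).toNat, (s d - r : ℤ) := by
  have h1 : ∀ d, 0 ≤ s d + n * M := fun d => (Int.natCast_nonneg _).trans (h.colLen_le d)
  rw [h.sum_eq hn, size, Nat.cast_sum, ← Finset.sum_add_distrib]
  refine Finset.sum_congr rfl fun d _ => ?_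
  have h2 := h.colLen_le d
  rw [card_eq_sum_rowLen (lam d) (p := (s d + n * M).toNat) (by omega), Nat.cast_sum,
    ← Finset.sum_add_distrib]
  refine Finset.sum_congr rfl fun r _ => ?_
  rw [xPart_pos hn]; ring

theorem IsBeadList.count_dPart (hn : 0 < n) (h : IsBeadList n s M lam l) (d : Fin ℓ) :
    ((l.map (dPart n ℓ)).count ((d : ℕ) + 1 : ℤ)) = (s d + n * M).toNat := by
  have h2 := h.sum_eq hn fun k => if dPart n ℓ k = (d : ℕ) + 1 then 1 else 0
  simp only [dPart_pos hn] at h2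
  rw [Finset.sum_eq_single d] at h2
  · simp only [if_true, Finset.sum_const, Finset.card_range, smul_eq_mul, mul_one] at h2
    rw [← h2]
    clear h2 h
    induction l with
    | nil => rfl
    | cons a l ih =>
      simp only [List.map_cons, List.count_cons, List.sum_cons, ih, beq_iff_eq]
      omega
  · intro d' _ hd
    refine Finset.sum_eq_zero fun r _ => if_neg fun hc => hd (Fin.ext ?_)
    omega
  · exact fun hc => absurd (Finset.mem_univ d) hc

theorem beads_le_iff (hn : 0 < n) (hℓ : 0 < ℓ)
    (h : ∀ d, ((lam d).colLen 0 : ℤ) ≤ s d + n * M) {k : ℤ} (hk : k ≤ -(n * ℓ * M : ℤ)) :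
    k ∈ beads n lam s := by
  obtain ⟨d, x, rfl⟩ := exists_pos_eq hn hℓ k
  rw [← not_lt, lt_pos_iff hn, not_lt] at hk
  have := h d
  refine ⟨d, (s d - x).toNat, ?_⟩
  rw [rowLen_eq_zero_of_colLen_le (by omega)]
  congr 1
  push_cast
  omega

/-- A bead list determines the sequence `k` with `|lam; s⟩ = u_k`. -/
theorem IsBeadList.enum_eq [NeZero n] [NeZero ℓ] (h : IsBeadList n s M lam l) :
    enum n lam s = ofList (∑ d, s d) l := by
  have hn := NeZero.pos n
  have hlen := h.length_eq hn
  have h1 : StrictAnti (ofList (∑ d, s d) l).1 := ofList_strictAnti h.pairwise fun x hx => by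
    have := ((h.mem_iff x).1 hx).2
    linarith
  have h2 : Set.range (ofList (∑ d, s d) l).1 = Set.range (enum n lam s).1 := by
    rw [range_enum]
    ext k
    constructor
    · rintro ⟨i, rfl⟩
      rw [ofList_apply]
      by_cases hi : i < l.length
      · rw [List.getD_eq_getElem _ _ hi]
        exact ((h.mem_iff _).1 (List.getElem_mem hi)).1
      · rw [List.getD_eq_default _ _ (by omega)]
        exact beads_le_iff hn (NeZero.pos ℓ) h.colLen_le (by omega)
    · intro hk
      by_cases hlt : -(n * ℓ * M : ℤ) < k
      · obtain ⟨i, hi, rfl⟩ := List.getElem_of_mem ((h.mem_iff k).2 ⟨hk, hlt⟩)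
        exact ⟨i, by rw [ofList_apply, List.getD_eq_getElem _ _ hi]⟩
      · refine ⟨(∑ d, s d - k).toNat, ?_⟩
        rw [ofList_apply, List.getD_eq_default _ _ (by omega)]
        omega
  refine Subtype.ext ?_
  have h3 : StrictMono fun i => -(ofList (∑ d, s d) l).1 i := fun i j hij => neg_lt_neg (h1 hij)
  have h4 : StrictMono fun i => -(enum n lam s).1 i :=
    fun i j hij => neg_lt_neg (enum_strictAnti n lam s hij)
  have h5 : (fun i => -(enum n lam s).1 i) = fun i => -(ofList (∑ d, s d) l).1 i := by
    rw [← StrictMono.range_inj h4 h3]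
    have h6 := congrArg (fun S : Set ℤ => Neg.neg '' S) h2
    simp only [← Set.range_comp] at h6
    exact h6.symm
  ext i
  exact neg_injective (congrFun h5 i)

theorem isBeadList_firstEntries [NeZero n] [NeZero ℓ]
    (h1 : ∀ d, ((lam d).colLen 0 : ℤ) ≤ s d + n * M)
    (h2 : StableAt (enum n lam s) (numEntries n s M)) :
    IsBeadList n s M lam (firstEntries (numEntries n s M) (enum n lam s).1) := by
  have hN : ((numEntries n s M : ℕ) : ℤ) = ∑ d, s d + n * ℓ * M := by
    have h3 : 0 ≤ ∑ d, (s d + n * M) :=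
      Finset.sum_nonneg fun d _ => (Int.natCast_nonneg _).trans (h1 d)
    rw [Finset.sum_add_distrib, Finset.sum_const, Finset.card_univ, Fintype.card_fin,
      nsmul_eq_mul] at h3
    rw [numEntries, Int.toNat_of_nonneg]
    linarith
  refine ⟨h1, ?_, fun k => ?_⟩
  · rw [firstEntries, List.pairwise_map]
    exact List.pairwise_lt_range.imp fun h => enum_strictAnti n lam s h
  · rw [← range_enum]
    constructor
    · intro hk
      have h3 := h2.2.1 k hk
      rw [length_firstEntries, hN] at h3
      obtain ⟨i, _, rfl⟩ := List.mem_map.1 hk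
      exact ⟨⟨i, rfl⟩, by linarith⟩
    · rintro ⟨⟨i, rfl⟩, hlt⟩
      refine List.mem_map.2 ⟨i, List.mem_range.2 ?_, rfl⟩
      by_contra hc
      rw [h2.1, ofList_apply, List.getD_eq_default _ _ (by rw [length_firstEntries]; omega)] at hlt
      omega

theorem tendsto_numEntries (hn : 0 < n) (hℓ : 0 < ℓ) (s : Fin ℓ → ℤ) :
    Tendsto (numEntries n s) atTop atTop := by
  refine tendsto_atTop.2 fun b => ?_
  filter_upwards [eventually_ge_atTop (b + (∑ d, s d).natAbs)] with M hM
  have h1 : (1 : ℤ) ≤ n * ℓ := by exact_mod_cast Nat.mul_pos hn hℓ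
  have h2 : (M : ℤ) ≤ n * ℓ * M := le_mul_of_one_le_left (by positivity) h1
  unfold numEntries
  omega

theorem eventually_isBeadList [NeZero n] [NeZero ℓ] (s : Fin ℓ → ℤ) (lam : MultiPartition ℓ) :
    ∀ᶠ M : ℕ in atTop, ∃ l, IsBeadList n s M lam l ∧ IsStable (∑ d, s d) l := by
  have h1 : ∀ᶠ M : ℕ in atTop, ∀ d, ((lam d).colLen 0 : ℤ) ≤ s d + n * M := by
    rw [Filter.eventually_all]
    intro d
    filter_upwards [eventually_ge_atTop ((lam d).colLen 0 + (s d).natAbs)] with M hM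
    have h1 : (1 : ℤ) ≤ n := by exact_mod_cast NeZero.pos n
    have h2 : (M : ℤ) ≤ n * M := le_mul_of_one_le_left (by positivity) h1
    omega
  filter_upwards [h1, (tendsto_numEntries (NeZero.pos n) (NeZero.pos ℓ) s).eventually
    (eventually_stableAt (enum n lam s))] with M hM1 hM2
  exact ⟨_, isBeadList_firstEntries hM1 hM2, hM2.2⟩

theorem enum_injective [NeZero n] [NeZero ℓ] (s : Fin ℓ → ℤ) :
    Function.Injective fun lam : MultiPartition ℓ => enum n lam s := by
  intro lam mu h
  have h1 : beads n lam s = beads n mu s := by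
    rw [← range_enum, ← range_enum]
    exact congrArg (fun k : P (∑ d, s d) => Set.range k.1) h
  have hn := NeZero.pos n
  refine funext fun d => ext_rowLen ?_
  have h2 : Set.range (fun r : ℕ => ((lam d).rowLen r + s d - r : ℤ)) =
      Set.range (fun r : ℕ => ((mu d).rowLen r + s d - r : ℤ)) := by
    have key : ∀ nu : MultiPartition ℓ, ∀ x, x ∈ Set.range (fun r : ℕ =>
        ((nu d).rowLen r + s d - r : ℤ)) ↔ pos n ℓ d x ∈ beads n nu s := by
      intro nu x
      constructor
      · rintro ⟨r, rfl⟩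
        exact ⟨d, r, rfl⟩
      · rintro ⟨d', r, hr⟩
        obtain ⟨rfl, rfl⟩ := pos_inj hn hr
        exact ⟨r, rfl⟩
    ext x
    rw [key, key, h1]
  have h3 : StrictMono fun r : ℕ => -((lam d).rowLen r + s d - r : ℤ) :=
    fun i j hij => neg_lt_neg (bead_strictAnti (lam d) (s d) hij)
  have h4 : StrictMono fun r : ℕ => -((mu d).rowLen r + s d - r : ℤ) :=
    fun i j hij => neg_lt_neg (bead_strictAnti (mu d) (s d) hij)
  have h5 : (fun r : ℕ => -((lam d).rowLen r + s d - r : ℤ)) =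
      fun r : ℕ => -((mu d).rowLen r + s d - r : ℤ) := by
    rw [← StrictMono.range_inj h3 h4]
    have h6 := congrArg (fun S : Set ℤ => Neg.neg '' S) h2
    simp only [← Set.range_comp] at h6
    exact h6
  intro r
  have := congrFun h5 r
  omega

/-- A decreasing list with the right number of beads on each abacus is a bead list. -/
theorem exists_isBeadList (hn : 0 < n) (hℓ : 0 < ℓ) (hs : ∀ d, 0 ≤ s d + n * M)
    (hl : l.Pairwise (· > ·)) (hgt : ∀ k ∈ l, -(n * ℓ * M : ℤ) < k)
    (hcount : ∀ d : Fin ℓ, (l.map (dPart n ℓ)).count ((d : ℕ) + 1 : ℤ) = (s d + n * M).toNat) :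
    ∃ mu, IsBeadList n s M mu l := by
  have key : ∀ d : Fin ℓ, ∃ Y : YoungDiagram, (Y.colLen 0 : ℤ) ≤ s d + n * M ∧
      ∀ x, -(n * M : ℤ) < x → (pos n ℓ d x ∈ l ↔ ∃ r : ℕ, x = Y.rowLen r + s d - r) := by
    intro d
    let X : Finset ℤ := (l.toFinset.filter fun k => dPart n ℓ k = (d : ℕ) + 1).image (xPart n ℓ)
    have hXmem : ∀ x, x ∈ X ↔ pos n ℓ d x ∈ l := by
      intro x
      simp only [X, Finset.mem_image, Finset.mem_filter, List.mem_toFinset]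
      constructor
      · rintro ⟨k, ⟨h1, h2⟩, rfl⟩
        obtain ⟨d', h3⟩ := exists_eq_pos hn hℓ k
        rw [h3, dPart_pos hn] at h2
        have : d' = d := Fin.ext (by omega)
        rw [← this, ← h3]
        exact h1
      · intro h
        exact ⟨_, ⟨h, dPart_pos hn d x⟩, xPart_pos hn d x⟩
    have hcard : X.card = (s d + n * M).toNat := by
      rw [← hcount d, Finset.card_image_of_injOn]
      · have h1 : l.toFinset.filter (fun k => dPart n ℓ k = (d : ℕ) + 1) =
            (l.filter fun k => dPart n ℓ k == (d : ℕ) + 1).toFinset := by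
          ext k; simp
        have h2 : (l.filter fun k => dPart n ℓ k == (d : ℕ) + 1).Nodup :=
          List.Nodup.filter _ (hl.imp fun h => h.ne')
        rw [h1, List.toFinset_card_of_nodup h2, List.count, List.countP_map,
          List.countP_eq_length_filter]
        rfl
      · intro k hk k' hk' he
        rw [Finset.mem_coe, Finset.mem_filter] at hk hk'
        obtain ⟨e1, h1⟩ := exists_eq_pos hn hℓ k
        obtain ⟨e2, h2⟩ := exists_eq_pos hn hℓ k'
        have a1 := hk.2
        have a2 := hk'.2
        rw [h1, dPart_pos hn] at a1
        rw [h2, dPart_pos hn] at a2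
        have : e1 = e2 := Fin.ext (by omega)
        rw [h1, h2, this, he]
    obtain ⟨p, hp⟩ : ∃ p, p = (s d + n * M).toNat := ⟨_, rfl⟩
    rw [← hp] at hcard
    have hps : (p : ℤ) = s d + n * M := by rw [hp, Int.toNat_of_nonneg (hs d)]
    have hX : ∀ x ∈ X, -(n * M : ℤ) < x := fun x hx => by
      have := hgt _ ((hXmem x).1 hx)
      rwa [lt_pos_iff hn] at this
    let y : ℕ → ℤ := fun r =>
      if h : r < p then X.orderEmbOfFin hcard ⟨p - 1 - r, by omega⟩ else s d - r
    have hanti : StrictAnti y := by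
      refine strictAnti_nat_of_succ_lt fun r => ?_
      simp only [y]
      by_cases h1 : r + 1 < p
      · rw [dif_pos h1, dif_pos (by omega)]
        refine (X.orderEmbOfFin hcard).strictMono ?_
        rw [Fin.mk_lt_mk]
        omega
      · rw [dif_neg h1]
        by_cases h2 : r < p
        · rw [dif_pos h2]
          have := hX _ (X.orderEmbOfFin_mem hcard ⟨p - 1 - r, by omega⟩)
          push_cast
          omega
        · rw [dif_neg h2]
          push_cast
          omega
    have hanti' : Antitone fun r : ℕ => y r - s d + r := by
      refine antitone_nat_of_succ_le fun r => ?_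
      have := hanti (Nat.lt_add_one r)
      push_cast
      omega
    have hzero : ∀ r, p ≤ r → y r - s d + r = 0 := by
      intro r hr
      simp only [y]
      rw [dif_neg (by omega)]
      ring
    have hnn : ∀ r : ℕ, 0 ≤ y r - s d + r := by
      intro r
      have := hanti' (le_max_left r p)
      dsimp only at this
      rwa [hzero _ (le_max_right r p)] at this
    obtain ⟨Y, hY⟩ := exists_youngDiagram (row := fun r => (y r - s d + r).toNat)
      (fun i j hij => Int.toNat_le_toNat (hanti' hij)) (p := p) fun r hr => by
        rw [hzero r hr]; rfl
    have hYy : ∀ r : ℕ, (Y.rowLen r + s d - r : ℤ) = y r := by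
      intro r
      rw [hY, Int.toNat_of_nonneg (hnn r)]
      ring
    refine ⟨Y, ?_, fun x hx => ?_⟩
    · have := colLen_le_of_rowLen_eq_zero (Y := Y) (r := p) (by rw [hY, hzero p le_rfl]; rfl)
      omega
    · rw [← hXmem]
      simp only [hYy]
      constructor
      · intro h
        have : x ∈ Set.range (X.orderEmbOfFin hcard) := by
          rw [Finset.range_orderEmbOfFin]; exact h
        obtain ⟨i, rfl⟩ := this
        refine ⟨p - 1 - i, ?_⟩
        have := i.2
        simp only [y]
        rw [dif_pos (by omega)]
        congr 1
        ext
        simp only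
        omega
      · rintro ⟨r, rfl⟩
        simp only [y] at hx ⊢
        by_cases hr : r < p
        · rw [dif_pos hr]
          exact X.orderEmbOfFin_mem hcard _
        · rw [dif_neg hr] at hx
          omega
  choose mu h1 h2 using key
  refine ⟨mu, h1, hl, fun k => ?_⟩
  constructor
  · intro hk
    have h3 := hgt k hk
    obtain ⟨d, h4⟩ := exists_eq_pos hn hℓ k
    rw [h4] at h3 hk
    rw [lt_pos_iff hn] at h3
    obtain ⟨r, hr⟩ := (h2 d _ h3).1 hk
    exact ⟨⟨d, r, by rw [← hr]; exact h4⟩, hgt k (by rw [h4]; exact hk)⟩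
  · rintro ⟨⟨d, r, rfl⟩, hlt⟩
    rw [lt_pos_iff hn] at hlt
    exact (h2 d _ hlt).2 ⟨r, rfl⟩

theorem colLen_le_card (Y : YoungDiagram) : Y.colLen 0 ≤ Y.card := by
  rw [card_eq_sum_rowLen Y le_rfl]
  have : ∑ _r ∈ Finset.range (Y.colLen 0), 1 ≤ ∑ r ∈ Finset.range (Y.colLen 0), Y.rowLen r := by
    refine Finset.sum_le_sum fun r hr => ?_
    rw [Nat.one_le_iff_ne_zero]
    intro h
    have := colLen_le_of_rowLen_eq_zero h
    have := Finset.mem_range.1 hr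
    omega
  simpa using this

theorem IsBeadList.isFull (hn : 0 < n) (hℓ : 0 < ℓ) (h : IsBeadList n s M lam l) {T : ℤ}
    (hT : ∀ d, T + (lam d).colLen 0 ≤ s d) : IsFull n ℓ T (-(n * ℓ * M : ℤ)) l := by
  intro k hk hx
  rw [h.mem_iff]
  refine ⟨?_, hk⟩
  obtain ⟨d, h4⟩ := exists_eq_pos hn hℓ k
  have := hT d
  refine ⟨d, (s d - xPart n ℓ k).toNat, ?_⟩
  rw [rowLen_eq_zero_of_colLen_le (by omega)]
  refine h4.trans ?_
  congr 1
  push_cast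
  omega

theorem IsBeadList.eq_bot_of_isFull (hn : 0 < n) (h : IsBeadList n s M lam l) {j : Fin ℓ}
    (hf : IsFull n ℓ (s j) (-(n * ℓ * M : ℤ)) l) : lam j = ⊥ := by
  by_contra hne
  have hp : 0 < (lam j).colLen 0 := by
    by_contra hc
    refine hne (ext_rowLen fun r => ?_)
    rw [rowLen_eq_zero_of_colLen_le (by omega), rowLen_eq_zero_of_colLen_le]
    exact colLen_le_of_rowLen_eq_zero (by
      by_contra h0
      have h1 : (r, 0) ∈ (⊥ : YoungDiagram) := YoungDiagram.mem_iff_lt_rowLen.2 (by omega)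
      exact YoungDiagram.notMem_bot _ h1)
  have h1 := h.colLen_le j
  have h2 := hf (pos n ℓ j (s j - (lam j).colLen 0 + 1)) (by rw [lt_pos_iff hn]; omega)
    (by rw [xPart_pos hn]; omega)
  rw [h.mem_iff] at h2
  obtain ⟨⟨d, r, hr⟩, -⟩ := h2
  obtain ⟨rfl, hr⟩ := pos_inj hn hr
  rcases lt_or_ge r ((lam j).colLen 0) with h3 | h3
  · have : (lam j).rowLen r ≠ 0 := fun h0 => by
      have := colLen_le_of_rowLen_eq_zero h0
      omega
    omega
  · rw [rowLen_eq_zero_of_colLen_le h3] at hr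
    push_cast at hr
    omega

theorem finite_size_eq (ℓ m : ℕ) : {lam : MultiPartition ℓ | size lam = m}.Finite := by
  have h1 : {Y : YoungDiagram | Y.card ≤ m}.Finite := by
    refine Set.Finite.of_finite_image (f := YoungDiagram.cells) ?_
      (fun Y _ Y' _ h => YoungDiagram.ext h)
    refine ((Finset.range m ×ˢ Finset.range m).powerset : Finset (Finset (ℕ × ℕ))).finite_toSet.subset ?_
    rintro _ ⟨Y, hY, rfl⟩
    rw [Finset.mem_coe, Finset.mem_powerset]
    rintro ⟨i, j⟩ hij
    rw [YoungDiagram.mem_cells] at hij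
    rw [Finset.mem_product, Finset.mem_range, Finset.mem_range]
    have h2 : (i, 0) ∈ Y := Y.isLowerSet (Prod.mk_le_mk.2 ⟨le_rfl, Nat.zero_le _⟩) hij
    have h3 := YoungDiagram.mem_iff_lt_colLen.1 h2
    have h4 := YoungDiagram.mem_iff_lt_rowLen.1 hij
    have h5 := colLen_le_card Y
    have h6 : Y.rowLen i ≤ Y.card := by
      rw [card_eq_sum_rowLen Y le_rfl]
      exact Finset.single_le_sum (f := Y.rowLen) (fun _ _ => Nat.zero_le _) (Finset.mem_range.2 h3)
    have hY' : Y.card ≤ m := hY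
    dsimp only
    omega
  refine (Set.Finite.pi' fun _ : Fin ℓ => h1).subset fun lam hlam d => ?_
  have : (lam d).card ≤ size lam :=
    Finset.single_le_sum (f := fun d => (lam d).card) (fun _ _ => Nat.zero_le _) (Finset.mem_univ d)
  have hlam' : size lam = m := hlam
  exact hlam' ▸ this

end Beads

/-! ### Canonical bases of unitriangular semilinear involutions -/

section Scalars

open LaurentPolynomial

theorem laurentToKq_C_mul_T (a : ℚ) (z : ℤ) :
    laurentToKq (C a * T z) = algebraMap ℚ Kq a * q ^ z := by
  simp [laurentToKq]

theorem conj_algebraMap (a : ℚ) : conj (algebraMap ℚ Kq a) = algebraMap ℚ Kq a :=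
  RingHom.congr_fun (RingHom.ext_rat (conj.comp (algebraMap ℚ Kq)) (algebraMap ℚ Kq)) a

theorem conj_laurentToKq (f : LaurentPolynomial ℚ) :
    conj (laurentToKq f) = laurentToKq (invert f) := by
  induction f using LaurentPolynomial.induction_on' with
  | add f g hf hg => rw [map_add, map_add, map_add, map_add, hf, hg]
  | C_mul_T z a =>
    rw [laurentToKq_C_mul_T, map_mul, map_mul, invert_C, invert_T, laurentToKq_C_mul_T, map_zpow₀,
      conj_q, conj_algebraMap, inv_zpow, zpow_neg]

theorem mem_laurent_iff {c : Kq} : c ∈ laurent ↔ ∃ f, laurentToKq f = c := by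
  constructor
  · intro h
    induction h using Algebra.adjoin_induction with
    | mem x hx =>
      rcases hx with rfl | rfl
      · exact ⟨T 1, by simpa using laurentToKq_C_mul_T 1 1⟩
      · exact ⟨T (-1), by simpa using laurentToKq_C_mul_T 1 (-1)⟩
    | algebraMap r => exact ⟨C r, by simpa using laurentToKq_C_mul_T r 0⟩
    | add x y _ _ hx hy =>
      obtain ⟨⟨f, rfl⟩, ⟨g, rfl⟩⟩ := And.intro hx hy
      exact ⟨f + g, map_add _ _ _⟩
    | mul x y _ _ hx hy =>
      obtain ⟨⟨f, rfl⟩, ⟨g, rfl⟩⟩ := And.intro hx hy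
      exact ⟨f * g, map_mul _ _ _⟩
  · rintro ⟨f, rfl⟩
    induction f using LaurentPolynomial.induction_on' with
    | add f g hf hg => rw [map_add]; exact add_mem hf hg
    | C_mul_T z a =>
      rw [laurentToKq_C_mul_T]
      refine mul_mem (Subalgebra.algebraMap_mem _ a) ?_
      obtain ⟨k, rfl | rfl⟩ := z.eq_nat_or_neg
      · rw [zpow_natCast]; exact pow_mem q_mem_laurent k
      · rw [zpow_neg, zpow_natCast, ← inv_pow]; exact pow_mem q_inv_mem_laurent k

/-- The ideal `q^ε ℚ[q^ε]` of `ℚ[q^ε]`, as an additive subgroup of `ℚ(q)`. -/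
def positivePart (ε : ℤˣ) : AddSubgroup Kq :=
  (Algebra.adjoin ℚ {qPow ε}).toSubring.toAddSubgroup.map (AddMonoidHom.mulLeft (qPow ε))

theorem mem_positivePart {ε : ℤˣ} {c : Kq} :
    c ∈ positivePart ε ↔ ∃ a ∈ Algebra.adjoin ℚ {qPow ε}, qPow ε * a = c := Iff.rfl

theorem mem_positivePart_iff {ε : ℤˣ} {c : Kq} :
    c ∈ positivePart ε ↔
      ∃ f : LaurentPolynomial ℚ, (∀ z, f.coeff z ≠ 0 → 0 < ε * z) ∧ laurentToKq f = c := by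
  have hε : (ε : ℤ) * ε = 1 := by rw [← Units.val_mul, Int.units_mul_self, Units.val_one]
  have hT : laurentToKq (T ε) = qPow ε := by simpa [qPow] using laurentToKq_C_mul_T 1 ε
  rw [mem_positivePart]
  constructor
  · rintro ⟨a, ha, rfl⟩
    obtain ⟨p, rfl⟩ := Algebra.adjoin_singleton_eq_range_aeval ℚ (qPow ε) ▸ ha
    induction p using Polynomial.induction_on' with
    | add p p' hp hp' =>
      obtain ⟨f, hf, hf'⟩ := hp (by
        rw [Algebra.adjoin_singleton_eq_range_aeval]; exact ⟨p, rfl⟩)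
      obtain ⟨g, hg, hg'⟩ := hp' (by
        rw [Algebra.adjoin_singleton_eq_range_aeval]; exact ⟨p', rfl⟩)
      refine ⟨f + g, fun z hz => ?_, by rw [map_add, hf', hg', map_add, mul_add]⟩
      rw [AddMonoidAlgebra.coeff_add, Finsupp.add_apply] at hz
      by_contra hc
      have h1 : f.coeff z = 0 := by_contra fun h => hc (hf z h)
      have h2 : g.coeff z = 0 := by_contra fun h => hc (hg z h)
      exact hz (by rw [h1, h2, add_zero])
    | monomial k r =>
      refine ⟨C r * T (ε * (k + 1)), fun z hz => ?_, ?_⟩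
      · rw [← single_eq_C_mul_T, AddMonoidAlgebra.coeff_single, Finsupp.single_apply] at hz
        obtain rfl : (ε : ℤ) * (k + 1) = z := by
          by_contra hc
          exact hz (if_neg hc)
        rw [← mul_assoc, hε]
        positivity
      · rw [laurentToKq_C_mul_T]
        change _ = qPow ε * Polynomial.aeval (qPow ε) (Polynomial.monomial k r)
        rw [Polynomial.aeval_monomial, zpow_mul, ← qPow, zpow_add_one₀ (by
          rw [qPow]; exact zpow_ne_zero _ q_ne_zero), zpow_natCast]
        ring
  · rintro ⟨f, hf, rfl⟩
    suffices h : ∀ (z : ℤ) (r : ℚ), 0 < ε * z → laurentToKq (C r * T z) ∈ positivePart ε by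
      rw [← mem_positivePart]
      have h2 : f = ∑ z ∈ f.coeff.support, C (f.coeff z) * T z := by
        apply AddMonoidAlgebra.coeff_injective
        ext z
        simp only [← single_eq_C_mul_T, AddMonoidAlgebra.coeff_sum, AddMonoidAlgebra.coeff_single,
          Finsupp.finsetSum_apply, Finsupp.single_apply]
        rw [Finset.sum_ite_eq']
        split_ifs with h
        · rfl
        · simpa using h
      rw [h2, map_sum]
      exact sum_mem fun z hz => h z _ (hf z (Finsupp.mem_support_iff.1 hz))
    intro z r hz
    obtain ⟨k, hk⟩ : ∃ k : ℕ, ε * z = k + 1 := ⟨(ε * z - 1).toNat, by omega⟩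
    obtain rfl : z = ε * (k + 1) := by rw [← hk, ← mul_assoc, hε, one_mul]
    have h1 : qPow ε ∈ Algebra.adjoin ℚ {qPow ε} := Algebra.subset_adjoin (Set.mem_singleton _)
    refine mem_positivePart.2 ⟨algebraMap ℚ Kq r * qPow ε ^ k,
      mul_mem (Subalgebra.algebraMap_mem (Algebra.adjoin ℚ {qPow ε}) r) (pow_mem h1 k), ?_⟩
    rw [laurentToKq_C_mul_T, zpow_mul, ← qPow, zpow_add_one₀ (by
      rw [qPow]; exact zpow_ne_zero _ q_ne_zero), zpow_natCast]
    ring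

theorem mem_laurent_of_mem_positivePart {ε : ℤˣ} {c : Kq} (h : c ∈ positivePart ε) :
    c ∈ laurent := by
  obtain ⟨f, -, hf⟩ := mem_positivePart_iff.1 h
  exact mem_laurent_iff.2 ⟨f, hf⟩

theorem conj_mem_laurent {c : Kq} (h : c ∈ laurent) : conj c ∈ laurent := by
  obtain ⟨f, rfl⟩ := mem_laurent_iff.1 h
  exact mem_laurent_iff.2 ⟨_, (conj_laurentToKq f).symm⟩

theorem eq_zero_of_conj_eq_self {ε : ℤˣ} {c : Kq} (h : c ∈ positivePart ε) (hc : conj c = c) :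
    c = 0 := by
  obtain ⟨f, hf, rfl⟩ := mem_positivePart_iff.1 h
  rw [conj_laurentToKq] at hc
  have h1 := laurentToKq_injective hc
  rw [show f = 0 from ?_, map_zero]
  ext z
  by_contra hz
  have h2 := hf z hz
  have h3 := hf (-z) (by rw [← invert_apply, h1]; exact hz)
  rw [mul_neg] at h3
  omega

/-- An anti-invariant Laurent polynomial is `p - p̄` with `p` its part of positive degree. -/
theorem exists_sub_conj_eq (ε : ℤˣ) {c : Kq} (h : c ∈ laurent) (hc : conj c = -c) :
    ∃ p ∈ positivePart ε, p - conj p = c := by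
  obtain ⟨f, rfl⟩ := mem_laurent_iff.1 h
  rw [conj_laurentToKq, ← map_neg] at hc
  have h1 : ∀ z, f.coeff (-z) = -f.coeff z := fun z => by
    rw [← invert_apply, laurentToKq_injective hc]; rfl
  let g : LaurentPolynomial ℚ := .ofCoeff (f.coeff.filter fun z => 0 < ε * z)
  have hg : ∀ z, g.coeff z = if 0 < ε * z then f.coeff z else 0 := fun z =>
    Finsupp.filter_apply _ _ _
  refine ⟨laurentToKq g, mem_positivePart_iff.2 ⟨g, fun z hz => ?_, rfl⟩, ?_⟩
  · by_contra hc
    exact hz (by rw [hg, if_neg hc])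
  · rw [conj_laurentToKq, ← map_sub]
    congr 1
    ext z
    rw [AddMonoidAlgebra.coeff_sub, Finsupp.sub_apply, invert_apply, hg, hg, h1, mul_neg]
    have hε : (ε : ℤ) ≠ 0 := ε.ne_zero
    rcases lt_trichotomy (ε * z) 0 with h | h | h
    · rw [if_neg (by omega), if_pos (by omega)]; ring
    · rw [if_neg (by omega), if_neg (by omega)]
      obtain rfl : z = 0 := (mul_eq_zero.1 h).resolve_left hε
      have := h1 0
      rw [neg_zero] at this
      linarith
    · rw [if_pos (by omega), if_neg (by omega)]; ring

end Scalars

section Unitriangular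

variable {I : Type*} {ρ : I → ℕ} {β : (I →₀ Kq) →ₛₗ[conj] (I →₀ Kq)}

/-- `β` is a semilinear involution which is unitriangular with respect to the rank `ρ`, with
entries in `ℚ[q, q⁻¹]`. -/
structure IsUnitriangular (ρ : I → ℕ) (β : (I →₀ Kq) →ₛₗ[conj] (I →₀ Kq)) : Prop where
  involutive : Function.Involutive β
  apply_self : ∀ i, β (Finsupp.single i 1) i = 1
  eq_or_lt : ∀ i j, β (Finsupp.single i 1) j ≠ 0 → j = i ∨ ρ j < ρ i
  mem_laurent : ∀ i j, β (Finsupp.single i 1) j ∈ laurent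

theorem semilinear_apply (β : (I →₀ Kq) →ₛₗ[conj] (I →₀ Kq)) (x : I →₀ Kq) (j : I) :
    β x j = x.sum fun i a => conj a * β (Finsupp.single i 1) j := by
  conv_lhs => rw [← Finsupp.sum_single x]
  rw [Finsupp.sum, map_sum, Finsupp.finsetSum_apply]
  refine Finset.sum_congr rfl fun i _ => ?_
  rw [← Finsupp.smul_single_one, LinearMap.map_smulₛₗ, Finsupp.smul_apply, smul_eq_mul]

/-- On the entries of top rank, `β` acts by conjugation of coordinates. -/
theorem IsUnitriangular.apply_top (hβ : IsUnitriangular ρ β) {x : I →₀ Kq} {N : ℕ}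
    (hx : ∀ i, x i ≠ 0 → ρ i ≤ N) {j : I} (hj : N ≤ ρ j) : β x j = conj (x j) := by
  rw [semilinear_apply, Finsupp.sum]
  rw [Finset.sum_eq_single j, hβ.apply_self, mul_one]
  · intro i hi hne
    by_contra hc
    have h1 := hx i (Finsupp.mem_support_iff.1 hi)
    rcases hβ.eq_or_lt i j (right_ne_zero_of_mul hc) with h | h
    · exact hne h.symm
    · omega
  · intro h
    rw [Finsupp.notMem_support_iff.1 h, map_zero, zero_mul]

theorem IsUnitriangular.apply_mem_laurent (hβ : IsUnitriangular ρ β) {x : I →₀ Kq}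
    (hx : ∀ i, x i ∈ laurent) (j : I) : β x j ∈ laurent := by
  rw [semilinear_apply]
  exact sum_mem fun i _ => mul_mem (conj_mem_laurent (hx i)) (hβ.mem_laurent i j)

/-- An invariant vector with coordinates in `q^ε ℚ[q^ε]` vanishes. -/
theorem IsUnitriangular.eq_zero (hβ : IsUnitriangular ρ β) {ε : ℤˣ} {x : I →₀ Kq} (hx : β x = x)
    (hε : ∀ i, x i ∈ positivePart ε) : x = 0 := by
  by_contra hne
  obtain ⟨i, hi, hmax⟩ := Finset.exists_max_image x.support ρ (Finsupp.support_nonempty_iff.2 hne)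
  refine Finsupp.mem_support_iff.1 hi (eq_zero_of_conj_eq_self (hε i) ?_)
  rw [← hβ.apply_top (N := ρ i) (fun k hk => hmax k (Finsupp.mem_support_iff.2 hk)) le_rfl, hx]

/-- An anti-invariant vector over `ℚ[q, q⁻¹]` is `y - β y` with the coordinates of `y` in
`q^ε ℚ[q^ε]`. -/
theorem IsUnitriangular.exists_sub_eq (hβ : IsUnitriangular ρ β) (ε : ℤˣ) (N : ℕ) :
    ∀ x : I →₀ Kq, β x = -x → (∀ i, x i ∈ laurent) → (∀ i, x i ≠ 0 → ρ i < N) →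
      ∃ y : I →₀ Kq, (∀ i, y i ∈ positivePart ε) ∧ (∀ i, y i ≠ 0 → ρ i < N) ∧ y - β y = x := by
  have hS : ∀ c : Kq, ∃ p ∈ positivePart ε, (c = 0 → p = 0) ∧
      (c ∈ laurent → conj c = -c → p - conj p = c) := by
    intro c
    by_cases h0 : c = 0
    · exact ⟨0, zero_mem _, fun _ => rfl, fun _ _ => by rw [h0, map_zero, sub_zero]⟩
    · by_cases h : c ∈ laurent ∧ conj c = -c
      · obtain ⟨p, hp, hpc⟩ := exists_sub_conj_eq ε h.1 h.2
        exact ⟨p, hp, fun h => absurd h h0, fun _ _ => hpc⟩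
      · exact ⟨0, zero_mem _, fun h => absurd h h0, fun h1 h2 => absurd ⟨h1, h2⟩ h⟩
  choose g hg hg0 hgc using hS
  induction N with
  | zero =>
    intro x _ _ hN
    refine ⟨0, fun _ => zero_mem _, fun i h => absurd rfl h, ?_⟩
    rw [map_zero, sub_zero]
    ext i
    by_contra hc
    exact absurd (hN i (Ne.symm hc)) (Nat.not_lt_zero _)
  | succ N ih =>
    intro x hx hl hN
    -- `y₀` solves the equation in the top rank; the difference has smaller rank
    let y₀ : I →₀ Kq := (x.filter (ρ · = N)).mapRange g (hg0 0 rfl)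
    have hy₀ : ∀ i, y₀ i = g (if ρ i = N then x i else 0) := fun i => by
      rw [Finsupp.mapRange_apply, Finsupp.filter_apply]
    have hy₀N : ∀ i, y₀ i ≠ 0 → ρ i = N := fun i hi => by
      by_contra hc
      rw [hy₀, if_neg hc] at hi
      exact hi (hg0 0 rfl)
    have hy₀l : ∀ i, y₀ i ∈ positivePart ε := fun i => by rw [hy₀]; exact hg _
    have htop : ∀ i, N ≤ ρ i → (x - (y₀ - β y₀)) i = 0 := by
      intro i hi
      rw [Finsupp.sub_apply, Finsupp.sub_apply, hβ.apply_top (fun k hk => (hy₀N k hk).le) hi]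
      rcases hi.eq_or_lt with h | h
      · have h1 : conj (x i) = -x i := by
          rw [← hβ.apply_top (fun k hk => Nat.lt_succ_iff.1 (hN k hk)) hi, hx, Finsupp.neg_apply]
        rw [hy₀, if_pos h.symm, hgc _ (hl i) h1, sub_self]
      · have h1 : x i = 0 := by
          by_contra hc
          have := hN i hc
          omega
        have h2 : y₀ i = 0 := by
          by_contra hc
          have := hy₀N i hc
          omega
        rw [h1, h2, map_zero, sub_zero, sub_zero]
    obtain ⟨y, hy1, hy2, hy3⟩ := ih (x - (y₀ - β y₀))
      (by rw [map_sub, map_sub, hβ.involutive y₀, hx]; abel)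
      (fun i => sub_mem (hl i) (sub_mem (mem_laurent_of_mem_positivePart (hy₀l i))
        (hβ.apply_mem_laurent (fun k => mem_laurent_of_mem_positivePart (hy₀l k)) i)))
      (fun i hi => by
        by_contra hc
        exact hi (htop i (by omega)))
    refine ⟨y₀ + y, fun i => add_mem (hy₀l i) (hy1 i), fun i hi => ?_, ?_⟩
    · by_contra hc
      rw [Finsupp.add_apply] at hi
      refine hi ?_
      have h3 : y₀ i = 0 := by_contra fun h => hc (by have := hy₀N i h; omega)
      have h4 : y i = 0 := by_contra fun h => hc (by have := hy2 i h; omega)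
      rw [h3, h4, add_zero]
    · rw [map_add, ← sub_add_sub_comm, hy3]; abel

theorem exists_basis_of_triangular (ρ : I → ℕ) (v : I → I →₀ Kq) (h1 : ∀ i, v i i = 1)
    (h2 : ∀ i j, v i j ≠ 0 → j = i ∨ ρ j < ρ i) :
    ∃ b : Module.Basis I Kq (I →₀ Kq), ∀ i, b i = v i := by
  have hli : LinearIndependent Kq v := by
    rw [linearIndependent_iff]
    intro l hl
    by_contra hne
    obtain ⟨i, hi, hmax⟩ :=
      Finset.exists_max_image l.support ρ (Finsupp.support_nonempty_iff.2 hne)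
    have h3 := DFunLike.congr_fun hl i
    rw [Finsupp.linearCombination_apply, Finsupp.sum, Finsupp.finsetSum_apply,
      Finset.sum_eq_single i] at h3
    · rw [Finsupp.smul_apply, h1, smul_eq_mul, mul_one] at h3
      exact Finsupp.mem_support_iff.1 hi h3
    · intro k hk hne
      by_contra hc
      rw [Finsupp.smul_apply, smul_eq_mul] at hc
      have := hmax k hk
      rcases h2 k i (right_ne_zero_of_mul hc) with h | h
      · exact hne h.symm
      · omega
    · exact fun h => absurd hi h
  have hsp : ∀ N i, ρ i < N → Finsupp.single i 1 ∈ Submodule.span Kq (Set.range v) := by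
    intro N
    induction N with
    | zero => exact fun i h => absurd h (Nat.not_lt_zero _)
    | succ N ih =>
      intro i hi
      have h3 : v i = Finsupp.single i 1 + ((v i).erase i).sum fun k a => a • Finsupp.single k 1 := by
        conv_lhs => rw [← Finsupp.single_add_erase i (v i), h1]
        congr 1
        conv_lhs => rw [← Finsupp.sum_single ((v i).erase i)]
        exact Finsupp.sum_congr fun k _ => (Finsupp.smul_single_one _ _).symm
      rw [eq_sub_of_add_eq h3.symm]
      refine sub_mem (Submodule.subset_span ⟨i, rfl⟩) (Submodule.sum_mem _ fun k hk =>
        Submodule.smul_mem _ _ (ih k ?_))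
      classical
      rw [Finsupp.support_erase, Finset.mem_erase, Finsupp.mem_support_iff] at hk
      have := (h2 i k hk.2).resolve_left hk.1
      omega
  refine ⟨Module.Basis.mk hli fun x _ => ?_, fun i => Module.Basis.mk_apply _ _ i⟩
  rw [← Finsupp.sum_single x]
  refine Submodule.sum_mem _ fun k _ => ?_
  rw [← Finsupp.smul_single_one]
  exact Submodule.smul_mem _ _ (hsp _ k (Nat.lt_succ_self _))

/-- Existence of the canonical basis of a unitriangular involution. -/
theorem IsUnitriangular.exists_basis (hβ : IsUnitriangular ρ β) (ε : ℤˣ) :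
    ∃ G : Module.Basis I Kq (I →₀ Kq), ∀ i, β (G i) = G i ∧
      ∀ j, (G i - Finsupp.single i 1 : I →₀ Kq) j ∈ positivePart ε := by
  have h : ∀ i, ∃ y : I →₀ Kq, (∀ j, y j ∈ positivePart ε) ∧ (∀ j, y j ≠ 0 → ρ j < ρ i) ∧
      y - β y = β (Finsupp.single i 1) - Finsupp.single i 1 := by
    intro i
    have h1 : ∀ j, (Finsupp.single i 1 : I →₀ Kq) j ∈ laurent := fun j => by
      classical
      rw [Finsupp.single_apply]
      split_ifs
      exacts [one_mem _, zero_mem _]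
    refine hβ.exists_sub_eq ε _ _ ?_ (fun j => sub_mem (hβ.mem_laurent i j) (h1 j)) fun j hj => ?_
    · rw [map_sub, hβ.involutive]; abel
    · rw [Finsupp.sub_apply] at hj
      by_cases hji : j = i
      · rw [hji, hβ.apply_self, Finsupp.single_eq_same, sub_self] at hj
        exact absurd rfl hj
      · rw [Finsupp.single_eq_of_ne hji, sub_zero] at hj
        exact (hβ.eq_or_lt i j hj).resolve_left hji
  choose y hy1 hy2 hy3 using h
  have hyi : ∀ i, y i i = 0 := fun i => by
    by_contra hc
    exact lt_irrefl _ (hy2 i i hc)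
  obtain ⟨G, hG⟩ := exists_basis_of_triangular ρ (fun i => Finsupp.single i 1 + y i)
    (fun i => by rw [Finsupp.add_apply, hyi, Finsupp.single_eq_same, add_zero])
    (fun i j hj => by
      by_cases hji : j = i
      · exact Or.inl hji
      · rw [Finsupp.add_apply, Finsupp.single_eq_of_ne hji, zero_add] at hj
        exact Or.inr (hy2 i j hj))
  refine ⟨G, fun i => ⟨?_, fun j => ?_⟩⟩
  · rw [hG, map_add]
    have := hy3 i
    rw [sub_eq_sub_iff_add_eq_add] at this
    rw [← this]; abel
  · rw [hG, add_sub_cancel_left]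
    exact hy1 i j

/-- The canonical basis of a unitriangular involution is unique. -/
theorem IsUnitriangular.eq_of_mem_positivePart (hβ : IsUnitriangular ρ β) {ε : ℤˣ} {i : I}
    {x x' : I →₀ Kq} (hx : β x = x) (hx' : β x' = x')
    (h : ∀ j, (x - Finsupp.single i 1 : I →₀ Kq) j ∈ positivePart ε)
    (h' : ∀ j, (x' - Finsupp.single i 1 : I →₀ Kq) j ∈ positivePart ε) : x = x' := by
  rw [← sub_eq_zero]
  refine hβ.eq_zero (ε := ε) (by rw [map_sub, hx, hx']) fun j => ?_
  have := sub_mem (h j) (h' j)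
  rwa [← Finsupp.sub_apply, sub_sub_sub_cancel_right] at this

end Unitriangular

/-! ### The bar involution of the Fock space -/

section Invariants

variable {n ℓ : ℕ}

theorem Step.map_dPart_perm (hn : 0 < n) (hℓ : 0 < ℓ) {l l' : List ℤ} (h : Step n ℓ l l') :
    (l'.map (dPart n ℓ)).Perm (l.map (dPart n ℓ)) := by
  cases h with
  | swap pre post k₂ k₁ h =>
    simp only [List.map_append, List.map_cons]
    exact (List.Perm.swap _ _ _).append_left _
  | corr pre post k₂ k₁ j h hj =>
    simp only [List.map_append, List.map_cons, (corrFst_parts hn hℓ k₂ k₁ j).2.1,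
      (corrSnd_parts hn hℓ k₂ k₁ j).2.1]
    exact (List.Perm.swap _ _ _).append_left _

theorem Reach.map_dPart_perm (hn : 0 < n) (hℓ : 0 < ℓ) {l l' : List ℤ} (h : Reach n ℓ l l') :
    (l'.map (dPart n ℓ)).Perm (l.map (dPart n ℓ)) := by
  induction h with
  | refl => rfl
  | tail _ h ih => exact (h.map_dPart_perm hn hℓ).trans ih

theorem Step.sum_xPart_eq (hn : 0 < n) (hℓ : 0 < ℓ) {l l' : List ℤ} (h : Step n ℓ l l') :
    (l'.map (xPart n ℓ)).sum = (l.map (xPart n ℓ)).sum := by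
  cases h with
  | swap pre post k₂ k₁ h =>
    simp only [List.map_append, List.map_cons, List.sum_append, List.sum_cons]; ring
  | corr pre post k₂ k₁ j h hj =>
    have := corr_xPart_add hn hℓ k₂ k₁ j
    simp only [List.map_append, List.map_cons, List.sum_append, List.sum_cons]; linarith

theorem Reach.sum_xPart_eq (hn : 0 < n) (hℓ : 0 < ℓ) {l l' : List ℤ} (h : Reach n ℓ l l') :
    (l'.map (xPart n ℓ)).sum = (l.map (xPart n ℓ)).sum := by
  induction h with
  | refl => rfl
  | tail _ h ih => exact (h.sum_xPart_eq hn hℓ).trans ih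

/-- Straightening a reordering of the beads of a multipartition yields the beads of
multipartitions of the same size. -/
theorem IsBeadList.exists_of_reach (hn : 0 < n) (hℓ : 0 < ℓ) {s : Fin ℓ → ℤ} {M : ℕ}
    {lam : MultiPartition ℓ} {l l' : List ℤ} (h : IsBeadList n s M lam l)
    (hr : Reach n ℓ l.reverse l') (hl' : l'.Pairwise (· > ·)) :
    ∃ mu, IsBeadList n s M mu l' ∧ size mu = size lam := by
  have h1 : ∀ d, 0 ≤ s d + n * M := fun d => (Int.natCast_nonneg _).trans (h.colLen_le d)
  obtain ⟨mu, hmu⟩ := exists_isBeadList hn hℓ h1 hl'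
    (fun k hk => Int.add_one_le_iff.1 (hr.le_of_forall_le hn hℓ (fun x hx =>
      Int.add_one_le_iff.2 ((h.mem_iff x).1 (List.mem_reverse.1 hx)).2) k hk))
    (fun d => by
      rw [(hr.map_dPart_perm hn hℓ).count_eq, List.map_reverse, List.count_reverse,
        h.count_dPart hn])
  refine ⟨mu, hmu, ?_⟩
  have h2 := hmu.sum_xPart hn
  rw [hr.sum_xPart_eq hn hℓ, List.map_reverse, List.sum_reverse, h.sum_xPart hn] at h2
  omega

end Invariants

section FockBar

variable (n : ℕ) {ℓ : ℕ} [NeZero n] [NeZero ℓ] (s : Fin ℓ → ℤ)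

theorem toWedge_single (lam : MultiPartition ℓ) (a : Kq) :
    toWedge n s (Finsupp.single lam a) = a • wedge n ℓ (enum n lam s) :=
  Finsupp.linearCombination_single _ _ _

variable {n s} in
theorem IsCoord.apply_toWedge {mu : MultiPartition ℓ} {f : Wedge n ℓ (∑ d, s d) →ₗ[Kq] Kq}
    (hf : IsCoord n ℓ (enum n mu s) f) (x : Fock ℓ) : f (toWedge n s x) = x mu := by
  induction x using Finsupp.induction_linear with
  | zero => simp
  | add x y hx hy => rw [map_add, map_add, hx, hy, Finsupp.add_apply]
  | single lam a =>
    rw [toWedge_single, map_smul, smul_eq_mul]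
    by_cases h : lam = mu
    · rw [h, hf.2.1, mul_one, Finsupp.single_eq_same]
    · rw [hf.2.2 _ (enum_strictAnti n lam s) fun h' => h (enum_injective s h'), mul_zero,
        Finsupp.single_eq_of_ne (Ne.symm h)]

theorem exists_isCoord_enum (mu : MultiPartition ℓ) : ∃ f, IsCoord n ℓ (enum n mu s) f :=
  exists_isCoord (NeZero.pos n) (NeZero.pos ℓ) (enum_strictAnti n mu s)

theorem toWedge_injective : Function.Injective (toWedge n s) := by
  intro x y h
  ext mu
  obtain ⟨f, hf⟩ := exists_isCoord_enum n s mu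
  rw [← hf.apply_toWedge, h, hf.apply_toWedge]

theorem exists_toWedge_eq_bar (lam : MultiPartition ℓ) :
    ∃ y : Fock ℓ, toWedge n s y =
        bar n ℓ (NeZero.pos n) (NeZero.pos ℓ) _ (wedge n ℓ (enum n lam s)) ∧
      (∀ mu, y mu ∈ laurent) ∧ ∀ mu, y mu ≠ 0 → size mu = size lam := by
  have hn := NeZero.pos n
  have hℓ := NeZero.pos ℓ
  obtain ⟨M, l, hl, hs⟩ := (eventually_isBeadList (n := n) s lam).exists
  obtain ⟨e, he⟩ := exists_expansion hn hℓ l.reverse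
  have h : ∀ l', ∃ mu, l' ∈ e.support → IsBeadList n s M mu l' ∧ size mu = size lam := by
    intro l'
    by_cases h : l' ∈ e.support
    · exact (hl.exists_of_reach hn hℓ (he.reach l' h) (he.pairwise l' h)).imp fun _ h _ => h
    · exact ⟨lam, fun h' => absurd h' h⟩
  choose g hg using h
  have hy : ∀ mu, (barFactor n ℓ l • e.sum fun l' a => Finsupp.single (g l') a : Fock ℓ) mu =
      barFactor n ℓ l * ∑ l' ∈ e.support, Finsupp.single (g l') (e l') mu := fun mu => by
    rw [Finsupp.smul_apply, smul_eq_mul, Finsupp.sum, Finsupp.finsetSum_apply]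
  refine ⟨barFactor n ℓ l • e.sum fun l' a => Finsupp.single (g l') a, ?_, fun mu => ?_,
    fun mu hmu => ?_⟩
  · rw [hl.enum_eq, bar_ofList hn hℓ hs, he.eq_sum (isStraight_wedge n ℓ _), map_smul, Finsupp.sum,
      Finsupp.sum, map_sum]
    congr 1
    refine Finset.sum_congr rfl fun l' hl' => ?_
    rw [toWedge_single, (hg l' hl').1.enum_eq]
  · classical
    rw [hy]
    refine mul_mem (barFactor_mem _) (sum_mem fun l' _ => ?_)
    rw [Finsupp.single_apply]
    split_ifs
    exacts [he.mem_laurent l', zero_mem _]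
  · rw [hy] at hmu
    obtain ⟨l', hl', h'⟩ := Finset.exists_ne_zero_of_sum_ne_zero (right_ne_zero_of_mul hmu)
    obtain rfl : mu = g l' := by
      by_contra hc
      exact h' (Finsupp.single_eq_of_ne hc)
    exact (hg l' hl').2

/-- The image of the standard basis vector of `lam` under the bar involution. -/
def barVector (lam : MultiPartition ℓ) : Fock ℓ := (exists_toWedge_eq_bar n s lam).choose

theorem toWedge_barVector (lam : MultiPartition ℓ) : toWedge n s (barVector n s lam) =
    bar n ℓ (NeZero.pos n) (NeZero.pos ℓ) _ (wedge n ℓ (enum n lam s)) :=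
  (exists_toWedge_eq_bar n s lam).choose_spec.1

theorem barVector_mem_laurent (lam mu : MultiPartition ℓ) : barVector n s lam mu ∈ laurent :=
  (exists_toWedge_eq_bar n s lam).choose_spec.2.1 mu

theorem size_eq_of_barVector_ne_zero {lam mu : MultiPartition ℓ} (h : barVector n s lam mu ≠ 0) :
    size mu = size lam :=
  (exists_toWedge_eq_bar n s lam).choose_spec.2.2 mu h

variable {n s} in
theorem IsCoord.bar_wedge_enum {lam mu : MultiPartition ℓ}
    {f : Wedge n ℓ (∑ d, s d) →ₗ[Kq] Kq} (hf : IsCoord n ℓ (enum n mu s) f) :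
    f (bar n ℓ (NeZero.pos n) (NeZero.pos ℓ) _ (wedge n ℓ (enum n lam s))) =
      barVector n s lam mu := by
  rw [← toWedge_barVector, hf.apply_toWedge]

/-- The bar involution of the Fock space, in coordinates. -/
def fockBar : Fock ℓ →ₛₗ[conj] Fock ℓ where
  toFun x := Finsupp.linearCombination Kq (barVector n s) (x.mapRange conj (map_zero _))
  map_add' x y := by rw [Finsupp.mapRange_add (map_add conj), map_add]
  map_smul' a x := by
    rw [← map_smul]
    congr 1
    ext mu
    simp

theorem fockBar_single (lam : MultiPartition ℓ) :
    fockBar n s (Finsupp.single lam 1) = barVector n s lam := by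
  change Finsupp.linearCombination Kq (barVector n s) (Finsupp.mapRange conj _ _) = _
  rw [Finsupp.mapRange_single, map_one, Finsupp.linearCombination_single, one_smul]

theorem toWedge_fockBar (x : Fock ℓ) : toWedge n s (fockBar n s x) =
    bar n ℓ (NeZero.pos n) (NeZero.pos ℓ) _ (toWedge n s x) := by
  induction x using Finsupp.induction_linear with
  | zero => simp
  | add x y hx hy => simp only [map_add, hx, hy]
  | single lam a =>
    rw [← Finsupp.smul_single_one, LinearMap.map_smulₛₗ, map_smul, map_smul, LinearMap.map_smulₛₗ,
      fockBar_single, toWedge_barVector, toWedge_single, one_smul]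

theorem eventually_isBeadList_of_size (m : ℕ) :
    ∀ᶠ M : ℕ in atTop, ∀ lam : MultiPartition ℓ, size lam = m →
      ∃ l, IsBeadList n s M lam l ∧ IsStable (∑ d, s d) l :=
  ((finite_size_eq ℓ m).eventually_all).2 fun lam _ => eventually_isBeadList s lam

/-- The bar involution of the Fock space is unitriangular with respect to the sum of the squares
of a large number of leading entries, the same number for all multipartitions of one size. -/
theorem exists_isUnitriangular_fockBar : ∃ ρ, IsUnitriangular ρ (fockBar n s) := by
  have h : ∀ m, ∃ M : ℕ, ∀ lam : MultiPartition ℓ, size lam = m →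
      ∃ l, IsBeadList n s M lam l ∧ IsStable (∑ d, s d) l := fun m =>
    (eventually_isBeadList_of_size n s m).exists
  choose M hM using h
  have h : ∀ lam : MultiPartition ℓ, ∃ l, IsBeadList n s (M (size lam)) lam l ∧
      IsStable (∑ d, s d) l := fun lam => hM _ lam rfl
  choose l hl hs using h
  let ρ : MultiPartition ℓ → ℕ := fun lam => ((l lam).map fun k => k.natAbs ^ 2).sum
  have key : ∀ lam mu : MultiPartition ℓ, size mu = size lam → ρ lam ≤ ρ mu →
      barVector n s lam mu = (Finsupp.single lam 1 : Fock ℓ) mu := by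
    intro lam mu hsz hρ
    obtain ⟨f, hf⟩ := exists_isCoord_enum n s mu
    have hlen : (l lam).length = (l mu).length := by
      have h1 := (hl lam).length_eq (NeZero.pos n)
      have h2 := (hl mu).length_eq (NeZero.pos n)
      rw [hsz] at h2
      omega
    rw [← hf.bar_wedge_enum, ← hf.apply_toWedge, toWedge_single, one_smul, (hl lam).enum_eq]
    refine hf.bar_of_weight_le _ _ hlen (hs lam) (hl lam).pairwise ?_
    rw [(hl mu).enum_eq, firstEntries_ofList]
    have hcast : ∀ L : List ℤ, (L.map fun k => ((k.natAbs ^ 2 : ℕ) : ℚ)).sum =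
        ((L.map fun k => k.natAbs ^ 2).sum : ℕ) := fun L => by
      rw [Nat.cast_list_sum, List.map_map]; rfl
    rw [hcast, hcast]
    exact_mod_cast hρ
  refine ⟨ρ, ⟨fun x => ?_, fun i => ?_, fun i j h => ?_, fun i j => ?_⟩⟩
  · refine toWedge_injective n s ?_
    rw [toWedge_fockBar, toWedge_fockBar]
    exact (isBarInvolution_bar _ _ _).involutive _
  · rw [fockBar_single, key i i rfl le_rfl, Finsupp.single_eq_same]
  · rw [fockBar_single] at h
    by_contra hc
    rw [not_or, not_lt] at hc
    rw [key i j (size_eq_of_barVector_ne_zero n s h) hc.2, Finsupp.single_eq_of_ne hc.1] at h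
    exact h rfl
  · rw [fockBar_single]
    exact barVector_mem_laurent n s i j

theorem qPow_ne_zero (ε : ℤˣ) : qPow ε ≠ 0 := zpow_ne_zero _ q_ne_zero

theorem isCanonicalBasis_iff {ε : ℤˣ} {G : Module.Basis (MultiPartition ℓ) Kq (Fock ℓ)} :
    IsCanonicalBasis n ε s G ↔ ∀ lam, fockBar n s (G lam) = G lam ∧
      ∀ mu, (G lam - Finsupp.single lam 1 : Fock ℓ) mu ∈ positivePart ε := by
  constructor
  · rintro ⟨⟨σ, hσ, h⟩, hc⟩ lam
    refine ⟨toWedge_injective n s ?_, fun mu => ?_⟩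
    · rw [toWedge_fockBar, ← hσ.unique (isBarInvolution_bar _ _ _), h]
    · obtain ⟨y, hy, he⟩ := hc lam
      rw [he, add_sub_cancel_left]
      exact mem_positivePart.2 ⟨y mu, hy mu, rfl⟩
  · intro h
    refine ⟨⟨_, isBarInvolution_bar (NeZero.pos n) (NeZero.pos ℓ) _, fun lam => ?_⟩, fun lam => ?_⟩
    · rw [← toWedge_fockBar, (h lam).1]
    · refine ⟨(qPow ε)⁻¹ • (G lam - Finsupp.single lam 1), fun mu => ?_, ?_⟩
      · obtain ⟨a, ha, he⟩ := mem_positivePart.1 ((h lam).2 mu)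
        rw [Finsupp.smul_apply, ← he, smul_eq_mul, inv_mul_cancel_left₀ (qPow_ne_zero ε)]
        exact ha
      · rw [smul_inv_smul₀ (qPow_ne_zero ε), add_sub_cancel]

theorem existsUnique_isCanonicalBasis (ε : ℤˣ) : ∃! G, IsCanonicalBasis n ε s G := by
  obtain ⟨ρ, hρ⟩ := exists_isUnitriangular_fockBar n s
  obtain ⟨G, hG⟩ := hρ.exists_basis ε
  refine ⟨G, (isCanonicalBasis_iff n s).2 hG, fun G' hG' => ?_⟩
  replace hG' := (isCanonicalBasis_iff n s).1 hG'
  exact Module.Basis.eq_of_apply_eq fun lam =>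
    hρ.eq_of_mem_positivePart (hG' lam).1 (hG lam).1 (hG' lam).2 (hG lam).2

end FockBar

/-! ### Comparison of the levels `ℓ` and `ℓ + 1` -/

section Relabel

variable {n ℓ : ℕ}

/-- The increasing map of the positive integers whose image omits `j + 1`. -/
def skip (j : ℕ) (d : ℤ) : ℤ := if d ≤ j then d else d + 1

theorem skip_lt_skip {j : ℕ} {d d' : ℤ} : skip j d < skip j d' ↔ d < d' := by
  unfold skip
  split_ifs <;> omega

theorem skip_injective (j : ℕ) : Function.Injective (skip j) := fun d d' h => by
  unfold skip at h
  split_ifs at h <;> omega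

/-- The index at level `ℓ + 1` with the labels `c`, `m` of `k`, and with its label `d` moved past
the abacus `j`, which is left empty. -/
def relabel (n ℓ j : ℕ) (k : ℤ) : ℤ :=
  cPart n k + n * (skip j (dPart n ℓ k) - 1) - n * (ℓ + 1 : ℕ) * mPart n ℓ k

theorem relabel_parts (hn : 0 < n) (hℓ : 0 < ℓ) (j : ℕ) (k : ℤ) :
    cPart n (relabel n ℓ j k) = cPart n k ∧
      dPart n (ℓ + 1) (relabel n ℓ j k) = skip j (dPart n ℓ k) ∧
      mPart n (ℓ + 1) (relabel n ℓ j k) = mPart n ℓ k := by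
  obtain ⟨h1, h2⟩ := cPart_mem hn k
  obtain ⟨h3, h4⟩ := dPart_mem (n := n) hℓ k
  refine parts_eq h1 h2 ?_ ?_ rfl
  all_goals
    unfold skip
    push_cast
    split_ifs <;> omega

theorem relabel_eq {j : ℕ} {k k' : ℤ} (hc : cPart n k' = cPart n k)
    (hd : dPart n (ℓ + 1) k' = skip j (dPart n ℓ k)) (hm : mPart n (ℓ + 1) k' = mPart n ℓ k) :
    k' = relabel n ℓ j k := by
  rw [cdm_eq n (ℓ + 1) k', hc, hd, hm, relabel]

theorem relabel_strictMono (hn : 0 < n) (hℓ : 0 < ℓ) (j : ℕ) : StrictMono (relabel n ℓ j) := by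
  intro k k' h
  obtain ⟨h1, h2, h3⟩ := relabel_parts hn hℓ j k
  obtain ⟨h1', h2', h3'⟩ := relabel_parts hn hℓ j k'
  rw [lt_iff_parts hn (Nat.succ_pos ℓ), h1, h2, h3, h1', h2', h3', skip_lt_skip,
    (skip_injective j).eq_iff]
  exact (lt_iff_parts hn hℓ k k').1 h

theorem relabel_pos (hn : 0 < n) (j : Fin (ℓ + 1)) (d : Fin ℓ) (x : ℤ) :
    relabel n ℓ j (pos n ℓ d x) = pos n (ℓ + 1) (j.succAbove d) x := by
  have hℓ : 0 < ℓ := (Nat.zero_le _).trans_lt d.2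
  refine (relabel_eq (by rw [cPart_pos, cPart_pos]) ?_
    (by rw [mPart_pos hn, mPart_pos hn])).symm
  rw [dPart_pos hn, dPart_pos hn, skip, Fin.succAbove]
  split_ifs with h1 h2 h2 <;> simp only [Fin.lt_def, Fin.val_castSucc, Fin.val_succ] at h1 ⊢ <;>
    push_cast <;> omega

theorem corrRange_relabel (hn : 0 < n) (hℓ : 0 < ℓ) (j : ℕ) (k₂ k₁ : ℤ) :
    corrRange n (ℓ + 1) (relabel n ℓ j k₂) (relabel n ℓ j k₁) = corrRange n ℓ k₂ k₁ := by
  obtain ⟨h1, h2, h3⟩ := relabel_parts hn hℓ j k₁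
  obtain ⟨h1', h2', h3'⟩ := relabel_parts hn hℓ j k₂
  have h : skip j (dPart n ℓ k₁) ≤ skip j (dPart n ℓ k₂) ↔ dPart n ℓ k₁ ≤ dPart n ℓ k₂ := by
    rw [← not_lt, skip_lt_skip, not_lt]
  simp only [corrRange, h1, h2, h3, h1', h2', h3', h]

theorem corrFst_relabel (hn : 0 < n) (hℓ : 0 < ℓ) (j : ℕ) (k₂ k₁ i : ℤ) :
    corrFst n (ℓ + 1) (relabel n ℓ j k₂) (relabel n ℓ j k₁) i =
      relabel n ℓ j (corrFst n ℓ k₂ k₁ i) := by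
  obtain ⟨h1, h2, h3⟩ := corrFst_parts hn (Nat.succ_pos ℓ) (relabel n ℓ j k₂) (relabel n ℓ j k₁) i
  obtain ⟨h1', h2', h3'⟩ := corrFst_parts hn hℓ k₂ k₁ i
  refine relabel_eq ?_ ?_ ?_
  · rw [h1, h1', (relabel_parts hn hℓ j k₂).1]
  · rw [h2, h2', (relabel_parts hn hℓ j k₁).2.1]
  · rw [h3, h3', (relabel_parts hn hℓ j k₁).2.2]

theorem corrSnd_relabel (hn : 0 < n) (hℓ : 0 < ℓ) (j : ℕ) (k₂ k₁ i : ℤ) :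
    corrSnd n (ℓ + 1) (relabel n ℓ j k₂) (relabel n ℓ j k₁) i =
      relabel n ℓ j (corrSnd n ℓ k₂ k₁ i) := by
  obtain ⟨h1, h2, h3⟩ := corrSnd_parts hn (Nat.succ_pos ℓ) (relabel n ℓ j k₂) (relabel n ℓ j k₁) i
  obtain ⟨h1', h2', h3'⟩ := corrSnd_parts hn hℓ k₂ k₁ i
  refine relabel_eq ?_ ?_ ?_
  · rw [h1, h1', (relabel_parts hn hℓ j k₁).1]
  · rw [h2, h2', (relabel_parts hn hℓ j k₂).2.1]
  · rw [h3, h3', (relabel_parts hn hℓ j k₂).2.2]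

theorem IsStraight.comp_relabel (hn : 0 < n) (hℓ : 0 < ℓ) (j : ℕ) {M : Type*} [AddCommGroup M]
    [Module Kq M] {F : List ℤ → M} (hF : IsStraight n (ℓ + 1) F) :
    IsStraight n ℓ fun l => F (l.map (relabel n ℓ j)) := by
  intro pre post k₂ k₁ h
  have := hF (pre.map (relabel n ℓ j)) (post.map (relabel n ℓ j)) _ _
    ((relabel_strictMono hn hℓ j).monotone h)
  rw [corrRange_relabel hn hℓ, dFactor, cFactor, (relabel_parts hn hℓ j k₁).1,
    (relabel_parts hn hℓ j k₂).1, (relabel_parts hn hℓ j k₁).2.1, (relabel_parts hn hℓ j k₂).2.1] at this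
  simp only [(skip_injective j).eq_iff, corrFst_relabel hn hℓ, corrSnd_relabel hn hℓ] at this
  simpa only [List.map_append, List.map_cons, dFactor, cFactor] using this

theorem Step.map_relabel (hn : 0 < n) (hℓ : 0 < ℓ) (j : ℕ) {l l' : List ℤ} (h : Step n ℓ l l') :
    Step n (ℓ + 1) (l.map (relabel n ℓ j)) (l'.map (relabel n ℓ j)) := by
  cases h with
  | swap pre post k₂ k₁ h =>
    simp only [List.map_append, List.map_cons]
    exact Step.swap _ _ _ _ (relabel_strictMono hn hℓ j h)
  | corr pre post k₂ k₁ i h hi =>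
    simp only [List.map_append, List.map_cons, ← corrFst_relabel hn hℓ, ← corrSnd_relabel hn hℓ]
    exact Step.corr _ _ _ _ _ (relabel_strictMono hn hℓ j h)
      (by rwa [corrRange_relabel hn hℓ])

/-- The straightening rules of the two levels agree on the indices that avoid the abacus `j`. -/
theorem IsExpansion.mapDomain_relabel (hn : 0 < n) (hℓ : 0 < ℓ) (j : ℕ) {l : List ℤ}
    {e : List ℤ →₀ Kq} (he : IsExpansion n ℓ l e) :
    IsExpansion n (ℓ + 1) (l.map (relabel n ℓ j)) (e.mapDomain (List.map (relabel n ℓ j))) := by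
  classical
  have hinj : Function.Injective (List.map (relabel n ℓ j)) :=
    List.map_injective_iff.2 (relabel_strictMono hn hℓ j).injective
  have hsupp : ∀ l' ∈ (e.mapDomain (List.map (relabel n ℓ j))).support,
      ∃ l'' ∈ e.support, l''.map (relabel n ℓ j) = l' := fun l' h => by
    rw [Finsupp.mapDomain_support_of_injective hinj] at h
    exact Finset.mem_image.1 h
  refine ⟨fun l' => ?_, fun l' h => ?_, fun l' h => ?_, fun {M} _ _ F hF => ?_⟩
  · by_cases h : l' ∈ Set.range (List.map (relabel n ℓ j))
    · obtain ⟨l'', rfl⟩ := h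
      rw [Finsupp.mapDomain_apply hinj]
      exact he.mem_laurent l''
    · rw [Finsupp.mapDomain_of_notMem_range _ _ h]
      exact zero_mem _
  · obtain ⟨l'', h1, rfl⟩ := hsupp l' h
    exact List.pairwise_map.2 ((he.pairwise l'' h1).imp fun h => relabel_strictMono hn hℓ j h)
  · obtain ⟨l'', h1, rfl⟩ := hsupp l' h
    exact (he.reach l'' h1).lift _ fun _ _ h => h.map_relabel hn hℓ j
  · rw [Finsupp.sum_mapDomain_index_inj hinj]
    exact he.eq_sum (hF.comp_relabel hn hℓ j)

theorem pairProd_map {f : ℤ → ℤ} (hf : Function.Injective f) (x : Kq) (l : List ℤ) :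
    pairProd x (l.map f) = pairProd x l := by
  induction l with
  | nil => rfl
  | cons a l ih => rw [List.map_cons, pairProd, pairProd, ih, List.count_map_of_injective _ _ hf]

theorem barFactor_map_relabel (hn : 0 < n) (hℓ : 0 < ℓ) (j : ℕ) (l : List ℤ) :
    barFactor n (ℓ + 1) (l.map (relabel n ℓ j)) = barFactor n ℓ l := by
  have h1 : (l.map (relabel n ℓ j)).map (dPart n (ℓ + 1)) = (l.map (dPart n ℓ)).map (skip j) := by
    simp only [List.map_map]
    exact List.map_congr_left fun k _ => (relabel_parts hn hℓ j k).2.1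
  have h2 : (l.map (relabel n ℓ j)).map (cPart n) = l.map (cPart n) := by
    simp only [List.map_map]
    exact List.map_congr_left fun k _ => (relabel_parts hn hℓ j k).1
  rw [barFactor, h1, h2, pairProd_map (skip_injective j), barFactor]

end Relabel

section Insert

variable {n ℓ : ℕ}

theorem card_bot : (⊥ : YoungDiagram).card = 0 := Finset.card_empty

theorem colLen_bot : (⊥ : YoungDiagram).colLen 0 = 0 := by
  have := colLen_le_card (⊥ : YoungDiagram)
  rw [card_bot] at this
  omega

theorem size_eq_add_size_removeNth (j : Fin (ℓ + 1)) (lam : MultiPartition (ℓ + 1)) :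
    size lam = (lam j).card + size (j.removeNth lam : MultiPartition ℓ) :=
  Fin.sum_univ_succAbove _ j

theorem size_removeNth {j : Fin (ℓ + 1)} {lam : MultiPartition (ℓ + 1)} (h : lam j = ⊥) :
    size (j.removeNth lam : MultiPartition ℓ) = size lam := by
  rw [size_eq_add_size_removeNth j lam, h, card_bot, zero_add]

variable {s : Fin (ℓ + 1) → ℤ} {j : Fin (ℓ + 1)} {M : ℕ} {lam : MultiPartition (ℓ + 1)}

/-- The beads above `s j` are the same at both levels. -/
theorem IsBeadList.high_eq_map_relabel (hn : 0 < n) (hℓ : 0 < ℓ) (hj : lam j = ⊥) {l l' : List ℤ}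
    (h : IsBeadList n s M lam l) (h' : IsBeadList n (j.removeNth s) M (j.removeNth lam) l') :
    high n (ℓ + 1) (s j) l = (high n ℓ (s j) l').map (relabel n ℓ j) := by
  refine eq_of_mem_iff_of_pairwise (fun k => ?_) (h.pairwise.filter _)
    (List.pairwise_map.2 ((h'.pairwise.filter _).imp fun h => relabel_strictMono hn hℓ j h))
  rw [mem_high, h.mem_iff, List.mem_map]
  constructor
  · rintro ⟨⟨⟨d, r, rfl⟩, hk⟩, hT⟩
    rw [xPart_pos hn] at hT
    have hd : d ≠ j := by
      rintro rfl
      rw [hj, rowLen_eq_zero_of_colLen_le (by rw [colLen_bot]; omega)] at hT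
      push_cast at hT
      omega
    obtain ⟨d', rfl⟩ := Fin.exists_succAbove_eq hd
    refine ⟨_, ?_, relabel_pos hn j d' _⟩
    rw [mem_high, h'.mem_iff, xPart_pos hn, lt_pos_iff hn]
    exact ⟨⟨⟨d', r, rfl⟩, (lt_pos_iff hn _ _ _).1 hk⟩, hT⟩
  · rintro ⟨k, hk, rfl⟩
    rw [mem_high, h'.mem_iff] at hk
    obtain ⟨⟨⟨d', r, rfl⟩, hk⟩, hT⟩ := hk
    rw [xPart_pos hn] at hT
    rw [relabel_pos hn, xPart_pos hn, lt_pos_iff hn]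
    exact ⟨⟨⟨_, r, rfl⟩, (lt_pos_iff hn _ _ _).1 hk⟩, hT⟩

theorem IsBeadList.sub_length [NeZero n] {ℓ : ℕ} {s : Fin ℓ → ℤ} {lam : MultiPartition ℓ}
    {l : List ℤ} (h : IsBeadList n s M lam l) : ∑ d, s d - l.length = -(n * ℓ * M : ℤ) := by
  rw [h.length_eq (NeZero.pos n)]; ring

/-- If all components but the `j`-th have charges much larger than `s j`, and the `j`-th component
is empty, then all positions up to `s j` are filled. -/
theorem add_colLen_le (hsmall : ∀ i, i ≠ j → (size lam : ℤ) ≤ s i - s j) (hj : lam j = ⊥)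
    (d : Fin (ℓ + 1)) : s j + (lam d).colLen 0 ≤ s d := by
  by_cases hd : d = j
  · rw [hd, hj, colLen_bot]; simp
  · have h1 : (lam d).card ≤ size lam :=
      Finset.single_le_sum (f := fun d => (lam d).card) (fun _ _ => Nat.zero_le _)
        (Finset.mem_univ d)
    have h2 := colLen_le_card (lam d)
    have h3 := hsmall d hd
    omega

variable [NeZero n] {mu : MultiPartition (ℓ + 1)}

/-- The coefficients of the bar involution agree at the two levels. -/
theorem barVector_removeNth [NeZero ℓ] (hsize : size lam = size mu)
    (hsmall : ∀ i, i ≠ j → (size mu : ℤ) ≤ s i - s j) (hlam : lam j = ⊥) (hmu : mu j = ⊥) :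
    barVector n s lam mu = barVector n (j.removeNth s) (j.removeNth lam) (j.removeNth mu) := by
  have hn := NeZero.pos n
  have hℓ := NeZero.pos ℓ
  obtain ⟨M, hM, hM'⟩ := ((eventually_isBeadList_of_size n s (size mu)).and
    (eventually_isBeadList_of_size n (j.removeNth s : Fin ℓ → ℤ) (size mu))).exists
  obtain ⟨L, hL, hLs⟩ := hM lam hsize
  obtain ⟨K, hK, hKs⟩ := hM mu rfl
  obtain ⟨L', hL', hLs'⟩ := hM' (j.removeNth lam) ((size_removeNth hlam).trans hsize)
  obtain ⟨K', hK', hKs'⟩ := hM' (j.removeNth mu) (size_removeNth hmu)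
  have hTlam := add_colLen_le (hsize ▸ hsmall) hlam
  have hTmu := add_colLen_le hsmall hmu
  obtain ⟨f, hf⟩ := exists_isCoord_enum n s mu
  obtain ⟨f', hf'⟩ := exists_isCoord_enum n (j.removeNth s : Fin ℓ → ℤ) (j.removeNth mu)
  obtain ⟨e, he⟩ := exists_expansion hn hℓ (high n ℓ (s j) L').reverse
  have hlen : L.length = K.length := by
    have h1 := hL.length_eq hn
    have h2 := hK.length_eq hn
    omega
  have hlen' : L'.length = K'.length := by
    have h1 := hL'.length_eq hn
    have h2 := hK'.length_eq hn
    omega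
  have hinj : Function.Injective (List.map (relabel n ℓ j)) :=
    List.map_injective_iff.2 (relabel_strictMono hn hℓ j).injective
  rw [← hf.bar_wedge_enum, ← hf'.bar_wedge_enum, hL.enum_eq, hL'.enum_eq,
    hf'.bar_of_isFull hn hℓ (T := s j) hL'.pairwise hK'.pairwise hLs' hKs'.1 hlen' hK'.enum_eq
      (by rw [hK'.sub_length]; exact hK'.isFull hn hℓ fun d => hTmu _)
      (by rw [hK'.sub_length]; exact hL'.isFull hn hℓ fun d => hTlam _) he,
    hf.bar_of_isFull hn (Nat.succ_pos ℓ) (T := s j) hL.pairwise hK.pairwise hLs hKs.1 hlen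
      hK.enum_eq
      (by rw [hK.sub_length]; exact hK.isFull hn (Nat.succ_pos ℓ) hTmu)
      (by rw [hK.sub_length]; exact hL.isFull hn (Nat.succ_pos ℓ) hTlam)
      (e := e.mapDomain (List.map (relabel n ℓ j)))
      (by
        rw [hL.high_eq_map_relabel hn hℓ hlam hL', ← List.map_reverse]
        exact he.mapDomain_relabel hn hℓ j),
    hL.high_eq_map_relabel hn hℓ hlam hL', hK.high_eq_map_relabel hn hℓ hmu hK',
    barFactor_map_relabel hn hℓ, Finsupp.mapDomain_apply hinj]

/-- A multipartition with nonempty `j`-th component has no coefficient at one with empty `j`-th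
component. -/
theorem barVector_eq_zero (hsize : size lam = size mu)
    (hsmall : ∀ i, i ≠ j → (size mu : ℤ) ≤ s i - s j) (hlam : lam j ≠ ⊥) (hmu : mu j = ⊥) :
    barVector n s lam mu = 0 := by
  have hn := NeZero.pos n
  obtain ⟨M, hM⟩ := (eventually_isBeadList_of_size n s (size mu)).exists
  obtain ⟨L, hL, hLs⟩ := hM lam hsize
  obtain ⟨K, hK, hKs⟩ := hM mu rfl
  obtain ⟨f, hf⟩ := exists_isCoord_enum n s mu
  have hlen : L.length = K.length := by
    have h1 := hL.length_eq hn
    have h2 := hK.length_eq hn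
    omega
  rw [← hf.bar_wedge_enum, hL.enum_eq]
  refine hf.bar_of_not_isFull hn (Nat.succ_pos ℓ) (T := s j) hL.pairwise hK.pairwise hLs hlen
    hK.enum_eq ?_ ?_
  · rw [hK.sub_length]
    exact hK.isFull hn (Nat.succ_pos ℓ) (add_colLen_le hsmall hmu)
  · rw [hK.sub_length]
    exact fun h => hlam (hL.eq_bot_of_isFull hn h)

end Insert

section Restrict

variable {n ℓ : ℕ} [NeZero n]

/-- The part of a vector of the Fock space supported by the multipartitions of size `m`. -/
def sizePart (m : ℕ) (x : Fock ℓ) : Fock ℓ := x.filter (size · = m)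

theorem sizePart_apply (m : ℕ) (x : Fock ℓ) (mu : MultiPartition ℓ) :
    sizePart m x mu = if size mu = m then x mu else 0 := Finsupp.filter_apply _ _ _

theorem fockBar_sizePart [NeZero ℓ] (s : Fin ℓ → ℤ) (m : ℕ) (x : Fock ℓ) :
    fockBar n s (sizePart m x) = sizePart m (fockBar n s x) := by
  induction x using Finsupp.induction_linear with
  | zero =>
    have h : sizePart m (0 : Fock ℓ) = 0 := Finsupp.filter_zero _
    rw [h, map_zero, h]
  | add x y hx hy =>
    have h : ∀ x y : Fock ℓ, sizePart m (x + y) = sizePart m x + sizePart m y := fun x y =>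
      Finsupp.filter_add
    rw [h, map_add, map_add, h, hx, hy]
  | single lam a =>
    ext mu
    rw [sizePart_apply, ← Finsupp.smul_single_one, LinearMap.map_smulₛₗ, fockBar_single,
      Finsupp.smul_apply]
    by_cases h : size lam = m
    · rw [sizePart, Finsupp.smul_single_one, Finsupp.filter_single_of_pos (size · = m) h,
        ← Finsupp.smul_single_one, LinearMap.map_smulₛₗ, fockBar_single, Finsupp.smul_apply]
      split_ifs with h'
      · rfl
      · rw [by_contra fun hc => h' ((size_eq_of_barVector_ne_zero n s hc).trans h), smul_zero]
    · rw [sizePart, Finsupp.smul_single_one, Finsupp.filter_single_of_neg (size · = m) h, map_zero,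
        Finsupp.zero_apply]
      split_ifs with h'
      · rw [by_contra fun hc => h ((size_eq_of_barVector_ne_zero n s hc).symm.trans h'), smul_zero]
      · rfl

/-- The multipartition with the empty diagram inserted at the place `j`. -/
def insertBot (j : Fin (ℓ + 1)) (mu : MultiPartition ℓ) : MultiPartition (ℓ + 1) :=
  j.insertNth (α := fun _ => YoungDiagram) ⊥ mu

theorem insertBot_self (j : Fin (ℓ + 1)) (mu : MultiPartition ℓ) : insertBot j mu j = ⊥ :=
  Fin.insertNth_apply_same _ _ _

theorem removeNth_insertBot (j : Fin (ℓ + 1)) (mu : MultiPartition ℓ) :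
    j.removeNth (insertBot j mu) = mu :=
  Fin.removeNth_insertNth _ _ _

theorem insertBot_removeNth {j : Fin (ℓ + 1)} {mu : MultiPartition (ℓ + 1)} (h : mu j = ⊥) :
    insertBot j (j.removeNth mu) = mu := by
  rw [insertBot, Fin.insertNth_removeNth, ← h, Function.update_eq_self]

theorem insertBot_injective (j : Fin (ℓ + 1)) :
    Function.Injective (insertBot j : MultiPartition ℓ → _) := fun mu mu' h => by
  rw [← removeNth_insertBot j mu, h, removeNth_insertBot]

theorem size_insertBot (j : Fin (ℓ + 1)) (mu : MultiPartition ℓ) :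
    size (insertBot j mu) = size mu := by
  rw [← size_removeNth (insertBot_self j mu), removeNth_insertBot]

/-- The coordinates of a vector at level `ℓ + 1` at the multipartitions of size `m` whose `j`-th
component is empty, as a vector at level `ℓ`. -/
def restrict (j : Fin (ℓ + 1)) (m : ℕ) (x : Fock (ℓ + 1)) : Fock ℓ :=
  sizePart m (x.comapDomain (insertBot j) (insertBot_injective j).injOn)

theorem restrict_apply (j : Fin (ℓ + 1)) (m : ℕ) (x : Fock (ℓ + 1)) (mu : MultiPartition ℓ) :
    restrict j m x mu = if size mu = m then x (insertBot j mu) else 0 :=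
  sizePart_apply _ _ _

theorem restrict_add (j : Fin (ℓ + 1)) (m : ℕ) (x y : Fock (ℓ + 1)) :
    restrict j m (x + y) = restrict j m x + restrict j m y := by
  ext mu
  simp only [restrict_apply, Finsupp.add_apply]
  split_ifs
  · rfl
  · rw [add_zero]

theorem restrict_smul (j : Fin (ℓ + 1)) (m : ℕ) (a : Kq) (x : Fock (ℓ + 1)) :
    restrict j m (a • x) = a • restrict j m x := by
  ext mu
  simp only [restrict_apply, Finsupp.smul_apply]
  split_ifs
  · rfl
  · rw [smul_zero]

/-- In sizes that are small compared with the charges, restriction commutes with the bar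
involutions of the two levels. -/
theorem fockBar_restrict [NeZero ℓ] {s : Fin (ℓ + 1) → ℤ} {j : Fin (ℓ + 1)} {m : ℕ}
    (hsmall : ∀ i, i ≠ j → (m : ℤ) ≤ s i - s j) (x : Fock (ℓ + 1)) :
    fockBar n (j.removeNth s : Fin ℓ → ℤ) (restrict j m x) = restrict j m (fockBar n s x) := by
  induction x using Finsupp.induction_linear with
  | zero =>
    have : restrict j m (0 : Fock (ℓ + 1)) = 0 := by
      rw [← zero_smul Kq (0 : Fock (ℓ + 1)), restrict_smul, zero_smul]
    rw [this, map_zero, map_zero, this]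
  | add x y hx hy => rw [restrict_add, map_add, map_add, restrict_add, hx, hy]
  | single lam a =>
    rw [← Finsupp.smul_single_one, LinearMap.map_smulₛₗ, restrict_smul, LinearMap.map_smulₛₗ,
      restrict_smul, fockBar_single]
    congr 1
    ext kap
    rw [restrict_apply]
    by_cases h : size lam = m ∧ lam j = ⊥
    · obtain ⟨h1, h2⟩ := h
      have h3 : restrict j m (Finsupp.single lam 1) = Finsupp.single (j.removeNth lam) 1 := by
        ext mu
        rw [restrict_apply]
        by_cases h4 : mu = j.removeNth lam
        · rw [h4, size_removeNth h2, insertBot_removeNth h2, if_pos h1, Finsupp.single_eq_same,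
            Finsupp.single_eq_same]
        · rw [Finsupp.single_eq_of_ne h4, Finsupp.single_eq_of_ne fun h =>
            h4 (by rw [← h, removeNth_insertBot]), ite_self]
      rw [h3, fockBar_single]
      by_cases hk : size kap = m
      · have h5 := barVector_removeNth (n := n) (s := s) (j := j) (lam := lam)
          (mu := insertBot j kap) (by rw [size_insertBot, h1, hk])
          (by rwa [size_insertBot, hk]) h2 (insertBot_self j kap)
        rw [if_pos hk, h5, removeNth_insertBot]
      · rw [if_neg hk]
        by_contra hc
        exact hk ((size_eq_of_barVector_ne_zero _ _ hc).trans ((size_removeNth h2).trans h1))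
    · have h3 : restrict j m (Finsupp.single lam 1) = 0 := by
        ext mu
        rw [restrict_apply, Finsupp.zero_apply, ite_eq_right_iff]
        rintro rfl
        refine Finsupp.single_eq_of_ne ?_
        rintro rfl
        exact h ⟨size_insertBot j mu, insertBot_self j mu⟩
      rw [h3, map_zero, Finsupp.zero_apply, eq_comm, ite_eq_right_iff]
      intro hk
      by_cases h1 : size lam = m
      · exact barVector_eq_zero (by rw [size_insertBot, h1, hk]) (by rwa [size_insertBot, hk])
          (fun h2 => h ⟨h1, h2⟩) (insertBot_self j kap)
      · by_contra hc
        exact h1 (by rw [← size_eq_of_barVector_ne_zero n s hc, size_insertBot, hk])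

end Restrict

end

end QFock

theorem theoremB (n ℓ : ℕ) [NeZero n] [NeZero ℓ] (hn : 2 ≤ n) (ε : ℤˣ)
    (s : Fin (ℓ + 1) → ℤ) (j : Fin (ℓ + 1)) (lam mu : QFock.MultiPartition (ℓ + 1))
    (hsize : QFock.size lam = QFock.size mu ∨ lam j = ⊥)
    (hsmall : ∀ i, i ≠ j → (QFock.size mu : ℤ) ≤ s i - s j)
    (hmu : mu j = ⊥) :
    (∃! G, QFock.IsCanonicalBasis n ε s G) ∧
    (∃! G', QFock.IsCanonicalBasis n ε (j.removeNth s) G') ∧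
    ∀ G G', QFock.IsCanonicalBasis n ε s G →
      QFock.IsCanonicalBasis n ε (j.removeNth s) G' →
      G lam mu = G' (j.removeNth lam) (j.removeNth mu) := by
  refine ⟨QFock.existsUnique_isCanonicalBasis n s ε, QFock.existsUnique_isCanonicalBasis n _ ε,
    fun G G' hG hG' => ?_⟩
  obtain ⟨hG1, hG2⟩ := (QFock.isCanonicalBasis_iff n s).1 hG lam
  obtain ⟨hG1', hG2'⟩ := (QFock.isCanonicalBasis_iff n _).1 hG' (j.removeNth lam)
  obtain ⟨ρ, hρ⟩ := QFock.exists_isUnitriangular_fockBar n (j.removeNth s : Fin ℓ → ℤ)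
  -- Restricted to the size of `mu`, both canonical basis vectors give invariant vectors at level `ℓ`,
  -- whose difference has coordinates in `q^ε ℚ[q^ε]`.
  have hz := hρ.eq_zero (ε := ε)
    (x := QFock.restrict j (QFock.size mu) (G lam) -
      QFock.sizePart (QFock.size mu) (G' (j.removeNth lam)))
    (by rw [map_sub, QFock.fockBar_restrict hsmall, QFock.fockBar_sizePart, hG1, hG1'])
    (fun kap => by
      rw [Finsupp.sub_apply, QFock.restrict_apply, QFock.sizePart_apply]
      split_ifs with hk
      · have h1 : (Finsupp.single lam 1 : QFock.Fock (ℓ + 1)) (QFock.insertBot j kap) =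
            (Finsupp.single (j.removeNth lam) 1 : QFock.Fock ℓ) kap := by
          by_cases h : kap = j.removeNth lam
          · have hbot : lam j = ⊥ := by
              refine hsize.elim (fun hs => ?_) id
              have h2 := QFock.size_eq_add_size_removeNth j lam
              rw [← h, hk, hs] at h2
              have h3 : (lam j).card = 0 := by omega
              exact YoungDiagram.ext (by simpa using Finset.card_eq_zero.1 h3)
            rw [h, QFock.insertBot_removeNth hbot, Finsupp.single_eq_same, Finsupp.single_eq_same]
          · rw [Finsupp.single_eq_of_ne h, Finsupp.single_eq_of_ne fun h' =>
              h (by rw [← h', QFock.removeNth_insertBot])]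
        have h2 := sub_mem (hG2 (QFock.insertBot j kap)) (hG2' kap)
        rwa [Finsupp.sub_apply, Finsupp.sub_apply, h1, sub_sub_sub_cancel_right] at h2
      · rw [sub_zero]
        exact zero_mem _)
  have h := DFunLike.congr_fun hz (j.removeNth mu)
  have h1 : QFock.size (j.removeNth mu : QFock.MultiPartition ℓ) = QFock.size mu :=
    QFock.size_removeNth hmu
  rwa [Finsupp.sub_apply, QFock.restrict_apply, QFock.sizePart_apply, if_pos h1, if_pos h1,
    QFock.insertBot_removeNth hmu, Finsupp.zero_apply, sub_eq_zero] at h
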